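/- Let $0\le\alpha<2$. For $a\in\mathbb C$, $t>0$ and $s\in\mathbb R$ put $$u_a(s,t)=a\,\frac{e^{i s^2/(4t)}}{\sqrt t},\qquad A_{a,\alpha}(t)=\frac{|a|^\alpha}{1-\alpha/2}\,t^{1-\alpha/2},\qquad u_{a,\pm\alpha}(s,t)=u_a(s,t)\,e^{\pm iA_{a,\alpha}(t)},$$ so that $u_{a,\pm\alpha}$ solves $iu_t+u_{ss}\pm|u|^\alpha u=0$ for $t>0$ and converges to $2\sqrt\pi\,e^{i\pi/4}\,a\,\delta$ in $\mathcal S'(\mathbb R)$ as $t\downarrow0$. Then there is a time $T=T(a,\|u_0\|_{L^2})>0$ (for the given $\alpha$, depending only on $a$ and $\|u_0\|_{L^2}$) such that for either choice of the sign, for every $a\in\mathbb C$ and every $u_0\in L^2(\mathbb R)$ there exists exactly one function $u$ on $(0,T)\times\mathbb R$ (as a family of functions $u(t)$ of $s$, each determined up to null sets) with the following properties: 1. $u$ and $|u|^\alpha u$ are locally integrable on $(0,T)\times\mathbb R$ and $iu_t+u_{ss}\pm|u|^\alpha u=0$ there in the sense of distributions; 2. $u$ has the initial data $u_0+2\sqrt\pi\,e^{i\pi/4}\,a\,\delta$,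 that is, $u(t)\to u_0+2\sqrt\pi\,e^{i\pi/4}\,a\,\delta$ in $\mathcal S'(\mathbb R)$ as $t\downarrow0$; 3. $u-u_{a,\pm\alpha}\in L^4\big([0,T),L^\infty(\mathbb R)\big)\cap C\big([0,T),L^2(\mathbb R)\big)$. -/

import Mathlib

open MeasureTheory Filter Topology Set
open scoped ContDiff SchwartzMap

namespace DiracNLS

/-- The solution `u_a(s,t) = a e^{i s²/(4t)} / √t` of the free Schrödinger equation (used for
`t > 0`). Functions of time and space are written `u t s`. -/
noncomputable def freeDirac (a : ℂ) (t s : ℝ) : ℂ :=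
  a * Complex.exp (Complex.I * ((s ^ 2 / (4 * t) : ℝ) : ℂ)) / ((Real.sqrt t : ℝ) : ℂ)

/-- The phase `A_{a,α}(t) = |a|^α t^{1-α/2} / (1 - α/2)`, for `α ≠ 2`. -/
noncomputable def phase (a : ℂ) (α t : ℝ) : ℝ :=
  ‖a‖ ^ α / (1 - α / 2) * t ^ (1 - α / 2)

/-- The explicit solution `u_{a,±α}(s,t) = u_a(s,t) e^{± i A_{a,α}(t)}` of
`i u_t + u_ss ± |u|^α u = 0`; the sign `±` is `σ ∈ {1, -1}`. -/
noncomputable def diracSol (a : ℂ) (α σ : ℝ) (t s : ℝ) : ℂ :=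
  freeDirac a t s * Complex.exp (Complex.I * ((σ * phase a α t : ℝ) : ℂ))

/-- The mass of the Dirac distribution to which `u_1` converges as `t ↓ 0`:
`u_a(·,t) → a (2 √π e^{iπ/4}) δ`. -/
noncomputable def diracMass : ℂ :=
  2 * ((Real.sqrt Real.pi : ℝ) : ℂ) * Complex.exp (Complex.I * ((Real.pi / 4 : ℝ) : ℂ))

/-- The nonlinearity `|z|^α z`. -/
noncomputable def powerNL (α : ℝ) (z : ℂ) : ℂ :=
  ((‖z‖ ^ α : ℝ) : ℂ) * z

/-- `u` is a solution of `i u_t + u_ss + σ |u|^α u = 0` on `(0,T) × ℝ` in the sense of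
distributions. -/
structure IsDistribSolution (α σ T : ℝ) (u : ℝ → ℝ → ℂ) : Prop where
  locInt : LocallyIntegrableOn (fun p : ℝ × ℝ => u p.1 p.2) (Ioo 0 T ×ˢ univ)
  locInt_powerNL :
    LocallyIntegrableOn (fun p : ℝ × ℝ => powerNL α (u p.1 p.2)) (Ioo 0 T ×ˢ univ)
  weak : ∀ φ : ℝ × ℝ → ℂ, ContDiff ℝ ∞ φ → HasCompactSupport φ →
    tsupport φ ⊆ Ioo 0 T ×ˢ univ →
    ∫ p : ℝ × ℝ,
      (u p.1 p.2 * (-Complex.I * deriv (fun t => φ (t, p.2)) p.1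
          + iteratedDeriv 2 (fun s => φ (p.1, s)) p.2)
        + (σ : ℂ) * powerNL α (u p.1 p.2) * φ p) = 0

/-- `u` takes the initial data `u₀ + m δ`: `u(t) → u₀ + m δ` in `𝓢'(ℝ)` as `t ↓ 0`. -/
def HasInitialData (u : ℝ → ℝ → ℂ) (u₀ : ℝ → ℂ) (m : ℂ) : Prop :=
  ∀ φ : 𝓢(ℝ, ℂ),
    Tendsto (fun t : ℝ => ∫ s, u t s * φ s) (𝓝[>] 0) (𝓝 ((∫ s, u₀ s * φ s) + m * φ 0))

/-- `w ∈ C([0,T), L²(ℝ))`, for a function `w` that is given at the times `0 < t < T`: it extends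
to a continuous curve `[0,T) → L²(ℝ)`. -/
def MemCL2 (T : ℝ) (w : ℝ → ℝ → ℂ) : Prop :=
  ∃ W : ℝ → Lp ℂ 2 (volume : Measure ℝ), ContinuousOn W (Ico 0 T) ∧
    ∀ t ∈ Ioo 0 T, w t =ᵐ[volume] W t

/-- `w ∈ L⁴([0,T), L^∞(ℝ))`. -/
def MemL4Linfty (T : ℝ) (w : ℝ → ℝ → ℂ) : Prop :=
  AEStronglyMeasurable (fun p : ℝ × ℝ => w p.1 p.2) (volume.restrict (Ioo 0 T ×ˢ univ)) ∧
    ∫⁻ t in Ioo 0 T, eLpNorm (w t) ⊤ volume ^ 4 < ⊤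

/-- `u` solves `i u_t + u_ss + σ |u|^α u = 0` on `(0,T) × ℝ`, it has the initial data of
`u_{a,σα}` plus `u₀`, and `u - u_{a,σα} ∈ L⁴([0,T), L^∞) ∩ C([0,T), L²)`. -/
structure IsPerturbedSolution (α σ : ℝ) (a : ℂ) (u₀ : ℝ → ℂ) (T : ℝ) (u : ℝ → ℝ → ℂ) :
    Prop where
  equation : IsDistribSolution α σ T u
  initial : HasInitialData u u₀ (a * diracMass)
  mem_L4Linfty : MemL4Linfty T (fun t s => u t s - diracSol a α σ t s)
  mem_CL2 : MemCL2 T (fun t s => u t s - diracSol a α σ t s)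

end DiracNLS

/-! Write u = u_{a,σα} + w. For a ≠ 0 the explicit solution is not in L², but its modulus |a|/√t
does not depend on s. The perturbation therefore solves i w_t + w_ss + σ(|u|^α u - |u_{a,σα}|^α
u_{a,σα}) = 0 with data u₀ in L², and two perturbations v, w at time t have nonlinear terms whose L²
distance is at most 3(|a|/√t + n)^α ‖v - w‖, where n is the sum of their sup norms
(`norm_nlDiff_sub_le`). This weight is integrable in time: t^{-α/2} is integrable at 0 since α < 2,
and n^α is dominated by 1 + 1/δ + δ n⁴ (`lipWeight_le`). The forcing thus lies in L¹_t L²_x, which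
explains the class L⁴_t L^∞_x ∩ C_t L²_x.

The linear tool is the Strichartz estimate for e^{it∂²} from L² to L⁴_t L^∞_x (`strichartz`),
together with its Duhamel version for L¹_t L²_x forcing (`strichartz_primitive`). The first comes
from the TT* method: the kernel decays like |t|^{-1/2}, and the resulting bilinear form in time is
bounded by the diagonal Hardy–Littlewood–Sobolev inequality (`hardyLittlewoodSobolev`). A heat
factor makes all integrals converge and is removed by Fatou's lemma.

Existence is a contraction for the Duhamel equation (`exists_isMild`). The time is fixed by the
requirement that the weight have integral at most 1/2, which involves only a, α and the size of the
data. The passage to distributions is an integration by parts in the interaction picture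
(`IsMild.isWeak`), combined with a direct verification for the explicit solution
(`integral_diracSol`). The Dirac mass is found from the Fourier transform of a Gaussian with
imaginary parameter (`tendsto_diracSol`).

Uniqueness has to cover the whole class and not only the ball of the contraction. The initial
condition forces w(0) = u₀. The difference D of two perturbations solves a linear inhomogeneous
equation in the weak sense with zero data and source N. On the Fourier side, after multiplication by
(1 + λ/(n+1))⁻¹, this becomes an integral equation in L², and testing with a free solution gives
‖D(t)‖ ≤ ∫₀ᵗ ‖N‖ (`IsWeakFree.norm_le`). As ‖N‖ is at most an integrable weight times ‖D‖,
Gronwall's inequality yields D = 0 (`IsWeak.eq`). -/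

namespace DiracNLS

/-! ### Curves in L²(ℝ): dominated convergence, measurability, essential suprema -/

section L2

open scoped ENNReal

/-- The Hilbert space `L²(ℝ)`. -/
abbrev L2R : Type := Lp ℂ 2 (volume : Measure ℝ)

open Classical in
/-- The class of a function in `L²(ℝ)`, zero if the function is not square integrable. -/
noncomputable def toL2 (f : ℝ → ℂ) : L2R :=
  if h : MemLp f 2 volume then h.toLp f else 0

theorem toL2_eq {f : ℝ → ℂ} (h : MemLp f 2 volume) : toL2 f = h.toLp f := by
  simp [toL2, h]

theorem coeFn_toL2 {f : ℝ → ℂ} (h : MemLp f 2 volume) : toL2 f =ᵐ[volume] f := by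
  rw [toL2_eq h]; exact h.coeFn_toLp

theorem toL2_congr {f g : ℝ → ℂ} (h : f =ᵐ[volume] g) : toL2 f = toL2 g := by
  by_cases hf : MemLp f 2 volume
  · rw [toL2_eq hf, toL2_eq ((memLp_congr_ae h).1 hf)]
    exact (MemLp.toLp_eq_toLp_iff _ _).2 h
  · have hg : ¬ MemLp g 2 volume := fun hg => hf ((memLp_congr_ae h).2 hg)
    simp [toL2, hf, hg]

@[simp] theorem toL2_coeFn (f : L2R) : toL2 f = f := by
  rw [toL2_eq (Lp.memLp f)]; exact Lp.toLp_coeFn _ _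

theorem toL2_add {f g : ℝ → ℂ} (hf : MemLp f 2 volume) (hg : MemLp g 2 volume) :
    toL2 (fun s => f s + g s) = toL2 f + toL2 g := by
  rw [toL2_eq hf, toL2_eq hg, ← MemLp.toLp_add hf hg, ← toL2_eq (hf.add hg)]; rfl

theorem toL2_sub {f g : ℝ → ℂ} (hf : MemLp f 2 volume) (hg : MemLp g 2 volume) :
    toL2 (fun s => f s - g s) = toL2 f - toL2 g := by
  rw [toL2_eq hf, toL2_eq hg, ← MemLp.toLp_sub hf hg, ← toL2_eq (hf.sub hg)]; rfl

theorem toL2_const_mul {f : ℝ → ℂ} (c : ℂ) (hf : MemLp f 2 volume) :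
    toL2 (fun s => c * f s) = c • toL2 f := by
  rw [toL2_eq hf, ← MemLp.toLp_const_smul c hf, ← toL2_eq (hf.const_smul c)]; rfl

theorem norm_toL2_le {f : ℝ → ℂ} {g : L2R} {c : ℝ} (hc : 0 ≤ c)
    (h : ∀ᵐ s, ‖f s‖ ≤ c * ‖g s‖) : ‖toL2 f‖ ≤ c * ‖g‖ := by
  by_cases hf : MemLp f 2 volume
  · refine Lp.norm_le_mul_norm_of_ae_le_mul ?_
    filter_upwards [h, coeFn_toL2 hf] with s hs hs'
    rwa [hs']
  · simp only [toL2, hf, dite_false, norm_zero]; positivity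

/-- The inner product of `L²` as an integral. -/
theorem inner_toL2 {f : ℝ → ℂ} (hf : MemLp f 2 volume) (g : L2R) :
    inner ℂ (toL2 f) g = ∫ s, g s * starRingEnd ℂ (f s) := by
  rw [L2.inner_def]
  refine integral_congr_ae ?_
  filter_upwards [coeFn_toL2 hf] with s hs
  rw [hs]; rfl

theorem sq_norm_toL2 {f : ℝ → ℂ} (hf : MemLp f 2 volume) :
    ‖toL2 f‖ ^ 2 = ∫ s, ‖f s‖ ^ 2 := by
  have h2 : ∫ s, toL2 f s * starRingEnd ℂ (f s) = ((∫ s, ‖f s‖ ^ 2 : ℝ) : ℂ) := by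
    rw [← integral_complex_ofReal]
    refine integral_congr_ae ?_
    filter_upwards [coeFn_toL2 hf] with s hs
    rw [hs, Complex.mul_conj, Complex.normSq_eq_norm_sq]
  rw [@norm_sq_eq_re_inner ℂ, inner_toL2 hf, h2]
  exact Complex.ofReal_re _

/-- Dominated convergence in `L²`. -/
theorem tendsto_toL2 {ι : Type*} {l : Filter ι} [l.IsCountablyGenerated] {F : ι → ℝ → ℂ}
    {f : ℝ → ℂ} {B : ℝ → ℝ} (hB : MemLp B 2 volume)
    (hF : ∀ᶠ n in l, AEStronglyMeasurable (F n) volume)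
    (hf : AEStronglyMeasurable f volume)
    (hb : ∀ᶠ n in l, ∀ᵐ s, ‖F n s‖ ≤ B s) (hfb : ∀ᵐ s, ‖f s‖ ≤ B s)
    (h : ∀ᵐ s, Tendsto (fun n => F n s) l (𝓝 (f s))) :
    Tendsto (fun n => toL2 (F n)) l (𝓝 (toL2 f)) := by
  have hfm : MemLp f 2 volume := hB.mono' hf hfb
  have hFm : ∀ᶠ n in l, MemLp (F n) 2 volume := by
    filter_upwards [hF, hb] with n h1 h2 using hB.mono' h1 h2
  rw [tendsto_iff_dist_tendsto_zero]
  have key : Tendsto (fun n => ∫ s, ‖F n s - f s‖ ^ 2) l (𝓝 0) := by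
    have h0 : (∫ _ : ℝ, (0 : ℝ)) = 0 := by simp
    rw [← h0]
    refine tendsto_integral_filter_of_dominated_convergence (fun s => (2 * B s) ^ 2)
      ?_ ?_ (hB.const_mul 2).integrable_sq ?_
    · filter_upwards [hF] with n hn
      exact ((hn.sub hf).norm.pow _)
    · filter_upwards [hb] with n hn
      filter_upwards [hn, hfb] with s h1 h2
      rw [Real.norm_of_nonneg (by positivity)]
      gcongr
      exact (norm_sub_le _ _).trans (by linarith)
    · filter_upwards [h] with s hs
      simpa using ((hs.sub_const (f s)).norm.pow 2)
  have key2 := (Real.continuous_sqrt.tendsto 0).comp key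
  rw [Real.sqrt_zero] at key2
  refine key2.congr' ?_
  filter_upwards [hFm] with n hn
  rw [dist_eq_norm, ← toL2_sub hn hfm, Function.comp_apply,
    ← sq_norm_toL2 (f := fun s => F n s - f s) (hn.sub hfm)]
  exact Real.sqrt_sq (norm_nonneg _)

noncomputable instance : MeasurableSpace L2R := borel _

instance : BorelSpace L2R := ⟨rfl⟩

instance : SecondCountableTopology L2R :=
  haveI : Fact ((2 : ℝ≥0∞) ≠ ⊤) := ⟨by simp⟩
  inferInstance

/-- A function into a separable metric space is measurable if its distances to points are. -/
theorem measurable_of_dist {α X : Type*} [MeasurableSpace α] [PseudoMetricSpace X]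
    [SecondCountableTopology X] [MeasurableSpace X] [BorelSpace X] {f : α → X}
    (h : ∀ c, Measurable fun a => dist (f a) c) : Measurable f := by
  refine measurable_of_isOpen fun U hU => ?_
  -- Second countability writes U as a countable union of balls, and preimages of balls are sublevel
  -- sets of the distance functions.
  obtain ⟨S, hS, hU'⟩ : ∃ S : Set (X × ℝ), S.Countable ∧
      U = ⋃ p ∈ S, Metric.ball p.1 p.2 := by
    let J : Set (X × ℝ) := {p | Metric.ball p.1 p.2 ⊆ U}
    obtain ⟨S, hSc, hSJ⟩ := TopologicalSpace.isOpen_iUnion_countable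
      (fun p : J => Metric.ball p.1.1 p.1.2) (fun _ => Metric.isOpen_ball)
    refine ⟨(fun p : J => p.1) '' S, hSc.image _, ?_⟩
    rw [biUnion_image, hSJ]
    ext x
    simp only [mem_iUnion]
    constructor
    · intro hx
      obtain ⟨ε, hε, hb⟩ := Metric.isOpen_iff.1 hU x hx
      exact ⟨⟨(x, ε), hb⟩, Metric.mem_ball_self hε⟩
    · rintro ⟨p, hp⟩
      exact p.2 hp
  rw [hU', preimage_iUnion₂]
  refine MeasurableSet.biUnion hS fun p _ => ?_
  exact measurableSet_lt (h p.1) measurable_const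

open Classical in
/-- The curve in `L²(ℝ)` given by a jointly measurable function is measurable. -/
theorem measurable_toL2 {α : Type*} [MeasurableSpace α] {g : α → ℝ → ℂ}
    (hg : Measurable (fun p : α × ℝ => g p.1 p.2)) : Measurable fun t => toL2 (g t) := by
  have hgt : ∀ t, Measurable (g t) := fun t => hg.comp measurable_prodMk_left
  have hI : ∀ c : ℝ → ℂ, Measurable c → Measurable fun t => eLpNorm (fun s => g t s - c s) 2 volume := by
    intro c hc
    simp_rw [eLpNorm_eq_lintegral_rpow_enorm_toReal (p := 2) (by simp) (by simp)]
    refine Measurable.pow_const (Measurable.lintegral_prod_right'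
      (f := fun p : α × ℝ => ‖g p.1 p.2 - c p.2‖ₑ ^ (ENNReal.toReal 2)) ?_) _
    exact ((hg.sub (hc.comp measurable_snd)).enorm.pow_const _)
  refine measurable_of_dist fun c => ?_
  obtain ⟨c', hc', hcc⟩ : ∃ c', Measurable c' ∧ c =ᵐ[volume] c' :=
    ⟨_, (Lp.stronglyMeasurable c).measurable, ae_eq_rfl⟩
  have hset : MeasurableSet {t | MemLp (g t) 2 volume} := by
    have : {t | MemLp (g t) 2 volume} = {t | eLpNorm (fun s => g t s - (0 : ℝ → ℂ) s) 2 volume < ⊤} := by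
      ext t
      simp only [mem_ofPred_eq, Pi.zero_apply, sub_zero]
      exact ⟨fun h => h.2, fun h => ⟨(hgt t).aestronglyMeasurable, h⟩⟩
    rw [this]
    exact measurableSet_lt (hI _ measurable_const) measurable_const
  -- At the times where the slice is not square integrable, `toL2` has the default value 0, so the
  -- distance is given piecewise on a measurable set of times and its complement.
  have hEq : (fun t => dist (toL2 (g t)) c) = {t | MemLp (g t) 2 volume}.piecewise
      (fun t => (eLpNorm (fun s => g t s - c' s) 2 volume).toReal) (fun _ => dist 0 c) := by
    ext t
    by_cases ht : MemLp (g t) 2 volume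
    · rw [piecewise_eq_of_mem {t | MemLp (g t) 2 volume} _ _ ht, Lp.dist_def]
      congr 1
      refine eLpNorm_congr_ae ?_
      filter_upwards [coeFn_toL2 ht, hcc] with s h1 h2
      simp [h1, h2]
    · rw [piecewise_eq_of_notMem {t | MemLp (g t) 2 volume} _ _ ht, toL2, dif_neg ht]
  rw [hEq]
  exact Measurable.piecewise hset (hI _ hc').ennreal_toReal measurable_const

/-- The essential supremum of an element of `L²(ℝ)`. -/
noncomputable def supNorm (f : L2R) : ℝ≥0∞ := eLpNorm f ⊤ volume

theorem supNorm_add_le (f g : L2R) : supNorm (f + g) ≤ supNorm f + supNorm g := by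
  unfold supNorm
  rw [eLpNorm_congr_ae (Lp.coeFn_add f g)]
  exact eLpNorm_add_le (Lp.aestronglyMeasurable f) (Lp.aestronglyMeasurable g) (by simp)

theorem supNorm_smul (c : ℂ) (f : L2R) : supNorm (c • f) = ‖c‖ₑ * supNorm f := by
  unfold supNorm
  rw [eLpNorm_congr_ae (Lp.coeFn_smul c f), eLpNorm_const_smul]

@[simp] theorem supNorm_zero : supNorm 0 = 0 := by
  unfold supNorm
  rw [eLpNorm_congr_ae (Lp.coeFn_zero ℂ 2 volume), eLpNorm_zero]

theorem ae_norm_le_supNorm {f : L2R} (hf : supNorm f ≠ ⊤) :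
    ∀ᵐ s, ‖f s‖ ≤ (supNorm f).toReal := by
  filter_upwards [enorm_ae_le_eLpNormEssSup f volume] with s hs
  have : ‖f s‖ₑ ≤ supNorm f := by simpa [supNorm] using hs
  have h2 := ENNReal.toReal_mono hf this
  simpa using h2

/-- L² convergence gives almost everywhere convergence along a subsequence, and an essential bound
survives that. Through this fact bounds in L⁴_t L^∞_x pass to limits that are only known in L². -/
theorem lowerSemicontinuous_supNorm : LowerSemicontinuous supNorm := by
  rw [lowerSemicontinuous_iff_isClosed_preimage]
  intro y
  refine IsSeqClosed.isClosed fun F f hF h => ?_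
  obtain ⟨ns, -, hae⟩ := (tendstoInMeasure_of_tendsto_Lp h).exists_seq_tendsto_ae
  exact Lp.eLpNorm_le_of_ae_tendsto (f := fun n => (F (ns n) : ℝ → ℂ))
    (Eventually.of_forall fun n => hF (ns n)) (fun n => Lp.aestronglyMeasurable _) hae

theorem supNorm_le_liminf {F : ℕ → L2R} {f : L2R} (h : Tendsto F atTop (𝓝 f)) :
    supNorm f ≤ atTop.liminf fun n => supNorm (F n) :=
  (lowerSemicontinuousAt_iff_le_liminf.1 (lowerSemicontinuous_supNorm f)).trans (liminf_le_liminf_of_le h)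

theorem measurable_supNorm : Measurable supNorm := lowerSemicontinuous_supNorm.measurable

/-- A measurable curve in `L²(ℝ)` has a jointly measurable representative. -/
theorem exists_measurable_rep {α : Type*} [MeasurableSpace α] {W : α → L2R} (hW : Measurable W) :
    ∃ w : α → ℝ → ℂ, Measurable (fun p : α × ℝ => w p.1 p.2) ∧ ∀ t, w t =ᵐ[volume] W t := by
  classical
  let d := TopologicalSpace.denseSeq L2R
  have hd : ∀ (j : ℕ) (f : L2R), ∃ n, dist f (d n) < (1 / 4 : ℝ) ^ j := fun j f =>
    (TopologicalSpace.denseRange_denseSeq L2R).exists_dist_lt f (by positivity)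
  -- The index of the first dense point within 4^{-j} of W t. The approximants are countably valued
  -- and measurable in t; since the errors are summable, the whole sequence converges almost
  -- everywhere in s, so no subsequence depending on t has to be selected.
  let k : ℕ → α → ℕ := fun j t => Nat.find (hd j (W t))
  have hk : ∀ j, Measurable (k j) := fun j =>
    measurable_find _ fun n => measurableSet_lt (hW.dist measurable_const) measurable_const
  have hkd : ∀ j t, dist (W t) (d (k j t)) < (1 / 4 : ℝ) ^ j := fun j t =>
    Nat.find_spec (hd j (W t))
  let F : ℕ → α × ℝ → ℂ := fun j p => d (k j p.1) p.2
  have hF : ∀ j, Measurable (F j) := by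
    intro j
    have h1 : Measurable fun q : ℕ × ℝ => d q.1 q.2 :=
      measurable_from_prod_countable_right fun n => (Lp.stronglyMeasurable (d n)).measurable
    exact h1.comp (((hk j).comp measurable_fst).prodMk measurable_snd)
  refine ⟨fun t s => limUnder atTop fun j => F j (t, s), ?_, fun t => ?_⟩
  · exact (StronglyMeasurable.limUnder (l := atTop)
      (fun j => (hF j).stronglyMeasurable)).measurable
  · have hlim : Tendsto (fun j => d (k j t)) atTop (𝓝 (W t)) := by
      rw [tendsto_iff_dist_tendsto_zero]
      refine squeeze_zero (fun _ => dist_nonneg) (fun j => ?_)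
        (tendsto_pow_atTop_nhds_zero_of_lt_one (r := (1 / 4 : ℝ)) (by norm_num) (by norm_num))
      rw [dist_comm]; exact (hkd j t).le
    obtain ⟨ns, hns, hae⟩ := (tendstoInMeasure_of_tendsto_Lp hlim).exists_seq_tendsto_ae
    have hc : ∀ᵐ s, ∃ l, Tendsto (fun j => d (k j t) s) atTop (𝓝 l) := by
      refine Lp.ae_tendsto_of_cauchy_eLpNorm (p := 2)
        (B := fun N => ENNReal.ofReal (2 * (1 / 4 : ℝ) ^ N))
        (fun j => Lp.aestronglyMeasurable _) (by norm_num) ?_ fun N n m hn hm => ?_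
      · rw [← ENNReal.ofReal_tsum_of_nonneg (fun n => by positivity)]
        · exact ENNReal.ofReal_ne_top
        · exact (summable_geometric_of_lt_one (by norm_num) (by norm_num)).mul_left 2
      · rw [← Lp.edist_def, edist_dist]
        refine (ENNReal.ofReal_lt_ofReal_iff (by positivity)).2 ?_
        have hp : ∀ {i}, N ≤ i → dist (W t) (d (k i t)) < (1 / 4 : ℝ) ^ N := fun hi =>
          (hkd _ t).trans_le (pow_le_pow_of_le_one (by norm_num) (by norm_num) hi)
        calc dist (d (k n t)) (d (k m t))
            ≤ dist (W t) (d (k n t)) + dist (W t) (d (k m t)) := dist_triangle_left _ _ _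
          _ < 2 * (1 / 4 : ℝ) ^ N := by linarith [hp hn, hp hm]
    filter_upwards [hae, hc] with s h1 ⟨l, h2⟩
    have h3 : l = W t s := tendsto_nhds_unique (h2.comp hns.tendsto_atTop) h1
    rw [← h3]
    exact h2.limUnder_eq

end L2

/-! ### Fourier multipliers and the free Schrödinger group -/

section Propagator

open scoped ENNReal BoundedContinuousFunction FourierTransform

theorem memLp_mul_bcf (m : ℝ →ᵇ ℂ) (f : L2R) : MemLp (fun ξ => m ξ * f ξ) 2 volume :=
  (Lp.memLp f).of_le_mul (c := ‖m‖)
    (m.continuous.aestronglyMeasurable.mul (Lp.aestronglyMeasurable f))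
    (Eventually.of_forall fun ξ => by
      rw [norm_mul]; exact mul_le_mul_of_nonneg_right (m.norm_coe_le_norm ξ) (norm_nonneg _))

/-- Multiplication by a bounded continuous function on `L²(ℝ)`. -/
noncomputable def mulL2 (m : ℝ →ᵇ ℂ) : L2R →L[ℂ] L2R :=
  LinearMap.mkContinuous
    { toFun := fun f => toL2 fun ξ => m ξ * f ξ
      map_add' := fun f g => by
        rw [← toL2_add (memLp_mul_bcf m f) (memLp_mul_bcf m g)]
        refine toL2_congr ?_
        filter_upwards [Lp.coeFn_add f g] with ξ h
        rw [h, Pi.add_apply, mul_add]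
      map_smul' := fun c f => by
        rw [RingHom.id_apply, ← toL2_const_mul c (memLp_mul_bcf m f)]
        refine toL2_congr ?_
        filter_upwards [Lp.coeFn_smul c f] with ξ h
        rw [h, Pi.smul_apply, smul_eq_mul]; ring } ‖m‖
    fun f => norm_toL2_le (norm_nonneg _) (Eventually.of_forall fun ξ => by
      rw [norm_mul]; exact mul_le_mul_of_nonneg_right (m.norm_coe_le_norm ξ) (norm_nonneg _))

theorem mulL2_apply (m : ℝ →ᵇ ℂ) (f : L2R) : mulL2 m f = toL2 fun ξ => m ξ * f ξ := rfl

theorem coeFn_mulL2 (m : ℝ →ᵇ ℂ) (f : L2R) : mulL2 m f =ᵐ[volume] fun ξ => m ξ * f ξ :=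
  coeFn_toL2 (memLp_mul_bcf m f)

theorem mulL2_toL2 (m : ℝ →ᵇ ℂ) {f : ℝ → ℂ} (hf : MemLp f 2 volume) :
    mulL2 m (toL2 f) = toL2 fun ξ => m ξ * f ξ := by
  refine toL2_congr ?_
  filter_upwards [coeFn_toL2 hf] with ξ h
  rw [h]

theorem mulL2_mulL2 (m n : ℝ →ᵇ ℂ) (f : L2R) : mulL2 m (mulL2 n f) = mulL2 (m * n) f := by
  rw [mulL2_apply n, mulL2_toL2 m (memLp_mul_bcf n f)]
  refine toL2_congr (Eventually.of_forall fun ξ => ?_)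
  simp [mul_assoc]

theorem norm_mulL2_le (m : ℝ →ᵇ ℂ) {C : ℝ} (hC : 0 ≤ C) (h : ∀ ξ, ‖m ξ‖ ≤ C) (f : L2R) :
    ‖mulL2 m f‖ ≤ C * ‖f‖ :=
  norm_toL2_le hC (Eventually.of_forall fun ξ => by
    rw [norm_mul]; exact mul_le_mul_of_nonneg_right (h ξ) (norm_nonneg _))

theorem inner_mulL2_left (m : ℝ →ᵇ ℂ) (f g : L2R) :
    inner ℂ (mulL2 m f) g = inner ℂ f (mulL2 (star m) g) := by
  rw [L2.inner_def, L2.inner_def]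
  refine integral_congr_ae ?_
  filter_upwards [coeFn_mulL2 m f, coeFn_mulL2 (star m) g] with ξ h1 h2
  rw [h1, h2]
  simp only [RCLike.inner_apply, map_mul, BoundedContinuousFunction.star_apply]
  simp only [RCLike.star_def]
  ring

/-- Pointwise bounded convergence of multipliers is strong convergence. -/
theorem tendsto_mulL2 {ι : Type*} {l : Filter ι} [l.IsCountablyGenerated] {m : ι → ℝ →ᵇ ℂ}
    {m₀ : ℝ →ᵇ ℂ} {C : ℝ} (hb : ∀ᶠ n in l, ∀ ξ, ‖m n ξ‖ ≤ C) (hb₀ : ∀ ξ, ‖m₀ ξ‖ ≤ C)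
    (h : ∀ ξ, Tendsto (fun n => m n ξ) l (𝓝 (m₀ ξ))) (f : L2R) :
    Tendsto (fun n => mulL2 (m n) f) l (𝓝 (mulL2 m₀ f)) := by
  refine tendsto_toL2 (B := fun ξ => C * ‖f ξ‖) ((Lp.memLp f).norm.const_mul C) ?_ ?_ ?_ ?_ ?_
  · exact Eventually.of_forall fun n => (memLp_mul_bcf (m n) f).1
  · exact (memLp_mul_bcf m₀ f).1
  · filter_upwards [hb] with n hn
    refine Eventually.of_forall fun ξ => ?_
    rw [norm_mul]; exact mul_le_mul_of_nonneg_right (hn ξ) (norm_nonneg _)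
  · refine Eventually.of_forall fun ξ => ?_
    rw [norm_mul]; exact mul_le_mul_of_nonneg_right (hb₀ ξ) (norm_nonneg _)
  · exact Eventually.of_forall fun ξ => (h ξ).mul_const _

/-- The symbol `4 π² ξ²` of `-∂²`. -/
noncomputable def freq (ξ : ℝ) : ℝ := 4 * Real.pi ^ 2 * ξ ^ 2

theorem freq_nonneg (ξ : ℝ) : 0 ≤ freq ξ := by unfold freq; positivity

theorem continuous_freq : Continuous freq := by unfold freq; fun_prop

/-- The symbol `e^{-itλ}` of the free Schrödinger propagator. -/
noncomputable def propSymbol (t : ℝ) : ℝ →ᵇ ℂ :=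
  BoundedContinuousFunction.ofNormedAddCommGroup
    (fun ξ => Complex.exp (((-(t * freq ξ) : ℝ) : ℂ) * Complex.I))
    (by have := continuous_freq; fun_prop) 1
    (fun ξ => (Complex.norm_exp_ofReal_mul_I _).le)

theorem propSymbol_apply (t ξ : ℝ) :
    propSymbol t ξ = Complex.exp (((-(t * freq ξ) : ℝ) : ℂ) * Complex.I) := rfl

theorem norm_propSymbol (t ξ : ℝ) : ‖propSymbol t ξ‖ = 1 := Complex.norm_exp_ofReal_mul_I _

theorem propSymbol_mul (t r : ℝ) : propSymbol t * propSymbol r = propSymbol (t + r) := by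
  ext ξ
  simp only [BoundedContinuousFunction.mul_apply, propSymbol_apply, ← Complex.exp_add]
  congr 1; push_cast; ring

theorem propSymbol_zero : propSymbol 0 = 1 := by
  ext ξ; simp [propSymbol_apply]

theorem mulL2_one (f : L2R) : mulL2 1 f = f := by
  simp [mulL2_apply]

theorem norm_mulL2_propSymbol (t : ℝ) (f : L2R) : ‖mulL2 (propSymbol t) f‖ = ‖f‖ := by
  have h : ∀ (r : ℝ) (g : L2R), ‖mulL2 (propSymbol r) g‖ ≤ ‖g‖ := fun r g => by
    simpa using norm_mulL2_le (propSymbol r) zero_le_one (fun ξ => (norm_propSymbol r ξ).le) g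
  refine le_antisymm (h t f) ?_
  have := h (-t) (mulL2 (propSymbol t) f)
  rwa [mulL2_mulL2, propSymbol_mul, neg_add_cancel, propSymbol_zero, mulL2_one] at this

/-- The Fourier transform on `L²(ℝ)`. -/
noncomputable abbrev fourierL2 : L2R ≃ₗᵢ[ℂ] L2R := Lp.fourierTransformₗᵢ ℝ ℂ

/-- The free Schrödinger group `e^{it∂²}` on `L²(ℝ)`. -/
noncomputable def freeProp (t : ℝ) : L2R →ₗᵢ[ℂ] L2R where
  toLinearMap := fourierL2.symm.toLinearEquiv.toLinearMap ∘ₗ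
    (mulL2 (propSymbol t)).toLinearMap ∘ₗ fourierL2.toLinearEquiv.toLinearMap
  norm_map' f := by
    change ‖fourierL2.symm (mulL2 (propSymbol t) (fourierL2 f))‖ = ‖f‖
    rw [LinearIsometryEquiv.norm_map, norm_mulL2_propSymbol, LinearIsometryEquiv.norm_map]

theorem freeProp_apply (t : ℝ) (f : L2R) :
    freeProp t f = fourierL2.symm (mulL2 (propSymbol t) (fourierL2 f)) := rfl

theorem fourier_freeProp (t : ℝ) (f : L2R) :
    fourierL2 (freeProp t f) = mulL2 (propSymbol t) (fourierL2 f) := by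
  rw [freeProp_apply, LinearIsometryEquiv.apply_symm_apply]

theorem freeProp_freeProp (t r : ℝ) (f : L2R) :
    freeProp t (freeProp r f) = freeProp (t + r) f := by
  rw [freeProp_apply t, fourier_freeProp, mulL2_mulL2, propSymbol_mul, freeProp_apply]

@[simp] theorem freeProp_zero (f : L2R) : freeProp 0 f = f := by
  rw [freeProp_apply, propSymbol_zero, mulL2_one, LinearIsometryEquiv.symm_apply_apply]

theorem inner_freeProp_neg (t : ℝ) (f g : L2R) :
    inner ℂ (freeProp (-t) f) g = inner ℂ f (freeProp t g) := by
  rw [← (freeProp t).inner_map_map, freeProp_freeProp, add_neg_cancel, freeProp_zero]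

theorem continuous_propSymbol_apply (ξ : ℝ) : Continuous fun t => propSymbol t ξ := by
  simp only [propSymbol_apply]; fun_prop

theorem continuous_mulL2_propSymbol (f : L2R) : Continuous fun t => mulL2 (propSymbol t) f :=
  continuous_iff_continuousAt.2 fun t =>
    tendsto_mulL2 (C := 1) (Eventually.of_forall fun r ξ => (norm_propSymbol r ξ).le)
      (fun ξ => (norm_propSymbol t ξ).le) (fun ξ => (continuous_propSymbol_apply ξ).tendsto t) f

theorem continuous_freeProp_left (f : L2R) : Continuous fun t => freeProp t f :=
  fourierL2.symm.continuous.comp (continuous_mulL2_propSymbol (fourierL2 f))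

/-- Strong continuity in t at a fixed f upgrades to joint continuity because every operator of the
group is an isometry. -/
theorem continuous_freeProp : Continuous fun p : ℝ × L2R => freeProp p.1 p.2 := by
  refine continuous_iff_continuousAt.2 fun ⟨t, f⟩ => ?_
  rw [ContinuousAt, tendsto_iff_dist_tendsto_zero]
  have h1 : Tendsto (fun p : ℝ × L2R => dist p.2 f + dist (freeProp p.1 f) (freeProp t f))
      (𝓝 (t, f)) (𝓝 (0 + 0)) := by
    refine Tendsto.add ?_ ?_
    · exact tendsto_iff_dist_tendsto_zero.1 (continuous_snd.tendsto (t, f))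
    · exact tendsto_iff_dist_tendsto_zero.1
        (((continuous_freeProp_left f).comp continuous_fst).tendsto (t, f))
  rw [add_zero] at h1
  refine squeeze_zero (fun _ => dist_nonneg) (fun p => ?_) h1
  calc dist (freeProp p.1 p.2) (freeProp t f)
      ≤ dist (freeProp p.1 p.2) (freeProp p.1 f) + dist (freeProp p.1 f) (freeProp t f) :=
        dist_triangle _ _ _
    _ = _ := by rw [(freeProp p.1).dist_map]

theorem hasDerivAt_propSymbol (t ξ : ℝ) :
    HasDerivAt (fun r => propSymbol r ξ) (propSymbol t ξ * (-Complex.I * freq ξ)) t := by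
  simp only [propSymbol_apply]
  have h : HasDerivAt (fun r : ℝ => ((-(r * freq ξ) : ℝ) : ℂ) * Complex.I)
      (-Complex.I * freq ξ) t := by
    have h1 : HasDerivAt (fun r : ℝ => -(r * freq ξ)) (-(1 * freq ξ)) t :=
      ((hasDerivAt_id t).mul_const _).neg
    have h2 := h1.ofReal_comp.mul_const Complex.I
    refine h2.congr_deriv ?_
    push_cast; ring
  exact h.cexp

/-- Differentiability of the free evolution on the domain of its generator, on the Fourier side. -/
theorem hasDerivAt_mulL2_propSymbol (f : L2R)
    (hf : MemLp (fun ξ => (freq ξ : ℂ) * f ξ) 2 volume) (t : ℝ) :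
    HasDerivAt (fun r => mulL2 (propSymbol r) f)
      (mulL2 (propSymbol t) (toL2 fun ξ => -Complex.I * (freq ξ * f ξ))) t := by
  have hf' : MemLp (fun ξ => -Complex.I * (freq ξ * f ξ)) 2 volume := hf.const_mul _
  rw [hasDerivAt_iff_tendsto_slope, mulL2_toL2 _ hf']
  have key : Tendsto (fun r => toL2 fun ξ => ((r - t)⁻¹ : ℝ) * (propSymbol r ξ - propSymbol t ξ) * f ξ)
      (𝓝[≠] t) (𝓝 (toL2 fun ξ => propSymbol t ξ * (-Complex.I * (freq ξ * f ξ)))) := by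
    refine tendsto_toL2 (B := fun ξ => ‖(freq ξ : ℂ) * f ξ‖) hf.norm ?_ ?_ ?_ ?_ ?_
    · refine Eventually.of_forall fun r => ?_
      exact (((propSymbol r).continuous.sub (propSymbol t).continuous).const_mul _
        |>.aestronglyMeasurable).mul (Lp.aestronglyMeasurable f)
    · exact (propSymbol t).continuous.aestronglyMeasurable.mul hf'.1
    · refine Eventually.of_forall fun r => Eventually.of_forall fun ξ => ?_
      rw [norm_mul, norm_mul, norm_mul]
      refine mul_le_mul_of_nonneg_right ?_ (norm_nonneg _)
      -- Mean value inequality: the time derivative of the symbol has modulus λ, so the difference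
      -- quotients are dominated by λ|f|, which is square integrable by hypothesis.
      have h1 : ‖propSymbol r ξ - propSymbol t ξ‖ ≤ ‖(freq ξ : ℂ)‖ * ‖r - t‖ := by
        refine Convex.norm_image_sub_le_of_norm_hasDerivWithin_le (s := univ)
          (f := fun r => propSymbol r ξ)
          (fun x _ => (hasDerivAt_propSymbol x ξ).hasDerivWithinAt) (fun x _ => ?_)
          convex_univ (mem_univ _) (mem_univ _)
        rw [norm_mul, norm_propSymbol, norm_mul, norm_neg, Complex.norm_I]; simp
      rw [Complex.norm_real, norm_inv]
      calc ‖r - t‖⁻¹ * ‖propSymbol r ξ - propSymbol t ξ‖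
          ≤ ‖r - t‖⁻¹ * (‖(freq ξ : ℂ)‖ * ‖r - t‖) := by gcongr
        _ = ‖(freq ξ : ℂ)‖ * (‖r - t‖⁻¹ * ‖r - t‖) := by ring
        _ ≤ ‖(freq ξ : ℂ)‖ * 1 := by gcongr; exact inv_mul_le_one
        _ = _ := mul_one _
    · refine Eventually.of_forall fun ξ => ?_
      rw [norm_mul, norm_propSymbol, norm_mul, norm_neg, Complex.norm_I]; simp
    · refine Eventually.of_forall fun ξ => ?_
      have h := (hasDerivAt_iff_tendsto_slope.1 (hasDerivAt_propSymbol t ξ)).mul_const (f ξ)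
      simp only [slope_def_module] at h
      convert h using 2
      · simp
      · ring
  refine key.congr fun r => ?_
  rw [slope_def_module, ← toL2_coeFn ((r - t)⁻¹ • (mulL2 (propSymbol r) f - mulL2 (propSymbol t) f))]
  refine toL2_congr ?_
  filter_upwards [Lp.coeFn_smul (r - t)⁻¹ (mulL2 (propSymbol r) f - mulL2 (propSymbol t) f),
    Lp.coeFn_sub (mulL2 (propSymbol r) f) (mulL2 (propSymbol t) f), coeFn_mulL2 (propSymbol r) f,
    coeFn_mulL2 (propSymbol t) f] with ξ h1 h2 h3 h4
  rw [h1, Pi.smul_apply, h2, Pi.sub_apply, h3, h4]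
  simp only [Complex.real_smul]
  ring

theorem toLp_eq_toL2 (f : 𝓢(ℝ, ℂ)) : f.toLp 2 = toL2 f := (toL2_eq (f.memLp 2)).symm

theorem fourierL2_toL2 (f : 𝓢(ℝ, ℂ)) : fourierL2 (toL2 f) = toL2 (𝓕 f : 𝓢(ℝ, ℂ)) := by
  rw [← toLp_eq_toL2, ← toLp_eq_toL2]; exact SchwartzMap.toLp_fourier_eq f

/-- The second derivative on Schwartz functions. -/
noncomputable def secondDeriv (f : 𝓢(ℝ, ℂ)) : 𝓢(ℝ, ℂ) :=
  SchwartzMap.derivCLM ℂ ℂ (SchwartzMap.derivCLM ℂ ℂ f)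

theorem fourier_secondDeriv (f : 𝓢(ℝ, ℂ)) (ξ : ℝ) :
    (𝓕 (secondDeriv f) : 𝓢(ℝ, ℂ)) ξ = -(freq ξ : ℂ) * (𝓕 f : 𝓢(ℝ, ℂ)) ξ := by
  have h : ∀ g : 𝓢(ℝ, ℂ), (𝓕 (SchwartzMap.derivCLM ℂ ℂ g) : 𝓢(ℝ, ℂ)) ξ =
      (2 * Real.pi * Complex.I * ξ) * (𝓕 g : 𝓢(ℝ, ℂ)) ξ := by
    intro g
    rw [SchwartzMap.fourier_coe, SchwartzMap.fourier_coe]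
    have h1 : ((SchwartzMap.derivCLM ℂ ℂ g : 𝓢(ℝ, ℂ)) : ℝ → ℂ) = deriv g := by
      ext x; exact SchwartzMap.derivCLM_apply ℂ g x
    rw [h1, Real.fourier_deriv g.integrable g.differentiable
      (by rw [← h1]; exact SchwartzMap.integrable _)]
    simp
  rw [secondDeriv, h, h, freq]
  push_cast
  linear_combination (4 * Real.pi ^ 2 * ξ ^ 2 * (𝓕 f : 𝓢(ℝ, ℂ)) ξ) * Complex.I_sq

/-- Schwartz functions lie in the domain of the generator: on the Fourier side the derivative of the
group is multiplication by -iλ, while ∂² is multiplication by -λ. -/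
theorem hasDerivAt_freeProp (f : 𝓢(ℝ, ℂ)) (t : ℝ) :
    HasDerivAt (fun r => freeProp r (toL2 f))
      (freeProp t (Complex.I • toL2 (secondDeriv f))) t := by
  have hae := coeFn_toL2 ((𝓕 f : 𝓢(ℝ, ℂ)).memLp 2)
  have h2 : MemLp (fun ξ => (freq ξ : ℂ) * fourierL2 (toL2 f) ξ) 2 volume := by
    refine (memLp_congr_ae ?_).1 ((𝓕 (secondDeriv f) : 𝓢(ℝ, ℂ)).memLp 2).neg
    filter_upwards [hae] with ξ h
    rw [fourierL2_toL2, h, Pi.neg_apply, fourier_secondDeriv]; ring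
  have h := hasDerivAt_mulL2_propSymbol (fourierL2 (toL2 f)) h2 t
  have h3 := (fourierL2.symm : L2R ≃ₗᵢ[ℂ] L2R).toContinuousLinearEquiv.toContinuousLinearMap.restrictScalars ℝ
    |>.hasFDerivAt.comp_hasDerivAt t h
  refine h3.congr_deriv ?_
  change fourierL2.symm _ = _
  rw [freeProp_apply, map_smul, fourierL2_toL2 (secondDeriv f),
    ← toL2_const_mul _ ((𝓕 (secondDeriv f) : 𝓢(ℝ, ℂ)).memLp 2)]
  congr 2
  refine toL2_congr ?_
  filter_upwards [hae] with ξ h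
  rw [fourierL2_toL2, h, fourier_secondDeriv]; ring

end Propagator

/-! ### The Hardy–Littlewood–Sobolev inequality on the diagonal -/

section HardyLittlewoodSobolev

open scoped ENNReal

theorem lintegral_comp_abs {h : ℝ → ℝ≥0∞} :
    ∫⁻ r, h |r| = 2 * ∫⁻ r in Ioi (0 : ℝ), h r := by
  have h1 : ∫⁻ r in Ioi (0 : ℝ), h |r| = ∫⁻ r in Ioi (0 : ℝ), h r :=
    setLIntegral_congr_fun measurableSet_Ioi fun r hr => by
      simp only [abs_of_pos (show 0 < r from hr)]
  have h2 : ∫⁻ r in Iic (0 : ℝ), h |r| = ∫⁻ r in Ioi (0 : ℝ), h r := by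
    rw [← h1, ← setLIntegral_congr (Ioi_ae_eq_Ici (a := (0 : ℝ)) (μ := volume)).symm]
    have := (Measure.measurePreserving_neg (volume : Measure ℝ)).setLIntegral_comp_preimage_emb
      (Homeomorph.neg ℝ).measurableEmbedding (fun r => h |r|) (Ici 0)
    simpa using this
  rw [← lintegral_add_compl _ measurableSet_Ioi (A := Ioi (0 : ℝ)), compl_Ioi, h1, h2, two_mul]

/-- The kernel `|r|^{-1/2}`. -/
noncomputable def rieszKernel (r : ℝ) : ℝ≥0∞ := ENNReal.ofReal (|r| ^ (-(1 / 2) : ℝ))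

theorem measurable_rieszKernel : Measurable rieszKernel := by
  unfold rieszKernel; fun_prop

theorem lintegral_rieszKernel_near {R : ℝ} (hR : 0 < R) :
    ∫⁻ r, {r : ℝ | |r| ≤ R}.indicator rieszKernel r = ENNReal.ofReal (4 * √R) := by
  have h : ∀ r : ℝ, {r : ℝ | |r| ≤ R}.indicator rieszKernel r =
      (fun x => (Iic R).indicator (fun x => ENNReal.ofReal (x ^ (-(1 / 2) : ℝ))) x) |r| := by
    intro r
    by_cases hr : |r| ≤ R
    · rw [indicator_of_mem (show r ∈ {r : ℝ | |r| ≤ R} from hr)]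
      simp [indicator_of_mem (show |r| ∈ Iic R from hr), rieszKernel]
    · rw [indicator_of_notMem (show r ∉ {r : ℝ | |r| ≤ R} from hr)]
      simp [indicator_of_notMem (show |r| ∉ Iic R from hr)]
  simp_rw [h]
  rw [lintegral_comp_abs (h := (Iic R).indicator fun x => ENNReal.ofReal (x ^ (-(1 / 2) : ℝ))),
    lintegral_indicator measurableSet_Iic, Measure.restrict_restrict measurableSet_Iic,
    Iic_inter_Ioi, ← ofReal_integral_eq_lintegral_ofReal]
  · rw [← intervalIntegral.integral_of_le hR.le, integral_rpow (by norm_num),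
      ← ENNReal.ofReal_ofNat, ← ENNReal.ofReal_mul (by norm_num), Real.sqrt_eq_rpow]
    congr 1
    norm_num; ring
  · exact (intervalIntegral.intervalIntegrable_rpow' (by norm_num) (a := 0) (b := R)).1
  · filter_upwards [ae_restrict_mem measurableSet_Ioc] with x hx
    exact Real.rpow_nonneg hx.1.le _

/-- The power 4 is the exponent dual to 4/3, and the fourth power |r|^{-2} of the kernel is
integrable at infinity. -/
theorem lintegral_rieszKernel_far {R : ℝ} (hR : 0 < R) :
    ∫⁻ r, ({r : ℝ | R < |r|}.indicator rieszKernel r) ^ (4 : ℝ) = ENNReal.ofReal (2 / R) := by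
  have h : ∀ r : ℝ, ({r : ℝ | R < |r|}.indicator rieszKernel r) ^ (4 : ℝ) =
      (fun x => (Ioi R).indicator (fun x => ENNReal.ofReal (x ^ (-2 : ℝ))) x) |r| := by
    intro r
    by_cases hr : R < |r|
    · rw [indicator_of_mem (show r ∈ {r : ℝ | R < |r|} from hr)]
      simp only [indicator_of_mem (show |r| ∈ Ioi R from hr), rieszKernel]
      rw [ENNReal.ofReal_rpow_of_nonneg (by positivity) (by norm_num),
        ← Real.rpow_mul (abs_nonneg r)]
      norm_num
    · rw [indicator_of_notMem (show r ∉ {r : ℝ | R < |r|} from hr)]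
      simp [indicator_of_notMem (show |r| ∉ Ioi R from hr)]
  simp_rw [h]
  rw [lintegral_comp_abs (h := (Ioi R).indicator fun x => ENNReal.ofReal (x ^ (-2 : ℝ))),
    lintegral_indicator measurableSet_Ioi, Measure.restrict_restrict measurableSet_Ioi,
    Ioi_inter_Ioi, max_eq_left hR.le, ← ofReal_integral_eq_lintegral_ofReal]
  · rw [integral_Ioi_rpow_of_lt (by norm_num) hR,
      ← ENNReal.ofReal_ofNat, ← ENNReal.ofReal_mul (by norm_num)]
    congr 1
    norm_num [Real.rpow_neg_one]; ring
  · exact integrableOn_Ioi_rpow_of_lt (by norm_num) hR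
  · filter_upwards [ae_restrict_mem measurableSet_Ioi] with x hx
    exact Real.rpow_nonneg (hR.trans hx).le _

/-- Split the kernel at |r| = R. Near the origin the bound b gives 4 b √R; far away Hölder's
inequality gives A^{3/4} (2/R)^{1/4}. The choice R = A b^{-4/3} makes both of the order A^{1/2}
b^{1/3}. -/
theorem lintegral_min_mul_rieszKernel_le {f : ℝ → ℝ≥0∞} (hf : Measurable f)
    (h0 : ∫⁻ t, f t ^ (4 / 3 : ℝ) ≠ 0) (hA : ∫⁻ t, f t ^ (4 / 3 : ℝ) ≠ ⊤) {b : ℝ≥0∞}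
    (hb : b ≠ ⊤) (t : ℝ) :
    ∫⁻ s, min (f s) b * rieszKernel (t - s) ≤
      6 * (∫⁻ t, f t ^ (4 / 3 : ℝ)) ^ (1 / 2 : ℝ) * b ^ (1 / 3 : ℝ) := by
  set A := ∫⁻ t, f t ^ (4 / 3 : ℝ) with hAdef
  rcases eq_or_ne b 0 with rfl | hb0
  · simp
  -- With A = p⁴ and b = q³ all powers in the balance become integral: R = p⁴/q⁴ and the common size
  -- is p² q.
  obtain ⟨p, hp, hpA⟩ : ∃ p : ℝ, 0 < p ∧ A = ENNReal.ofReal (p ^ (4 : ℝ)) := by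
    refine ⟨A.toReal ^ (1 / 4 : ℝ), Real.rpow_pos_of_pos (ENNReal.toReal_pos h0 hA) _, ?_⟩
    rw [← Real.rpow_mul ENNReal.toReal_nonneg]; simp [hA]
  obtain ⟨q, hq, hqb⟩ : ∃ q : ℝ, 0 < q ∧ b = ENNReal.ofReal (q ^ (3 : ℝ)) := by
    refine ⟨b.toReal ^ (1 / 3 : ℝ), Real.rpow_pos_of_pos (ENNReal.toReal_pos hb0 hb) _, ?_⟩
    rw [← Real.rpow_mul ENNReal.toReal_nonneg]; simp [hb]
  have hR : 0 < p ^ 4 / q ^ 4 := by positivity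
  set R := p ^ 4 / q ^ 4 with hRdef
  let k1 : ℝ → ℝ≥0∞ := {r : ℝ | |r| ≤ R}.indicator rieszKernel
  let k2 : ℝ → ℝ≥0∞ := {r : ℝ | R < |r|}.indicator rieszKernel
  have hk1 : Measurable k1 :=
    measurable_rieszKernel.indicator (measurableSet_le (by fun_prop) measurable_const)
  have hk2 : Measurable k2 :=
    measurable_rieszKernel.indicator (measurableSet_lt measurable_const (by fun_prop))
  have hsplit : ∀ s, min (f s) b * rieszKernel (t - s) ≤ b * k1 (t - s) + f s * k2 (t - s) := by
    intro s
    by_cases hs : |t - s| ≤ R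
    · have : k1 (t - s) = rieszKernel (t - s) :=
        indicator_of_mem (show t - s ∈ {r : ℝ | |r| ≤ R} from hs) _
      rw [this]
      exact le_add_right (mul_le_mul_left (min_le_right _ _) _)
    · have : k2 (t - s) = rieszKernel (t - s) :=
        indicator_of_mem (show t - s ∈ {r : ℝ | R < |r|} from not_le.1 hs) _
      rw [this]
      exact le_add_left (mul_le_mul_left (min_le_left _ _) _)
  have hnear : ∫⁻ s, b * k1 (t - s) = b * ENNReal.ofReal (4 * √R) := by
    rw [lintegral_const_mul b (show Measurable fun s => k1 (t - s) from
        hk1.comp (measurable_const.sub measurable_id)),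
      lintegral_sub_left_eq_self (fun r => k1 r) t, lintegral_rieszKernel_near hR]
  have hfar : ∫⁻ s, f s * k2 (t - s) ≤
      A ^ (3 / 4 : ℝ) * ENNReal.ofReal (2 / R) ^ (1 / 4 : ℝ) := by
    have hpq : (4 / 3 : ℝ).HolderConjugate 4 := by
      rw [Real.holderConjugate_iff]; norm_num
    have := ENNReal.lintegral_mul_le_Lp_mul_Lq volume hpq hf.aemeasurable
      (hk2.comp (measurable_const.sub measurable_id)).aemeasurable (g := fun s => k2 (t - s))
    rw [lintegral_sub_left_eq_self (fun r => k2 r ^ (4 : ℝ)) t, lintegral_rieszKernel_far hR] at this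
    simpa using this
  calc ∫⁻ s, min (f s) b * rieszKernel (t - s)
      ≤ ∫⁻ s, (b * k1 (t - s) + f s * k2 (t - s)) := lintegral_mono hsplit
    _ = (∫⁻ s, b * k1 (t - s)) + ∫⁻ s, f s * k2 (t - s) :=
        lintegral_add_left ((hk1.comp (measurable_const.sub measurable_id)).const_mul b) _
    _ ≤ b * ENNReal.ofReal (4 * √R) +
          A ^ (3 / 4 : ℝ) * ENNReal.ofReal (2 / R) ^ (1 / 4 : ℝ) := by
        rw [hnear]; gcongr
    _ ≤ 6 * A ^ (1 / 2 : ℝ) * b ^ (1 / 3 : ℝ) := by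
        rw [hpA, hqb]
        simp only [ENNReal.ofReal_rpow_of_nonneg (Real.rpow_nonneg hp.le _)
            (show (0 : ℝ) ≤ 3 / 4 by norm_num),
          ENNReal.ofReal_rpow_of_nonneg (Real.rpow_nonneg hp.le _)
            (show (0 : ℝ) ≤ 1 / 2 by norm_num),
          ENNReal.ofReal_rpow_of_nonneg (Real.rpow_nonneg hq.le _)
            (show (0 : ℝ) ≤ 1 / 3 by norm_num),
          ENNReal.ofReal_rpow_of_nonneg (show 0 ≤ 2 / R by positivity)
            (show (0 : ℝ) ≤ 1 / 4 by norm_num)]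
        rw [← ENNReal.ofReal_ofNat, ← ENNReal.ofReal_mul (by positivity),
          ← ENNReal.ofReal_mul (by positivity), ← ENNReal.ofReal_mul (by positivity),
          ← ENNReal.ofReal_mul (by positivity), ← ENNReal.ofReal_add (by positivity) (by positivity)]
        refine ENNReal.ofReal_le_ofReal ?_
        have e1 : √R = p ^ 2 / q ^ 2 := by
          rw [hRdef, show p ^ 4 / q ^ 4 = (p ^ 2 / q ^ 2) ^ 2 by field_simp]
          exact Real.sqrt_sq (by positivity)
        have e2 : (2 / R) ^ (1 / 4 : ℝ) ≤ 2 * (q / p) := by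
          have h16 : 2 / R ≤ (2 * (q / p)) ^ (4 : ℝ) := by
            have : (2 * (q / p)) ^ (4 : ℝ) = 16 / R := by
              rw [show (4 : ℝ) = ((4 : ℕ) : ℝ) by norm_num, Real.rpow_natCast, hRdef]
              field_simp; norm_num
            rw [this]; gcongr; norm_num
          calc (2 / R) ^ (1 / 4 : ℝ) ≤ ((2 * (q / p)) ^ (4 : ℝ)) ^ (1 / 4 : ℝ) := by gcongr
            _ = 2 * (q / p) := by rw [← Real.rpow_mul (by positivity)]; norm_num
        have e3 : (p ^ (4 : ℝ)) ^ (3 / 4 : ℝ) = p ^ 3 := by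
          rw [← Real.rpow_mul hp.le, show (4 : ℝ) * (3 / 4) = ((3 : ℕ) : ℝ) by norm_num,
            Real.rpow_natCast]
        have e4 : (p ^ (4 : ℝ)) ^ (1 / 2 : ℝ) = p ^ 2 := by
          rw [← Real.rpow_mul hp.le, show (4 : ℝ) * (1 / 2) = ((2 : ℕ) : ℝ) by norm_num,
            Real.rpow_natCast]
        have e5 : (q ^ (3 : ℝ)) ^ (1 / 3 : ℝ) = q := by
          rw [← Real.rpow_mul hq.le]; norm_num
        have e6 : q ^ (3 : ℝ) = q ^ 3 := by
          rw [show (3 : ℝ) = ((3 : ℕ) : ℝ) by norm_num, Real.rpow_natCast]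
        rw [e3, e4, e5, e6, e1]
        calc q ^ 3 * (4 * (p ^ 2 / q ^ 2)) + p ^ 3 * (2 / R) ^ (1 / 4 : ℝ)
            ≤ q ^ 3 * (4 * (p ^ 2 / q ^ 2)) + p ^ 3 * (2 * (q / p)) := by gcongr
          _ = 6 * p ^ 2 * q := by field_simp; ring

/-- The diagonal Hardy–Littlewood–Sobolev inequality with kernel `|t - s|^{-1/2}`. -/
theorem hardyLittlewoodSobolev {f : ℝ → ℝ≥0∞} (hf : Measurable f) (hft : ∀ t, f t ≠ ⊤) :
    ∫⁻ t, ∫⁻ s, f t * f s * rieszKernel (t - s) ≤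
      12 * (∫⁻ t, f t ^ (4 / 3 : ℝ)) ^ (3 / 2 : ℝ) := by
  set A := ∫⁻ t, f t ^ (4 / 3 : ℝ) with hAdef
  rcases eq_or_ne A 0 with h0 | h0
  · have hz : f =ᵐ[volume] 0 := by
      rw [hAdef, lintegral_eq_zero_iff (hf.pow_const _)] at h0
      filter_upwards [h0] with t ht
      exact (ENNReal.rpow_eq_zero_iff_of_pos (by norm_num)).1 ht
    have : ∫⁻ t, ∫⁻ s, f t * f s * rieszKernel (t - s) = 0 := by
      rw [lintegral_eq_zero_iff']
      · filter_upwards [hz] with t ht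
        simp [ht]
      · refine (Measurable.lintegral_prod_right'
          (f := fun p : ℝ × ℝ => f p.1 * f p.2 * rieszKernel (p.1 - p.2)) ?_).aemeasurable
        have := measurable_rieszKernel
        fun_prop
    rw [this]; exact zero_le
  rcases eq_or_ne A ⊤ with hA | hA
  · rw [hA, ENNReal.top_rpow_of_pos (by norm_num), ENNReal.mul_top (by simp)]; exact le_top
  have hm : Measurable fun p : ℝ × ℝ => f p.1 * (min (f p.2) (f p.1) * rieszKernel (p.1 - p.2)) := by
    have := measurable_rieszKernel
    fun_prop
  have hm' : Measurable fun p : ℝ × ℝ => f p.2 * (min (f p.1) (f p.2) * rieszKernel (p.2 - p.1)) :=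
    hm.comp measurable_swap
  -- By symmetry of the kernel it suffices to treat the region where the inner value f s is the
  -- smaller one. There it equals its truncation at height f t, so the truncated bound applies with
  -- b = f t.
  have hpt : ∀ t s, f t * f s * rieszKernel (t - s) ≤
      f t * (min (f s) (f t) * rieszKernel (t - s)) +
        f s * (min (f t) (f s) * rieszKernel (s - t)) := by
    intro t s
    have hsym : rieszKernel (s - t) = rieszKernel (t - s) := by
      unfold rieszKernel; rw [abs_sub_comm]
    rcases le_total (f s) (f t) with h | h
    · rw [min_eq_left h, mul_assoc]; exact le_add_right le_rfl
    · rw [min_eq_left h, hsym]; exact le_add_left (by rw [← mul_assoc, mul_comm (f t)])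
  have hsum : ∫⁻ t, ∫⁻ s, (f t * (min (f s) (f t) * rieszKernel (t - s)) +
        f s * (min (f t) (f s) * rieszKernel (s - t))) =
      (∫⁻ t, ∫⁻ s, f t * (min (f s) (f t) * rieszKernel (t - s))) +
        ∫⁻ t, ∫⁻ s, f t * (min (f s) (f t) * rieszKernel (t - s)) := by
    have : ∀ t, ∫⁻ s, (f t * (min (f s) (f t) * rieszKernel (t - s)) +
        f s * (min (f t) (f s) * rieszKernel (s - t))) =
        (∫⁻ s, f t * (min (f s) (f t) * rieszKernel (t - s))) +
        ∫⁻ s, f s * (min (f t) (f s) * rieszKernel (s - t)) := fun t =>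
      lintegral_add_left (hm.comp (measurable_prodMk_left (x := t))) _
    simp_rw [this]
    rw [lintegral_add_left hm.lintegral_prod_right']
    congr 1
    exact lintegral_lintegral_swap hm'.aemeasurable
  have hmain : ∫⁻ t, ∫⁻ s, f t * (min (f s) (f t) * rieszKernel (t - s)) ≤
      6 * A ^ (3 / 2 : ℝ) := by
    calc ∫⁻ t, ∫⁻ s, f t * (min (f s) (f t) * rieszKernel (t - s))
        ≤ ∫⁻ t, 6 * A ^ (1 / 2 : ℝ) * f t ^ (4 / 3 : ℝ) := by
          refine lintegral_mono fun t => ?_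
          rw [lintegral_const_mul' _ _ (hft t)]
          calc f t * ∫⁻ s, min (f s) (f t) * rieszKernel (t - s)
              ≤ f t * (6 * A ^ (1 / 2 : ℝ) * f t ^ (1 / 3 : ℝ)) := by
                gcongr; exact lintegral_min_mul_rieszKernel_le hf h0 hA (hft t) t
            _ = 6 * A ^ (1 / 2 : ℝ) * (f t ^ (1 : ℝ) * f t ^ (1 / 3 : ℝ)) := by
                rw [ENNReal.rpow_one]; ring
            _ = 6 * A ^ (1 / 2 : ℝ) * f t ^ (4 / 3 : ℝ) := by
                rw [← ENNReal.rpow_add_of_nonneg _ _ (by norm_num) (by norm_num)]; norm_num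
      _ = 6 * A ^ (1 / 2 : ℝ) * A := by
          rw [lintegral_const_mul _ (hf.pow_const _)]
      _ = 6 * A ^ (3 / 2 : ℝ) := by
          rw [mul_assoc]
          nth_rewrite 2 [← ENNReal.rpow_one A]
          rw [← ENNReal.rpow_add_of_nonneg _ _ (by norm_num) (by norm_num)]; norm_num
  calc ∫⁻ t, ∫⁻ s, f t * f s * rieszKernel (t - s)
      ≤ ∫⁻ t, ∫⁻ s, (f t * (min (f s) (f t) * rieszKernel (t - s)) +
        f s * (min (f t) (f s) * rieszKernel (s - t))) :=
        lintegral_mono fun t => lintegral_mono fun s => hpt t s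
    _ ≤ 6 * A ^ (3 / 2 : ℝ) + 6 * A ^ (3 / 2 : ℝ) := by rw [hsum]; gcongr
    _ = 12 * A ^ (3 / 2 : ℝ) := by rw [← add_mul]; norm_num

end HardyLittlewoodSobolev

/-! ### The regularised Strichartz estimate by the TT* method -/

section Strichartz

open scoped ENNReal BoundedContinuousFunction FourierTransform

/-- The symbol `e^{-|ε|λ}` of the heat semigroup. -/
noncomputable def heatSymbol (ε : ℝ) : ℝ →ᵇ ℂ :=
  BoundedContinuousFunction.ofNormedAddCommGroup
    (fun ξ => ((Real.exp (-(|ε| * freq ξ)) : ℝ) : ℂ))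
    (by have := continuous_freq; fun_prop) 1
    (fun ξ => by
      rw [Complex.norm_real, Real.norm_of_nonneg (Real.exp_pos _).le, Real.exp_le_one_iff]
      have := mul_nonneg (abs_nonneg ε) (freq_nonneg ξ)
      linarith)

theorem heatSymbol_apply (ε ξ : ℝ) :
    heatSymbol ε ξ = ((Real.exp (-(|ε| * freq ξ)) : ℝ) : ℂ) := rfl

theorem norm_heatSymbol_le (ε ξ : ℝ) : ‖heatSymbol ε ξ‖ ≤ 1 := by
  rw [heatSymbol_apply, Complex.norm_real, Real.norm_of_nonneg (Real.exp_pos _).le,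
    Real.exp_le_one_iff]
  have := mul_nonneg (abs_nonneg ε) (freq_nonneg ξ)
  linarith

/-- The plane wave `e^{i(2πxξ - tλ)}`. -/
noncomputable def wave (t x ξ : ℝ) : ℂ :=
  Complex.exp (((2 * Real.pi * x * ξ - t * freq ξ : ℝ) : ℂ) * Complex.I)

theorem norm_wave (t x ξ : ℝ) : ‖wave t x ξ‖ = 1 := Complex.norm_exp_ofReal_mul_I _

theorem continuous_wave : Continuous fun p : ℝ × ℝ × ℝ => wave p.1 p.2.1 p.2.2 := by
  have := continuous_freq
  unfold wave; fun_prop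

theorem wave_mul_conj (t x r y ξ : ℝ) :
    wave t x ξ * starRingEnd ℂ (wave r y ξ) = wave (t - r) (x - y) ξ := by
  unfold wave
  rw [← Complex.exp_conj, ← Complex.exp_add]
  congr 1
  simp only [map_mul, Complex.conj_ofReal, Complex.conj_I]
  push_cast; ring

theorem integrable_heatSymbol {ε : ℝ} (hε : 0 < ε) : Integrable (heatSymbol ε) volume := by
  have h := (integrable_exp_neg_mul_sq (b := ε * (4 * Real.pi ^ 2)) (by positivity)).ofReal (𝕜 := ℂ)
  refine h.congr (Eventually.of_forall fun ξ => ?_)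
  have e : -(ε * (4 * Real.pi ^ 2)) * ξ ^ 2 = -(|ε| * freq ξ) := by
    rw [abs_of_pos hε, freq]; ring
  simp only [e]; rfl

theorem memLp_heatSymbol {ε : ℝ} (hε : 0 < ε) : MemLp (heatSymbol ε) 2 volume := by
  rw [memLp_two_iff_integrable_sq_norm (heatSymbol ε).continuous.aestronglyMeasurable]
  refine (integrable_heatSymbol hε).norm.mono
    ((heatSymbol ε).continuous.norm.pow 2).aestronglyMeasurable (Eventually.of_forall fun ξ => ?_)
  rw [norm_norm, Real.norm_of_nonneg (by positivity), sq]
  exact mul_le_of_le_one_left (norm_nonneg _) (norm_heatSymbol_le ε ξ)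

/-- The dispersive estimate. The integral is a Gaussian one with parameter b = 4π²(2ε + iτ), hence
of modulus at most |π/b|^{1/2}; since |b| ≥ 4π²|τ|, the bound is uniform in ε and in the point y. -/
theorem enorm_integral_heatSymbol_mul_wave_le {ε τ : ℝ} (hε : 0 < ε) (hτ : τ ≠ 0) (y : ℝ) :
    ‖∫ ξ, heatSymbol ε ξ * heatSymbol ε ξ * wave τ y ξ‖ₑ ≤ rieszKernel τ := by
  set b : ℂ := 4 * Real.pi ^ 2 * (((2 * ε : ℝ) : ℂ) + ((τ : ℝ) : ℂ) * Complex.I) with hb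
  have hbe : b = ((4 * Real.pi ^ 2 * (2 * ε) : ℝ) : ℂ) + ((4 * Real.pi ^ 2 * τ : ℝ) : ℂ) * Complex.I := by
    rw [hb]; push_cast; ring
  have hre : b.re = 4 * Real.pi ^ 2 * (2 * ε) := by
    rw [hbe]; simp only [Complex.add_re, Complex.ofReal_re, Complex.re_ofReal_mul, Complex.I_re]; ring
  have him : b.im = 4 * Real.pi ^ 2 * τ := by
    rw [hbe]; simp only [Complex.add_im, Complex.ofReal_im, Complex.im_ofReal_mul, Complex.I_im]; ring
  have hbpos : 0 < b.re := by rw [hre]; positivity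
  have hint : ∫ ξ, heatSymbol ε ξ * heatSymbol ε ξ * wave τ y ξ =
      ∫ ξ : ℝ, Complex.exp (Complex.I * ((2 * Real.pi * y : ℝ) : ℂ) * ξ) * Complex.exp (-b * ξ ^ 2) := by
    refine integral_congr_ae (Eventually.of_forall fun ξ => ?_)
    simp only [heatSymbol_apply, wave, abs_of_pos hε, Complex.ofReal_exp, ← Complex.exp_add]
    congr 1
    rw [hb, freq]; push_cast; ring
  rw [hint, fourierIntegral_gaussian hbpos]
  have hexp : ‖Complex.exp (-((2 * Real.pi * y : ℝ) : ℂ) ^ 2 / (4 * b))‖ ≤ 1 := by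
    rw [Complex.norm_exp, Real.exp_le_one_iff]
    have : -((2 * Real.pi * y : ℝ) : ℂ) ^ 2 / (4 * b) =
        ((-(2 * Real.pi * y) ^ 2 / 4 : ℝ) : ℂ) * b⁻¹ := by
      rw [div_eq_mul_inv _ (4 * b), mul_inv]; push_cast; ring
    rw [this, Complex.re_ofReal_mul, Complex.inv_re]
    refine mul_nonpos_of_nonpos_of_nonneg ?_ (div_nonneg hbpos.le (Complex.normSq_nonneg _))
    have := sq_nonneg (2 * Real.pi * y)
    linarith
  have hnb : ‖(Real.pi : ℂ) / b‖ ≤ |τ|⁻¹ := by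
    have h1 : 4 * Real.pi ^ 2 * |τ| ≤ ‖b‖ := by
      have := Complex.abs_im_le_norm b
      rwa [him, abs_mul, abs_of_pos (show 0 < 4 * Real.pi ^ 2 by positivity)] at this
    have hτ' : 0 < |τ| := abs_pos.2 hτ
    rw [norm_div, Complex.norm_real, Real.norm_of_nonneg Real.pi_pos.le]
    calc Real.pi / ‖b‖ ≤ Real.pi / (4 * Real.pi ^ 2 * |τ|) := by gcongr
      _ = (4 * Real.pi)⁻¹ * |τ|⁻¹ := by field_simp
      _ ≤ 1 * |τ|⁻¹ := by
          gcongr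
          exact inv_le_one_of_one_le₀ (by linarith [Real.pi_gt_three])
      _ = |τ|⁻¹ := one_mul _
  have hc : ‖((Real.pi : ℂ) / b) ^ (1 / 2 : ℂ)‖ ≤ |τ| ^ (-(1 / 2) : ℝ) := by
    have : (1 / 2 : ℂ) = (((1 / 2 : ℝ)) : ℂ) := by push_cast; rfl
    rw [this, Complex.norm_cpow_real, Real.rpow_neg (abs_nonneg _),
      ← Real.inv_rpow (abs_nonneg _)]
    gcongr
  rw [rieszKernel, ← ofReal_norm, norm_mul]
  refine ENNReal.ofReal_le_ofReal ?_
  calc _ ≤ |τ| ^ (-(1 / 2) : ℝ) * 1 := by gcongr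
    _ = _ := mul_one _

/-- `e^{it∂²} e^{ε∂²}` applied to the inverse Fourier transform of `h`. -/
noncomputable def smoothProp (ε : ℝ) (h : L2R) (t x : ℝ) : ℂ :=
  ∫ ξ, h ξ * heatSymbol ε ξ * wave t x ξ

theorem integrable_mul_heatSymbol {ε : ℝ} (hε : 0 < ε) (h : L2R) :
    Integrable (fun ξ => h ξ * heatSymbol ε ξ) volume :=
  (Lp.memLp h).integrable_mul (memLp_heatSymbol hε)

theorem continuous_smoothProp {ε : ℝ} (hε : 0 < ε) (h : L2R) :
    Continuous fun p : ℝ × ℝ => smoothProp ε h p.1 p.2 := by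
  refine continuous_of_dominated (bound := fun ξ => ‖h ξ * heatSymbol ε ξ‖) (fun p => ?_)
    (fun p => ?_) (integrable_mul_heatSymbol hε h).norm ?_
  · refine (integrable_mul_heatSymbol hε h).1.mul (Continuous.aestronglyMeasurable ?_)
    exact continuous_wave.comp (by fun_prop : Continuous fun ξ : ℝ => (p.1, p.2, ξ))
  · refine Eventually.of_forall fun ξ => ?_
    rw [norm_mul, norm_wave, mul_one]
  · refine Eventually.of_forall fun ξ => ?_
    exact continuous_const.mul
      (continuous_wave.comp (by fun_prop : Continuous fun p : ℝ × ℝ => (p.1, p.2, ξ)))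

theorem norm_smoothProp_le {ε : ℝ} (h : L2R) (t x : ℝ) :
    ‖smoothProp ε h t x‖ ≤ ∫ ξ, ‖h ξ * heatSymbol ε ξ‖ := by
  refine (norm_integral_le_integral_norm _).trans (le_of_eq ?_)
  refine integral_congr_ae (Eventually.of_forall fun ξ => ?_)
  simp only [norm_mul, norm_wave, mul_one]

/-- The adjoint of the linearised evolution operator `h ↦ U(t, x(t))`. -/
noncomputable def adjointWave (g : ℝ → ℂ) (x : ℝ → ℝ) (ξ : ℝ) : ℂ := ∫ t, g t * wave t (x t) ξ

theorem measurable_wave_comp {x : ℝ → ℝ} (hx : Measurable x) :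
    Measurable fun p : ℝ × ℝ => wave p.1 (x p.1) p.2 :=
  continuous_wave.measurable.comp
    (measurable_fst.prodMk ((hx.comp measurable_fst).prodMk measurable_snd))

theorem aestronglyMeasurable_adjointWave {g : ℝ → ℂ} {x : ℝ → ℝ} (hg : Measurable g)
    (hx : Measurable x) : AEStronglyMeasurable (adjointWave g x) volume := by
  have : Measurable fun p : ℝ × ℝ => g p.2 * wave p.2 (x p.2) p.1 :=
    (hg.comp measurable_snd).mul ((measurable_wave_comp hx).comp measurable_swap)
  exact (this.stronglyMeasurable.integral_prod_right').aestronglyMeasurable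

/-- This is TT*: the square expands into a double time integral of g(t) and the conjugate of g(r)
against the dispersive kernel at (t - r, x(t) - x(r)). Its bound |t - r|^{-1/2} ignores the curve x,
so Hardy–Littlewood–Sobolev applies. -/
theorem lintegral_heatSymbol_mul_adjointWave_le {ε : ℝ} (hε : 0 < ε) {g : ℝ → ℂ} {x : ℝ → ℝ}
    (hg : Measurable g) (hgi : Integrable g volume) (hx : Measurable x) :
    ∫⁻ ξ, ‖heatSymbol ε ξ * adjointWave g x ξ‖ₑ ^ (2 : ℝ) ≤
      12 * (∫⁻ t, ‖g t‖ₑ ^ (4 / 3 : ℝ)) ^ (3 / 2 : ℝ) := by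
  let F : ℝ → ℝ × ℝ → ℂ := fun ξ p => heatSymbol ε ξ * heatSymbol ε ξ *
    (g p.1 * wave p.1 (x p.1) ξ * starRingEnd ℂ (g p.2 * wave p.2 (x p.2) ξ))
  have hw := measurable_wave_comp hx
  have hFi : Integrable (Function.uncurry F) (volume.prod (volume.prod volume)) := by
    have h1 : Integrable (fun ξ => heatSymbol ε ξ * heatSymbol ε ξ) volume :=
      (memLp_heatSymbol hε).integrable_mul (memLp_heatSymbol hε)
    have hgc : Integrable (fun t => starRingEnd ℂ (g t)) volume :=
      hgi.norm.mono' ((Complex.continuous_conj.measurable.comp hg).aestronglyMeasurable)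
        (Eventually.of_forall fun t => by simp)
    have h2 := h1.mul_prod (hgi.mul_prod hgc)
    have hwm : Measurable fun z : ℝ × ℝ × ℝ =>
        wave z.2.1 (x z.2.1) z.1 * starRingEnd ℂ (wave z.2.2 (x z.2.2) z.1) :=
      (hw.comp ((measurable_fst.comp measurable_snd).prodMk measurable_fst)).mul
        (Complex.continuous_conj.measurable.comp
          (hw.comp ((measurable_snd.comp measurable_snd).prodMk measurable_fst)))
    have h3 := h2.mul_bdd (c := 1) hwm.aestronglyMeasurable
      (Eventually.of_forall fun z => by simp [norm_wave])
    refine h3.congr (Eventually.of_forall fun z => ?_)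
    simp only [F, Function.uncurry, map_mul]
    ring
  have hsq : ∀ ξ, ((‖heatSymbol ε ξ * adjointWave g x ξ‖ ^ 2 : ℝ) : ℂ) = ∫ p, F ξ p ∂(volume.prod volume) := by
    intro ξ
    have h1 : ∫ p : ℝ × ℝ, F ξ p ∂(volume.prod volume) = heatSymbol ε ξ * heatSymbol ε ξ *
        (adjointWave g x ξ * starRingEnd ℂ (adjointWave g x ξ)) := by
      simp only [F]
      rw [integral_const_mul, adjointWave, ← integral_conj, ← integral_prod_mul]
    rw [h1, ← Complex.normSq_eq_norm_sq, ← Complex.mul_conj, map_mul]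
    have : starRingEnd ℂ (heatSymbol ε ξ) = heatSymbol ε ξ := by
      rw [heatSymbol_apply, Complex.conj_ofReal]
    rw [this]; ring
  have hinner : ∀ p : ℝ × ℝ, ∫ ξ, F ξ p = g p.1 * starRingEnd ℂ (g p.2) *
      ∫ ξ, heatSymbol ε ξ * heatSymbol ε ξ * wave (p.1 - p.2) (x p.1 - x p.2) ξ := by
    intro p
    rw [← integral_const_mul]
    refine integral_congr_ae (Eventually.of_forall fun ξ => ?_)
    simp only [F]
    rw [← wave_mul_conj, map_mul]; ring
  have hle : ∀ᵐ p : ℝ × ℝ ∂(volume.prod volume), ‖∫ ξ, F ξ p‖ₑ ≤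
      ‖g p.1‖ₑ * ‖g p.2‖ₑ * rieszKernel (p.1 - p.2) := by
    rw [Measure.ae_prod_iff_ae_ae]
    · refine Eventually.of_forall fun t => ?_
      -- On the diagonal `rieszKernel` takes the default value 0, so the dispersive bound is
      -- available only off this null set.
      have : ∀ᵐ s : ℝ, s ≠ t := by simp [ae_iff]
      filter_upwards [this] with s hs
      rw [hinner, enorm_mul, enorm_mul]
      simp only [RCLike.enorm_conj]
      gcongr
      exact enorm_integral_heatSymbol_mul_wave_le hε (sub_ne_zero.2 (Ne.symm hs)) _
    · have h1 : StronglyMeasurable fun p : ℝ × ℝ => ∫ ξ, F ξ p := by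
        refine StronglyMeasurable.integral_prod_right' (f := fun q : (ℝ × ℝ) × ℝ => F q.2 q.1) ?_
        refine Measurable.stronglyMeasurable ?_
        have hhm := (heatSymbol ε).continuous.measurable
        simp only [F]
        refine ((hhm.comp measurable_snd).mul (hhm.comp measurable_snd)).mul
          (Measurable.mul ?_ (Complex.continuous_conj.measurable.comp ?_))
        · exact (hg.comp (measurable_fst.comp measurable_fst)).mul
            (hw.comp ((measurable_fst.comp measurable_fst).prodMk measurable_snd))
        · exact (hg.comp (measurable_snd.comp measurable_fst)).mul
            (hw.comp ((measurable_snd.comp measurable_fst).prodMk measurable_snd))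
      have hrk := measurable_rieszKernel
      exact measurableSet_le h1.enorm (by fun_prop)
  have hreal : ((∫ ξ, ‖heatSymbol ε ξ * adjointWave g x ξ‖ ^ 2 : ℝ) : ℂ) =
      ∫ p, ∫ ξ, F ξ p ∂volume ∂(volume.prod volume) := by
    rw [← integral_integral_swap hFi, ← integral_complex_ofReal]
    exact integral_congr_ae (Eventually.of_forall hsq)
  have hint : Integrable (fun ξ => ‖heatSymbol ε ξ * adjointWave g x ξ‖ ^ 2) volume := by
    have h1 := hFi.integral_prod_left
    refine h1.norm.congr (Eventually.of_forall fun ξ => ?_)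
    simp only [Function.uncurry]
    rw [← hsq, Complex.norm_real, Real.norm_of_nonneg (by positivity)]
  have e1 : ∫⁻ ξ, ‖heatSymbol ε ξ * adjointWave g x ξ‖ₑ ^ (2 : ℝ) =
      ‖((∫ ξ, ‖heatSymbol ε ξ * adjointWave g x ξ‖ ^ 2 : ℝ) : ℂ)‖ₑ := by
    rw [← ofReal_norm, Complex.norm_real,
      Real.norm_of_nonneg (integral_nonneg fun ξ => by positivity),
      ofReal_integral_eq_lintegral_ofReal hint (Eventually.of_forall fun ξ => by positivity)]
    refine lintegral_congr fun ξ => ?_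
    rw [← ofReal_norm, ENNReal.ofReal_rpow_of_nonneg (norm_nonneg _) (by norm_num), Real.rpow_two]
  rw [e1, hreal]
  refine (enorm_integral_le_lintegral_enorm _).trans ?_
  refine (lintegral_mono_ae hle).trans ?_
  have hrk := measurable_rieszKernel
  rw [lintegral_prod _ (by fun_prop)]
  exact hardyLittlewoodSobolev hg.enorm (fun t => enorm_ne_top)

/-- Duality: Fubini puts the time integral onto `adjointWave`, and Cauchy–Schwarz in frequency
leaves its weighted L² norm. -/
theorem enorm_integral_mul_smoothProp_le {ε : ℝ} (hε : 0 < ε) (h : L2R) {g : ℝ → ℂ} {x : ℝ → ℝ}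
    (hg : Measurable g) (hgi : Integrable g volume) (hx : Measurable x) :
    ‖∫ t, g t * smoothProp ε h t (x t)‖ₑ ≤
      ‖h‖ₑ * (12 * (∫⁻ t, ‖g t‖ₑ ^ (4 / 3 : ℝ)) ^ (3 / 2 : ℝ)) ^ (1 / 2 : ℝ) := by
  have hFi : Integrable (fun p : ℝ × ℝ =>
      g p.1 * (h p.2 * heatSymbol ε p.2 * wave p.1 (x p.1) p.2)) (volume.prod volume) := by
    have h1 := (hgi.mul_prod (integrable_mul_heatSymbol hε h)).mul_bdd (c := 1)
      (measurable_wave_comp hx).aestronglyMeasurable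
      (Eventually.of_forall fun z => (norm_wave _ _ _).le)
    refine h1.congr (Eventually.of_forall fun z => ?_)
    simp only; ring
  have e1 : ∫ t, g t * smoothProp ε h t (x t) =
      ∫ ξ, h ξ * (heatSymbol ε ξ * adjointWave g x ξ) := by
    simp only [smoothProp, ← integral_const_mul]
    rw [integral_integral_swap hFi]
    refine integral_congr_ae (Eventually.of_forall fun ξ => ?_)
    simp only [adjointWave, ← integral_const_mul]
    refine integral_congr_ae (Eventually.of_forall fun t => ?_)
    simp only; ring
  rw [e1]
  refine (enorm_integral_le_lintegral_enorm _).trans ?_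
  simp_rw [enorm_mul (h _)]
  have hpq : (2 : ℝ).HolderConjugate 2 := by rw [Real.holderConjugate_iff]; norm_num
  have hH := ENNReal.lintegral_mul_le_Lp_mul_Lq volume hpq (Lp.aestronglyMeasurable h).enorm
    (((heatSymbol ε).continuous.aestronglyMeasurable.mul
      (aestronglyMeasurable_adjointWave hg hx)).enorm)
  refine hH.trans ?_
  have e2 : (∫⁻ ξ, ‖h ξ‖ₑ ^ (2 : ℝ)) ^ (1 / 2 : ℝ) = ‖h‖ₑ := by
    rw [Lp.enorm_def, eLpNorm_eq_lintegral_rpow_enorm_toReal (by simp) (by simp)]; simp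
  rw [e2]
  gcongr
  exact lintegral_heatSymbol_mul_adjointWave_le hε hg hgi hx

/-- The absorption at the end of the duality argument: in fourth powers the inequality reads y⁴ ≤
144 c⁴ y³, and finiteness of y permits cancelling y³. -/
theorem le_of_le_mul_rpow {y c : ℝ≥0∞} (hy : y ≠ ⊤)
    (h : y ≤ c * (12 * y ^ (3 / 2 : ℝ)) ^ (1 / 2 : ℝ)) : y ≤ 144 * c ^ 4 := by
  rcases eq_or_ne y 0 with rfl | hy0
  · exact zero_le
  have h4 : y ^ 4 ≤ 144 * c ^ 4 * y ^ 3 := by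
    calc y ^ 4 ≤ (c * (12 * y ^ (3 / 2 : ℝ)) ^ (1 / 2 : ℝ)) ^ 4 := by gcongr
      _ = 144 * c ^ 4 * y ^ 3 := by
        rw [mul_pow]
        have : ((12 * y ^ (3 / 2 : ℝ)) ^ (1 / 2 : ℝ)) ^ 4 = 144 * y ^ 3 := by
          rw [← ENNReal.rpow_natCast, ← ENNReal.rpow_mul,
            show (1 / 2 : ℝ) * ((4 : ℕ) : ℝ) = ((2 : ℕ) : ℝ) by norm_num, ENNReal.rpow_natCast,
            mul_pow, ← ENNReal.rpow_natCast (y ^ (3 / 2 : ℝ)), ← ENNReal.rpow_mul,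
            show (3 / 2 : ℝ) * ((2 : ℕ) : ℝ) = ((3 : ℕ) : ℝ) by norm_num, ENNReal.rpow_natCast]
          norm_num
        rw [this]; ring
  have h5 : y * y ^ 3 ≤ 144 * c ^ 4 * y ^ 3 := by rwa [← pow_succ']
  exact (ENNReal.mul_le_mul_iff_left (pow_ne_zero 3 hy0) (ENNReal.pow_ne_top hy)).1 h5

/-- The dual estimate is tested with the extremal g = |u|² ū, for which ∫ g u = ∫ |u|⁴ = ∫
|g|^{4/3}. Cutting g off to [-n, n] keeps this quantity finite, u being bounded, so it can be
absorbed; the resulting bound does not depend on n. -/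
theorem lintegral_smoothProp_comp_le {ε : ℝ} (hε : 0 < ε) (h : L2R) {x : ℝ → ℝ}
    (hx : Measurable x) : ∫⁻ t, ‖smoothProp ε h t (x t)‖ₑ ^ 4 ≤ 144 * ‖h‖ₑ ^ 4 := by
  have hum : Measurable fun t => smoothProp ε h t (x t) :=
    Measurable.comp (g := fun p : ℝ × ℝ => smoothProp ε h p.1 p.2) (f := fun t => (t, x t))
      (continuous_smoothProp hε h).measurable (measurable_id.prodMk hx)
  set u : ℝ → ℂ := fun t => smoothProp ε h t (x t) with hu
  set M := ∫ ξ, ‖h ξ * heatSymbol ε ξ‖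
  have huM : ∀ t, ‖u t‖ ≤ M := fun t => norm_smoothProp_le h _ _
  have key : ∀ n : ℕ, ∫⁻ t in Icc (-n : ℝ) n, ‖u t‖ₑ ^ 4 ≤ 144 * ‖h‖ₑ ^ 4 := by
    intro n
    set g : ℝ → ℂ := (Icc (-n : ℝ) n).indicator fun t => ((‖u t‖ ^ 2 : ℝ) : ℂ) * starRingEnd ℂ (u t)
      with hgdef
    have hgm : Measurable g := by
      refine Measurable.indicator ?_ measurableSet_Icc
      have := Complex.continuous_conj.measurable.comp hum
      fun_prop
    have hgi : Integrable g volume := by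
      rw [hgdef, integrable_indicator_iff measurableSet_Icc]
      refine Measure.integrableOn_of_bounded (M := M ^ 2 * M) (by simp) ?_ ?_
      · have := Complex.continuous_conj.measurable.comp hum
        exact Measurable.aestronglyMeasurable (by fun_prop)
      · refine Eventually.of_forall fun t => ?_
        rw [norm_mul, Complex.norm_real, Real.norm_of_nonneg (by positivity), RCLike.norm_conj]
        gcongr <;> exact huM t
    have hY : ∫⁻ t in Icc (-n : ℝ) n, ‖u t‖ₑ ^ 4 ≠ ⊤ := by
      have h1 : ∫⁻ t in Icc (-n : ℝ) n, ‖u t‖ₑ ^ 4 ≤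
          ∫⁻ _ in Icc (-n : ℝ) n, ENNReal.ofReal M ^ 4 := by
        refine setLIntegral_mono' measurableSet_Icc fun t _ => ?_
        gcongr
        rw [← ofReal_norm]; exact ENNReal.ofReal_le_ofReal (huM t)
      refine ne_of_lt (h1.trans_lt ?_)
      rw [setLIntegral_const, Real.volume_Icc]
      exact ENNReal.mul_lt_top (ENNReal.pow_lt_top ENNReal.ofReal_lt_top) ENNReal.ofReal_lt_top
    have hA : ∫⁻ t, ‖g t‖ₑ ^ (4 / 3 : ℝ) = ∫⁻ t in Icc (-n : ℝ) n, ‖u t‖ₑ ^ 4 := by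
      rw [← lintegral_indicator measurableSet_Icc]
      refine lintegral_congr fun t => ?_
      by_cases ht : t ∈ Icc (-n : ℝ) n
      · rw [hgdef, indicator_of_mem ht, indicator_of_mem ht]
        have : ‖((‖u t‖ ^ 2 : ℝ) : ℂ) * starRingEnd ℂ (u t)‖ₑ = ‖u t‖ₑ ^ 3 := by
          rw [enorm_mul]
          simp only [RCLike.enorm_conj]
          rw [← ofReal_norm, Complex.norm_real, Real.norm_of_nonneg (by positivity),
            ENNReal.ofReal_pow (norm_nonneg _), ofReal_norm]; ring
        rw [this, ← ENNReal.rpow_natCast, ← ENNReal.rpow_mul,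
          show ((3 : ℕ) : ℝ) * (4 / 3) = ((4 : ℕ) : ℝ) by norm_num, ENNReal.rpow_natCast]
      · rw [hgdef, indicator_of_notMem ht, indicator_of_notMem ht]; simp
    have hL : ‖∫ t, g t * u t‖ₑ = ∫⁻ t in Icc (-n : ℝ) n, ‖u t‖ₑ ^ 4 := by
      have e1 : ∫ t, g t * u t = ((∫ t in Icc (-n : ℝ) n, ‖u t‖ ^ 4 : ℝ) : ℂ) := by
        rw [← integral_complex_ofReal, ← integral_indicator measurableSet_Icc]
        refine integral_congr_ae (Eventually.of_forall fun t => ?_)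
        by_cases ht : t ∈ Icc (-n : ℝ) n
        · simp only [hgdef, indicator_of_mem ht]
          rw [mul_assoc, mul_comm (starRingEnd ℂ (u t)), Complex.mul_conj,
            Complex.normSq_eq_norm_sq]
          norm_cast; ring
        · simp only [hgdef, indicator_of_notMem ht, zero_mul]
      rw [e1, ← ofReal_norm, Complex.norm_real,
        Real.norm_of_nonneg (integral_nonneg fun t => by positivity),
        ofReal_integral_eq_lintegral_ofReal]
      · refine lintegral_congr fun t => ?_
        rw [ENNReal.ofReal_pow (norm_nonneg _), ofReal_norm]
      · refine Measure.integrableOn_of_bounded (M := M ^ 4) (by simp)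
          (hum.norm.pow_const 4).aestronglyMeasurable (Eventually.of_forall fun t => ?_)
        rw [Real.norm_of_nonneg (by positivity)]
        gcongr; exact huM t
      · exact Eventually.of_forall fun t => by positivity
    have hdual := enorm_integral_mul_smoothProp_le hε h hgm hgi hx
    rw [hA] at hdual
    change ‖∫ t, g t * u t‖ₑ ≤ _ at hdual
    rw [hL] at hdual
    exact le_of_le_mul_rpow hY hdual
  have hcov : AECover volume atTop fun n : ℕ => Icc (-n : ℝ) n :=
    aecover_Icc (tendsto_neg_atTop_atBot.comp tendsto_natCast_atTop_atTop)
      tendsto_natCast_atTop_atTop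
  exact le_of_tendsto'
    (hcov.lintegral_tendsto_of_countably_generated (hum.enorm.pow_const 4).aemeasurable) key

end Strichartz

/-! ### Strichartz estimates for the free group and for Duhamel terms -/

section StrichartzL2

open scoped ENNReal BoundedContinuousFunction FourierTransform

/-- Measurable selection of almost maximisers of a jointly continuous function. -/
theorem exists_measurable_maximizers {S : ℝ → ℝ → ℂ} (hS : Continuous fun p : ℝ × ℝ => S p.1 p.2) :
    ∃ x : ℕ → ℝ → ℝ, (∀ n, Measurable (x n)) ∧ (∀ t, Monotone fun n => ‖S t (x n t)‖ₑ) ∧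
      ∀ t y, ‖S t y‖ₑ ≤ ⨆ n, ‖S t (x n t)‖ₑ := by
  classical
  let q := TopologicalSpace.denseSeq ℝ
  -- A running record: x n t is a best point among the first n + 1 dense points, replaced only on
  -- strict improvement. This keeps it measurable in t and makes the values increase.
  let x : ℕ → ℝ → ℝ := fun n => Nat.rec (fun _ => q 0)
    (fun n xn t => if ‖S t (xn t)‖ₑ < ‖S t (q (n + 1))‖ₑ then q (n + 1) else xn t) n
  have hx0 : x 0 = fun _ => q 0 := rfl
  have hxs : ∀ n, x (n + 1) =
      fun t => if ‖S t (x n t)‖ₑ < ‖S t (q (n + 1))‖ₑ then q (n + 1) else x n t := fun n => rfl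
  clear_value x
  have hm : ∀ {y : ℝ → ℝ}, Measurable y → Measurable fun t => ‖S t (y t)‖ₑ := fun {y} hy =>
    (Measurable.comp (g := fun p : ℝ × ℝ => S p.1 p.2) (f := fun t => (t, y t))
      hS.measurable (measurable_id.prodMk hy)).enorm
  refine ⟨x, fun n => ?_, fun t => ?_, fun t y => ?_⟩
  · induction n with
    | zero => rw [hx0]; exact measurable_const
    | succ n ih =>
      rw [hxs]
      exact Measurable.ite (measurableSet_lt (hm ih) (hm measurable_const)) measurable_const ih
  · refine monotone_nat_of_le_succ fun n => ?_
    rw [hxs]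
    dsimp only
    split_ifs with h
    · exact h.le
    · exact le_rfl
  · have hq : ∀ n, ‖S t (q n)‖ₑ ≤ ‖S t (x n t)‖ₑ := by
      intro n
      cases n with
      | zero => rw [hx0]
      | succ n =>
        rw [hxs]
        dsimp only
        split_ifs with h
        · exact le_rfl
        · exact not_lt.1 h
    have hcl : IsClosed {y | ‖S t y‖ₑ ≤ ⨆ n, ‖S t (x n t)‖ₑ} :=
      isClosed_le ((hS.comp (by fun_prop : Continuous fun y : ℝ => (t, y))).enorm) continuous_const
    have : closure (range q) ⊆ {y | ‖S t y‖ₑ ≤ ⨆ n, ‖S t (x n t)‖ₑ} := by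
      refine closure_minimal ?_ hcl
      rintro _ ⟨n, rfl⟩
      exact (hq n).trans (le_iSup (fun n => ‖S t (x n t)‖ₑ) n)
    exact this ((TopologicalSpace.denseRange_denseSeq ℝ) y)

/-- The supremum in space is linearised: along measurable almost maximisers the estimate for curves
x(t) holds with a constant independent of the curve, and monotone convergence recovers the supremum.
-/
theorem lintegral_eLpNorm_smoothProp_le {ε : ℝ} (hε : 0 < ε) (h : L2R) :
    ∫⁻ t, eLpNorm (smoothProp ε h t) ⊤ volume ^ 4 ≤ 144 * ‖h‖ₑ ^ 4 := by
  obtain ⟨x, hx, hmono, hsup⟩ := exists_measurable_maximizers (continuous_smoothProp hε h)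
  have hm : ∀ n, Measurable fun t => ‖smoothProp ε h t (x n t)‖ₑ ^ 4 := fun n =>
    (Measurable.comp (g := fun p : ℝ × ℝ => smoothProp ε h p.1 p.2) (f := fun t => (t, x n t))
      (continuous_smoothProp hε h).measurable (measurable_id.prodMk (hx n))).enorm.pow_const 4
  calc ∫⁻ t, eLpNorm (smoothProp ε h t) ⊤ volume ^ 4
      ≤ ∫⁻ t, ⨆ n, ‖smoothProp ε h t (x n t)‖ₑ ^ 4 := by
        refine lintegral_mono fun t => ?_
        have h1 : eLpNorm (smoothProp ε h t) ⊤ volume ≤ ⨆ n, ‖smoothProp ε h t (x n t)‖ₑ := by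
          rw [eLpNorm_exponent_top]
          exact eLpNormEssSup_le_of_ae_enorm_bound (Eventually.of_forall fun y => hsup t y)
        refine (pow_le_pow_left' h1 4).trans (le_of_eq ?_)
        exact (Monotone.map_iSup_of_continuousAt (f := fun z : ℝ≥0∞ => z ^ 4)
          (ENNReal.continuous_pow 4).continuousAt (pow_left_mono 4) (by simp))
    _ = ⨆ n, ∫⁻ t, ‖smoothProp ε h t (x n t)‖ₑ ^ 4 :=
        lintegral_iSup hm fun m n hmn t => pow_le_pow_left' (hmono t hmn) 4
    _ ≤ 144 * ‖h‖ₑ ^ 4 := iSup_le fun n => lintegral_smoothProp_comp_le hε h (hx n)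

/-- The inverse Fourier transform on `L²(ℝ)` is given by the integral for integrable functions. -/
theorem fourierL2_symm_ae_eq {m : ℝ → ℂ} (hm : MemLp m 2 volume) (hi : Integrable m volume)
    (hc : Continuous fun x => ∫ ξ, m ξ * wave 0 x ξ) :
    fourierL2.symm (toL2 m) =ᵐ[volume] fun x => ∫ ξ, m ξ * wave 0 x ξ := by
  refine ae_eq_of_integral_contDiff_smul_eq
    ((Lp.memLp (fourierL2.symm (toL2 m))).locallyIntegrable (by norm_num)) hc.locallyIntegrable
    fun φ hφ hφc => ?_
  let ψ : 𝓢(ℝ, ℂ) := HasCompactSupport.toSchwartzMap (f := fun x => (φ x : ℂ))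
    (hφc.comp_left Complex.ofReal_zero) (Complex.ofRealCLM.contDiff.comp hφ)
  have hψ : ∀ x, ψ x = (φ x : ℂ) := fun x => rfl
  -- The inverse transform on L² agrees with the one on tempered distributions, so paired with a
  -- test function it can be moved onto that function and expanded by Fubini.
  have h1 := congrArg (fun T => T ψ) (Lp.fourierInv_toTemperedDistribution_eq (toL2 m))
  simp only [TemperedDistribution.fourierInv_apply, Lp.toTemperedDistribution_apply] at h1
  have e1 : ∫ x, φ x • (fourierL2.symm (toL2 m)) x = ∫ x, ψ x • (𝓕⁻ (toL2 m) : L2R) x := rfl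
  rw [e1, ← h1]
  have e2 : ∫ ξ, (𝓕⁻ ψ : 𝓢(ℝ, ℂ)) ξ • toL2 m ξ = ∫ ξ, ∫ x, ψ x * (m ξ * wave 0 x ξ) := by
    refine integral_congr_ae ?_
    filter_upwards [coeFn_toL2 hm] with ξ h
    rw [h, SchwartzMap.fourierInv_coe, Real.fourierInv_eq', smul_eq_mul, ← integral_mul_const]
    refine integral_congr_ae (Eventually.of_forall fun x => ?_)
    simp only [smul_eq_mul, wave]
    have : (2 * Real.pi * inner ℝ x ξ : ℝ) = 2 * Real.pi * x * ξ - 0 * freq ξ := by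
      simp only [RCLike.inner_apply, conj_trivial]; ring
    rw [this]; ring
  rw [e2]
  have hF : Integrable (fun p : ℝ × ℝ => ψ p.2 * (m p.1 * wave 0 p.2 p.1)) (volume.prod volume) := by
    have h2 := (hi.mul_prod (ψ.integrable (μ := volume))).mul_bdd (c := 1)
      (g := fun p : ℝ × ℝ => wave 0 p.2 p.1)
      (continuous_wave.comp (by fun_prop :
        Continuous fun p : ℝ × ℝ => ((0 : ℝ), p.2, p.1))).aestronglyMeasurable
      (Eventually.of_forall fun z => (norm_wave _ _ _).le)
    refine h2.congr (Eventually.of_forall fun z => ?_)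
    simp only; ring
  rw [integral_integral_swap hF]
  refine integral_congr_ae (Eventually.of_forall fun x => ?_)
  simp only [Complex.real_smul, ← integral_const_mul, hψ]

theorem freeProp_heatSymbol_ae_eq {ε : ℝ} (hε : 0 < ε) (h : L2R) (t : ℝ) :
    freeProp t (fourierL2.symm (mulL2 (heatSymbol ε) h)) =ᵐ[volume] smoothProp ε h t := by
  have hw : ∀ x ξ, (propSymbol t * heatSymbol ε) ξ * h ξ * wave 0 x ξ =
      h ξ * heatSymbol ε ξ * wave t x ξ := by
    intro x ξ
    have : propSymbol t ξ * wave 0 x ξ = wave t x ξ := by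
      rw [propSymbol_apply, wave, wave, ← Complex.exp_add]
      congr 1; push_cast; ring
    rw [BoundedContinuousFunction.mul_apply, ← this]; ring
  have hint : (fun x => ∫ ξ, (propSymbol t * heatSymbol ε) ξ * h ξ * wave 0 x ξ) =
      smoothProp ε h t := by
    ext x
    simp only [smoothProp, hw]
  rw [freeProp_apply, LinearIsometryEquiv.apply_symm_apply, mulL2_mulL2, mulL2_apply, ← hint]
  refine fourierL2_symm_ae_eq (memLp_mul_bcf _ h) ?_ ?_
  · refine ((integrable_mul_heatSymbol hε h).bdd_mul (c := 1)
      (propSymbol t).continuous.aestronglyMeasurable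
      (Eventually.of_forall fun ξ => (norm_propSymbol t ξ).le)).congr
      (Eventually.of_forall fun ξ => ?_)
    simp only [BoundedContinuousFunction.mul_apply]; ring
  · rw [hint]
    exact (continuous_smoothProp hε h).comp (by fun_prop : Continuous fun x : ℝ => (t, x))

/-- Fatou's lemma for the norm of `L⁴_t L^∞_x`. -/
theorem lintegral_supNorm_le_of_tendsto {μ : Measure ℝ} {F : ℕ → ℝ → L2R} {W : ℝ → L2R}
    (hm : ∀ n, AEMeasurable (F n) μ)
    (hlim : ∀ᵐ t ∂μ, Tendsto (fun n => F n t) atTop (𝓝 (W t))) {B : ℕ → ℝ≥0∞} {b : ℝ≥0∞}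
    (hB : ∀ n, ∫⁻ t, supNorm (F n t) ^ 4 ∂μ ≤ B n) (hb : Tendsto B atTop (𝓝 b)) :
    ∫⁻ t, supNorm (W t) ^ 4 ∂μ ≤ b := by
  calc ∫⁻ t, supNorm (W t) ^ 4 ∂μ
      ≤ ∫⁻ t, atTop.liminf fun n => supNorm (F n t) ^ 4 ∂μ := by
        refine lintegral_mono_ae ?_
        filter_upwards [hlim] with t ht
        refine (pow_le_pow_left' (supNorm_le_liminf ht) 4).trans (le_of_eq ?_)
        exact (Monotone.map_liminf_of_continuousAt (f := fun z : ℝ≥0∞ => z ^ 4) (pow_left_mono 4) _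
          (ENNReal.continuous_pow 4).continuousAt)
    _ ≤ atTop.liminf fun n => ∫⁻ t, supNorm (F n t) ^ 4 ∂μ :=
        lintegral_liminf_le' fun n => (measurable_supNorm.comp_aemeasurable (hm n)).pow_const 4
    _ ≤ atTop.liminf B := liminf_le_liminf (Eventually.of_forall hB)
    _ = b := hb.liminf_eq

/-- The triangle inequality for the norm of `L⁴_t L^∞_x`. -/
theorem lintegral_supNorm_add_le {μ : Measure ℝ} {F G : ℝ → L2R} (hF : AEMeasurable F μ)
    (hG : AEMeasurable G μ) {x y : ℝ≥0∞} (hx : ∫⁻ t, supNorm (F t) ^ 4 ∂μ ≤ x ^ 4)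
    (hy : ∫⁻ t, supNorm (G t) ^ 4 ∂μ ≤ y ^ 4) :
    ∫⁻ t, supNorm (F t + G t) ^ 4 ∂μ ≤ (x + y) ^ 4 := by
  have hroot : ∀ {z w : ℝ≥0∞}, z ≤ w ^ 4 → z ^ (1 / 4 : ℝ) ≤ w := fun {z w} h => by
    calc z ^ (1 / 4 : ℝ) ≤ (w ^ 4) ^ (1 / 4 : ℝ) := by gcongr
      _ = w := by rw [← ENNReal.rpow_natCast, ← ENNReal.rpow_mul]; norm_num
  have hL := ENNReal.lintegral_Lp_add_le (p := 4) (measurable_supNorm.comp_aemeasurable hF)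
    (measurable_supNorm.comp_aemeasurable hG) (by norm_num)
  simp only [Pi.add_apply, Function.comp_apply, ENNReal.rpow_ofNat] at hL
  have h1 : (∫⁻ t, supNorm (F t + G t) ^ 4 ∂μ) ^ (1 / 4 : ℝ) ≤ x + y := by
    refine le_trans ?_ (hL.trans (add_le_add (hroot hx) (hroot hy)))
    gcongr with t
    exact supNorm_add_le _ _
  calc ∫⁻ t, supNorm (F t + G t) ^ 4 ∂μ
      = ((∫⁻ t, supNorm (F t + G t) ^ 4 ∂μ) ^ (1 / 4 : ℝ)) ^ 4 := by
        rw [← ENNReal.rpow_natCast, ← ENNReal.rpow_mul]; norm_num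
    _ ≤ (x + y) ^ 4 := by gcongr

/-- The homogeneous `L⁴_t L^∞_x` Strichartz estimate. -/
theorem strichartz (f : L2R) : ∫⁻ t, supNorm (freeProp t f) ^ 4 ≤ (4 * ‖f‖ₑ) ^ 4 := by
  set h := fourierL2 f with hh
  -- Heat regularisation at scale 1/(n+1). The estimate is uniform in it, so Fatou's lemma removes
  -- it.
  let ε : ℕ → ℝ := fun n => 1 / ((n : ℝ) + 1)
  have hε : ∀ n, 0 < ε n := fun n => by positivity
  let F : ℕ → ℝ → L2R := fun n t => freeProp t (fourierL2.symm (mulL2 (heatSymbol (ε n)) h))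
  have hlim : Tendsto (fun n => mulL2 (heatSymbol (ε n)) h) atTop (𝓝 h) := by
    conv => enter [3]; rw [← mulL2_one h]
    refine tendsto_mulL2 (C := 1) (Eventually.of_forall fun n ξ => norm_heatSymbol_le _ ξ)
      (fun ξ => by simp) (fun ξ => ?_) h
    have h1 : Tendsto ε atTop (𝓝 0) := tendsto_one_div_add_atTop_nhds_zero_nat
    have h2 : Continuous fun e : ℝ => ((Real.exp (-(|e| * freq ξ)) : ℝ) : ℂ) := by fun_prop
    simpa [heatSymbol_apply, Function.comp_def] using (h2.tendsto 0).comp h1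
  refine lintegral_supNorm_le_of_tendsto (F := F) (B := fun _ => (4 * ‖f‖ₑ) ^ 4)
    (fun n => (continuous_freeProp_left _).measurable.aemeasurable)
    (Eventually.of_forall fun t => ?_) (fun n => ?_) tendsto_const_nhds
  · have h1 := (freeProp t).continuous.tendsto _ |>.comp
      ((fourierL2.symm.continuous.tendsto h).comp hlim)
    rw [hh, LinearIsometryEquiv.symm_apply_apply] at h1
    exact h1
  · calc ∫⁻ t, supNorm (F n t) ^ 4
        = ∫⁻ t, eLpNorm (smoothProp (ε n) h t) ⊤ volume ^ 4 := by
          refine lintegral_congr fun t => ?_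
          rw [supNorm, eLpNorm_congr_ae (freeProp_heatSymbol_ae_eq (hε n) h t)]
      _ ≤ 144 * ‖h‖ₑ ^ 4 := lintegral_eLpNorm_smoothProp_le (hε n) h
      _ = 144 * ‖f‖ₑ ^ 4 := by
          have : ‖h‖ₑ = ‖f‖ₑ := by
            rw [← ofReal_norm, ← ofReal_norm, hh, LinearIsometryEquiv.norm_map]
          rw [this]
      -- The constant is enlarged to 4⁴, so that the estimate has the form of a fourth power that
      -- the triangle inequality requires.
      _ ≤ 256 * ‖f‖ₑ ^ 4 := by gcongr; norm_num
      _ = (4 * ‖f‖ₑ) ^ 4 := by rw [mul_pow]; norm_num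

theorem continuous_setIntegral_Iic {K : ℝ → L2R} (hK : Integrable K volume) :
    Continuous fun t => ∫ r in Iic t, K r := by
  have h : (fun t => ∫ r in Iic t, K r) = fun t => (∫ r in Iic 0, K r) + ∫ r in (0 : ℝ)..t, K r := by
    ext1 t
    rw [← intervalIntegral.integral_Iic_sub_Iic hK.integrableOn hK.integrableOn]
    abel
  rw [h]
  exact continuous_const.add
    (intervalIntegral.continuous_primitive (fun a b => hK.intervalIntegrable) 0)

/-- The `L⁴_t L^∞_x` Strichartz estimate for primitives of integrable curves. -/
theorem strichartz_primitive {K : ℝ → L2R} (hK : Integrable K volume) :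
    ∫⁻ t, supNorm (freeProp t (∫ r in Iic t, K r)) ^ 4 ≤ (4 * ∫⁻ r, ‖K r‖ₑ) ^ 4 := by
  have hcont : ∀ {K : ℝ → L2R}, Integrable K volume →
      Measurable fun t => freeProp t (∫ r in Iic t, K r) := fun hK =>
    (continuous_freeProp.comp (continuous_id.prodMk (continuous_setIntegral_Iic hK))).measurable
  -- For forcing in L¹ in time the retarded estimate needs no Christ–Kiselev argument. For a
  -- constant c on a set s the primitive is |s ∩ (-∞, t]| c, a multiple of c by at most |s|, and the
  -- homogeneous estimate applies. Disjoint supports make the L¹ norm additive, so the bounds add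
  -- up, and Fatou passes to L¹ limits.
  refine Integrable.induction
    (fun K => ∫⁻ t, supNorm (freeProp t (∫ r in Iic t, K r)) ^ 4 ≤ (4 * ∫⁻ r, ‖K r‖ₑ) ^ 4)
    ?_ ?_ ?_ ?_ hK
  · intro c s hs hμ
    have e1 : ∀ t, ∫ r in Iic t, s.indicator (fun _ => c) r = volume.real (s ∩ Iic t) • c := by
      intro t
      rw [integral_indicator hs, Measure.restrict_restrict hs, setIntegral_const]
    have e2 : ∫⁻ r, ‖s.indicator (fun _ => c) r‖ₑ = volume s * ‖c‖ₑ := by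
      simp_rw [enorm_indicator_eq_indicator_enorm]
      rw [lintegral_indicator_const hs, mul_comm]
    rw [e2]
    calc ∫⁻ t, supNorm (freeProp t (∫ r in Iic t, s.indicator (fun _ => c) r)) ^ 4
        ≤ ∫⁻ t, volume s ^ 4 * supNorm (freeProp t c) ^ 4 := by
          refine lintegral_mono fun t => ?_
          rw [e1, ← mul_pow]
          refine pow_le_pow_left' ?_ 4
          rw [show volume.real (s ∩ Iic t) • c = ((volume.real (s ∩ Iic t) : ℝ) : ℂ) • c from
            (Complex.coe_smul _ c).symm, map_smul, supNorm_smul]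
          gcongr
          rw [← ofReal_norm, Complex.norm_real, Real.norm_of_nonneg measureReal_nonneg,
            ofReal_measureReal (((measure_mono inter_subset_left).trans_lt hμ).ne)]
          exact measure_mono inter_subset_left
      _ = volume s ^ 4 * ∫⁻ t, supNorm (freeProp t c) ^ 4 :=
          lintegral_const_mul' _ _ (ENNReal.pow_ne_top hμ.ne)
      _ ≤ volume s ^ 4 * (4 * ‖c‖ₑ) ^ 4 := by gcongr; exact strichartz c
      _ = (4 * (volume s * ‖c‖ₑ)) ^ 4 := by ring
  · intro f g hd hf hg hPf hPg
    have e1 : ∀ t, freeProp t (∫ r in Iic t, (f + g) r) =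
        freeProp t (∫ r in Iic t, f r) + freeProp t (∫ r in Iic t, g r) := by
      intro t
      rw [← map_add, ← integral_add hf.integrableOn hg.integrableOn]; rfl
    have e2 : ∫⁻ r, ‖(f + g) r‖ₑ = (∫⁻ r, ‖f r‖ₑ) + ∫⁻ r, ‖g r‖ₑ := by
      rw [← lintegral_add_left' hf.1.enorm]
      refine lintegral_congr fun r => ?_
      by_cases h : f r = 0
      · simp [h]
      · have : g r = 0 := by
          by_contra h'
          exact disjoint_left.1 hd h h'
        simp [this]
    simp_rw [e1]
    rw [e2, mul_add]
    exact lintegral_supNorm_add_le (hcont hf).aemeasurable (hcont hg).aemeasurable hPf hPg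
  · refine IsSeqClosed.isClosed fun F f hF hlim => ?_
    refine lintegral_supNorm_le_of_tendsto
      (F := fun n t => freeProp t (∫ r in Iic t, F n r))
      (B := fun n => (4 * ∫⁻ r, ‖F n r‖ₑ) ^ 4)
      (fun n => (hcont (L1.integrable_coeFn (F n))).aemeasurable) (Eventually.of_forall fun t => ?_)
      hF ?_
    · refine ((freeProp t).continuous.tendsto _).comp ?_
      exact ((continuous_setIntegral (Iic t)).tendsto f).comp hlim
    · have h1 : ∀ g : ℝ →₁[volume] L2R, ∫⁻ r, ‖g r‖ₑ = ‖g‖ₑ := fun g => by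
        rw [Lp.enorm_def, eLpNorm_one_eq_lintegral_enorm]
      simp only [h1]
      refine ((ENNReal.continuous_pow 4).tendsto _).comp ?_
      exact ENNReal.Tendsto.const_mul hlim.enorm (Or.inr (by simp))
  · intro f g hfg hf h
    have e1 : ∀ t, ∫ r in Iic t, f r = ∫ r in Iic t, g r := fun t =>
      integral_congr_ae (ae_restrict_of_ae hfg)
    have e2 : ∫⁻ r, ‖f r‖ₑ = ∫⁻ r, ‖g r‖ₑ := lintegral_congr_ae (hfg.mono fun r hr => by simp [hr])
    simpa only [e1, e2] using h

end StrichartzL2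

/-! ### Lipschitz bounds for the power nonlinearity and their integrability in time -/

section Nonlinearity

open scoped ENNReal BoundedContinuousFunction

/-- For y > 0, with r = y/x in (0, 1], the claim is (1 - r^α) r ≤ 2 (1 - r). Since α ≤ 2, r^α ≥ r²,
and 2 (1 - r) - (1 - r²) r = (1 - r)² (2 + r). -/
theorem rpow_sub_rpow_mul_le {α x y : ℝ} (hα₂ : α ≤ 2) (hy : 0 ≤ y) (hyx : y ≤ x) :
    (x ^ α - y ^ α) * y ≤ 2 * x ^ α * (x - y) := by
  rcases eq_or_lt_of_le hy with rfl | hy0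
  · have : 0 ≤ 2 * x ^ α * (x - 0) := by positivity
    simpa using this
  have hx : 0 < x := hy0.trans_le hyx
  set r := y / x with hr
  have hr0 : 0 < r := div_pos hy0 hx
  have hr1 : r ≤ 1 := (div_le_one hx).2 hyx
  have hyr : y = x * r := by rw [hr]; field_simp
  have hrα : r ^ 2 ≤ r ^ α := by
    rw [← Real.rpow_two]; exact Real.rpow_le_rpow_of_exponent_ge hr0 hr1 hα₂
  have hxα : 0 ≤ x ^ α := by positivity
  rw [hyr, Real.mul_rpow hx.le hr0.le]
  have h1 : (x ^ α - x ^ α * r ^ α) * (x * r) ≤ (x ^ α - x ^ α * r ^ 2) * (x * r) := by gcongr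
  have h2 : 0 ≤ x ^ α * x * (1 - r) * (2 + r) * (1 - r) := by
    have := sub_nonneg.2 hr1
    positivity
  nlinarith [h1, h2]

/-- Local Lipschitz estimate for the power nonlinearity. -/
theorem norm_powerNL_sub_le {α : ℝ} (hα₀ : 0 ≤ α) (hα₂ : α ≤ 2) {z w : ℂ} {M : ℝ}
    (hz : ‖z‖ ≤ M) (hw : ‖w‖ ≤ M) :
    ‖powerNL α z - powerNL α w‖ ≤ 3 * M ^ α * ‖z - w‖ := by
  wlog h : ‖w‖ ≤ ‖z‖ generalizing z w
  · rw [norm_sub_rev, norm_sub_rev z]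
    exact this hw hz (le_of_not_ge h)
  have e : powerNL α z - powerNL α w = ((‖z‖ ^ α : ℝ) : ℂ) * (z - w) +
      ((‖z‖ ^ α - ‖w‖ ^ α : ℝ) : ℂ) * w := by
    rw [powerNL, powerNL]; push_cast; ring
  have hmono : ‖w‖ ^ α ≤ ‖z‖ ^ α := by gcongr
  have h1 : ‖z‖ - ‖w‖ ≤ ‖z - w‖ := norm_sub_norm_le z w
  calc ‖powerNL α z - powerNL α w‖
      ≤ ‖z‖ ^ α * ‖z - w‖ + (‖z‖ ^ α - ‖w‖ ^ α) * ‖w‖ := by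
        rw [e]
        refine (norm_add_le _ _).trans (le_of_eq ?_)
        rw [norm_mul, norm_mul, Complex.norm_real, Complex.norm_real,
          Real.norm_of_nonneg (by positivity), Real.norm_of_nonneg (sub_nonneg.2 hmono)]
    _ ≤ ‖z‖ ^ α * ‖z - w‖ + 2 * ‖z‖ ^ α * (‖z‖ - ‖w‖) := by
        exact add_le_add le_rfl (rpow_sub_rpow_mul_le hα₂ (norm_nonneg _) h)
    _ ≤ ‖z‖ ^ α * ‖z - w‖ + 2 * ‖z‖ ^ α * ‖z - w‖ := by gcongr
    _ = 3 * ‖z‖ ^ α * ‖z - w‖ := by ring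
    _ ≤ 3 * M ^ α * ‖z - w‖ := by gcongr

theorem norm_freeDirac (a : ℂ) (t s : ℝ) : ‖freeDirac a t s‖ = ‖a‖ / √t := by
  rw [freeDirac, norm_div, norm_mul, mul_comm Complex.I, Complex.norm_exp_ofReal_mul_I, mul_one,
    Complex.norm_real, Real.norm_of_nonneg (Real.sqrt_nonneg _)]

theorem norm_diracSol (a : ℂ) (α σ t s : ℝ) : ‖diracSol a α σ t s‖ = ‖a‖ / √t := by
  rw [diracSol, norm_mul, norm_freeDirac, mul_comm Complex.I, Complex.norm_exp_ofReal_mul_I,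
    mul_one]

theorem measurable_powerNL (α : ℝ) : Measurable (powerNL α) := by
  unfold powerNL; fun_prop

theorem measurable_diracSol (a : ℂ) (α σ : ℝ) :
    Measurable fun p : ℝ × ℝ => diracSol a α σ p.1 p.2 := by
  unfold diracSol freeDirac phase; fun_prop

/-- The difference `|u|^α u - |u_a|^α u_a` for `u = u_{a,σα}(t) + f`, as an element of `L²`. -/
noncomputable def nlDiff (a : ℂ) (α σ t : ℝ) (f : L2R) : L2R :=
  toL2 fun s => powerNL α (diracSol a α σ t s + f s) - powerNL α (diracSol a α σ t s)

/-- The Lipschitz constant of the nonlinearity at perturbations of size `n`. -/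
noncomputable def lipWeight (a : ℂ) (α t n : ℝ) : ℝ := 3 * (‖a‖ / √t + n) ^ α

/-- The subtraction matters: for a ≠ 0 the power |u_{a,σα}|^α u_{a,σα} has constant nonzero modulus
in s for t > 0 and is not square integrable, whereas the difference is at most a constant times |f|
when f is bounded. -/
theorem memLp_nlDiff {a : ℂ} {α σ t : ℝ} (hα₀ : 0 ≤ α) (hα₂ : α ≤ 2) {f : L2R}
    (hf : supNorm f ≠ ⊤) :
    MemLp (fun s => powerNL α (diracSol a α σ t s + f s) - powerNL α (diracSol a α σ t s)) 2
      volume := by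
  have hd : Measurable (diracSol a α σ t) := by unfold diracSol freeDirac; fun_prop
  refine (Lp.memLp f).of_le_mul (c := lipWeight a α t (supNorm f).toReal) ?_ ?_
  · have hfm : Measurable f := (Lp.stronglyMeasurable f).measurable
    exact (((measurable_powerNL α).comp (hd.add hfm)).sub
      ((measurable_powerNL α).comp hd)).aestronglyMeasurable
  · filter_upwards [ae_norm_le_supNorm hf] with s hs
    have h1 : ‖diracSol a α σ t s + f s‖ ≤ ‖a‖ / √t + (supNorm f).toReal := by
      refine (norm_add_le _ _).trans ?_
      rw [norm_diracSol]; gcongr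
    have h2 : ‖diracSol a α σ t s‖ ≤ ‖a‖ / √t + (supNorm f).toReal := by
      rw [norm_diracSol]; exact le_add_of_nonneg_right ENNReal.toReal_nonneg
    simpa [lipWeight] using norm_powerNL_sub_le hα₀ hα₂ h1 h2

theorem nlDiff_zero (a : ℂ) (α σ t : ℝ) : nlDiff a α σ t 0 = 0 := by
  have : nlDiff a α σ t 0 = toL2 ((0 : L2R) : ℝ → ℂ) := by
    refine toL2_congr ?_
    exact Eventually.of_forall fun s => by simp
  rw [this, toL2_coeFn]

theorem norm_nlDiff_sub_le {a : ℂ} {α σ t : ℝ} (hα₀ : 0 ≤ α) (hα₂ : α ≤ 2) {f g : L2R}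
    (hf : supNorm f ≠ ⊤) (hg : supNorm g ≠ ⊤) :
    ‖nlDiff a α σ t f - nlDiff a α σ t g‖ ≤
      lipWeight a α t (supNorm f + supNorm g).toReal * ‖f - g‖ := by
  rw [nlDiff, nlDiff, ← toL2_sub (memLp_nlDiff hα₀ hα₂ hf) (memLp_nlDiff hα₀ hα₂ hg)]
  refine norm_toL2_le (by unfold lipWeight; positivity) ?_
  rw [ENNReal.toReal_add hf hg]
  filter_upwards [ae_norm_le_supNorm hf, ae_norm_le_supNorm hg, Lp.coeFn_sub f g] with s h1 h2 h3
  have hb : ∀ {z : ℂ}, ‖z‖ ≤ (supNorm f).toReal + (supNorm g).toReal →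
      ‖diracSol a α σ t s + z‖ ≤ ‖a‖ / √t + ((supNorm f).toReal + (supNorm g).toReal) := by
    intro z hz
    refine (norm_add_le _ _).trans ?_
    rw [norm_diracSol]; gcongr
  have h := norm_powerNL_sub_le hα₀ hα₂
    (hb (h1.trans (le_add_of_nonneg_right ENNReal.toReal_nonneg)))
    (hb (h2.trans (le_add_of_nonneg_left ENNReal.toReal_nonneg)))
  rw [h3, Pi.sub_apply]
  rw [add_sub_add_left_eq_sub] at h
  rw [sub_sub_sub_cancel_right]
  exact h

/-- The nonlinearity acts pointwise in (t, s), while W consists of classes of functions of s; a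
jointly measurable representative bridges the two. -/
theorem measurable_nlDiff (a : ℂ) (α σ : ℝ) {W : ℝ → L2R} (hW : Measurable W) :
    Measurable fun t => nlDiff a α σ t (W t) := by
  obtain ⟨w, hw, hwW⟩ := exists_measurable_rep hW
  have : (fun t => nlDiff a α σ t (W t)) = fun t => toL2 fun s =>
      powerNL α (diracSol a α σ t s + w t s) - powerNL α (diracSol a α σ t s) := by
    ext1 t
    refine toL2_congr ?_
    filter_upwards [hwW t] with s hs
    rw [hs]
  rw [this]
  refine measurable_toL2 ?_
  have hd := measurable_diracSol a α σ
  exact ((measurable_powerNL α).comp (hd.add hw)).sub ((measurable_powerNL α).comp hd)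

theorem add_rpow_le {α x y : ℝ} (hα₀ : 0 ≤ α) (hα₂ : α ≤ 2) (hx : 0 ≤ x) (hy : 0 ≤ y) :
    (x + y) ^ α ≤ 4 * (x ^ α + y ^ α) := by
  have h2 : (2 : ℝ) ^ α ≤ 4 := by
    calc (2 : ℝ) ^ α ≤ 2 ^ (2 : ℝ) := Real.rpow_le_rpow_of_exponent_le (by norm_num) hα₂
      _ = 4 := by norm_num
  have key : ∀ {x y : ℝ}, 0 ≤ x → 0 ≤ y → y ≤ x → (x + y) ^ α ≤ 4 * (x ^ α + y ^ α) := by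
    intro x y hx hy h
    calc (x + y) ^ α ≤ (2 * x) ^ α := by gcongr; linarith
      _ = 2 ^ α * x ^ α := Real.mul_rpow (by norm_num) hx
      _ ≤ 4 * x ^ α := by gcongr
      _ ≤ 4 * (x ^ α + y ^ α) := by
          have : 0 ≤ y ^ α := by positivity
          linarith
  rcases le_total y x with h | h
  · exact key hx hy h
  · rw [add_comm, add_comm (x ^ α)]; exact key hy hx h

/-- From α ≤ 2 come n^α ≤ 1 + n² and, by completing a square, n² ≤ 1/δ + δ n⁴. The part depending on
the solution thus carries the free small factor δ, and the rest is explicit in t. -/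
theorem lipWeight_le {a : ℂ} {α t n δ : ℝ} (hα₀ : 0 ≤ α) (hα₂ : α ≤ 2) (ht : 0 < t) (hn : 0 ≤ n)
    (hδ : 0 < δ) : lipWeight a α t n ≤
      (12 * ‖a‖ ^ α * t ^ (-(α / 2)) + 12 * (1 + 1 / δ)) + 12 * δ * n ^ 4 := by
  have h1 : (‖a‖ / √t) ^ α = ‖a‖ ^ α * t ^ (-(α / 2)) := by
    rw [Real.div_rpow (norm_nonneg _) (Real.sqrt_nonneg _), Real.sqrt_eq_rpow, ← Real.rpow_mul ht.le,
      Real.rpow_neg ht.le, div_eq_mul_inv]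
    congr 3; ring
  have h2 : n ^ α ≤ 1 + 1 / δ + δ * n ^ 4 := by
    have h3 : n ^ α ≤ 1 + n ^ 2 := by
      rcases le_total n 1 with h | h
      · have : n ^ α ≤ 1 := Real.rpow_le_one hn h hα₀
        nlinarith [sq_nonneg n]
      · have : n ^ α ≤ n ^ (2 : ℝ) := Real.rpow_le_rpow_of_exponent_le h hα₂
        rw [Real.rpow_two] at this
        linarith
    have h4 : n ^ 2 ≤ 1 / δ + δ * n ^ 4 := by
      have : 0 ≤ δ * (n ^ 2 - 1 / δ) ^ 2 := by positivity
      have e : δ * (n ^ 2 - 1 / δ) ^ 2 = δ * n ^ 4 - 2 * n ^ 2 + 1 / δ := by field_simp; ring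
      nlinarith [sq_nonneg n]
    linarith
  calc lipWeight a α t n ≤ 3 * (4 * ((‖a‖ / √t) ^ α + n ^ α)) := by
        unfold lipWeight
        gcongr
        exact add_rpow_le hα₀ hα₂ (by positivity) hn
    _ ≤ 3 * (4 * (‖a‖ ^ α * t ^ (-(α / 2)) + (1 + 1 / δ + δ * n ^ 4))) := by
        rw [h1]; gcongr
    _ = _ := by ring

/-- The contribution to the time integral of `lipWeight` that does not depend on the solution. -/
noncomputable def weightBound (a : ℂ) (α δ T : ℝ) : ℝ :=
  12 * ‖a‖ ^ α * (T ^ (1 - α / 2) / (1 - α / 2)) + 12 * (1 + 1 / δ) * T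

theorem lintegral_lipWeight_le {a : ℂ} {α δ T : ℝ} (hα₀ : 0 ≤ α) (hα₂ : α < 2) (hδ : 0 < δ)
    (hT : 0 ≤ T) {n : ℝ → ℝ≥0∞} (hn : AEMeasurable n (volume.restrict (Ioc 0 T)))
    {M : ℝ≥0∞} (hM : ∫⁻ t in Ioc 0 T, n t ^ 4 ≤ M) :
    ∫⁻ t in Ioc 0 T, ENNReal.ofReal (lipWeight a α t (n t).toReal) ≤
      ENNReal.ofReal (weightBound a α δ T) + ENNReal.ofReal (12 * δ) * M := by
  have hint : IntervalIntegrable (fun t : ℝ => 12 * ‖a‖ ^ α * t ^ (-(α / 2)) + 12 * (1 + 1 / δ))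
      volume 0 T :=
    ((intervalIntegral.intervalIntegrable_rpow' (by linarith)).const_mul _).add
      intervalIntegrable_const
  have hval : ∫ t in (0 : ℝ)..T, (12 * ‖a‖ ^ α * t ^ (-(α / 2)) + 12 * (1 + 1 / δ)) =
      weightBound a α δ T := by
    rw [intervalIntegral.integral_add
      ((intervalIntegral.intervalIntegrable_rpow' (by linarith)).const_mul _)
      intervalIntegrable_const, intervalIntegral.integral_const_mul,
      integral_rpow (Or.inl (by linarith)), intervalIntegral.integral_const, weightBound,
      Real.zero_rpow (by linarith)]
    simp only [smul_eq_mul]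
    rw [show -(α / 2) + 1 = 1 - α / 2 by ring]; ring
  have hpt : ∀ t ∈ Ioc 0 T, ENNReal.ofReal (lipWeight a α t (n t).toReal) ≤
      ENNReal.ofReal (12 * ‖a‖ ^ α * t ^ (-(α / 2)) + 12 * (1 + 1 / δ)) +
        ENNReal.ofReal (12 * δ) * n t ^ 4 := by
    intro t ht
    refine (ENNReal.ofReal_le_ofReal
      (lipWeight_le hα₀ hα₂.le ht.1 ENNReal.toReal_nonneg hδ)).trans ?_
    refine ENNReal.ofReal_add_le.trans ?_
    gcongr
    rw [ENNReal.ofReal_mul (by positivity), ← ENNReal.toReal_pow]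
    gcongr
    exact ENNReal.ofReal_toReal_le
  calc ∫⁻ t in Ioc 0 T, ENNReal.ofReal (lipWeight a α t (n t).toReal)
      ≤ ∫⁻ t in Ioc 0 T, (ENNReal.ofReal (12 * ‖a‖ ^ α * t ^ (-(α / 2)) + 12 * (1 + 1 / δ)) +
        ENNReal.ofReal (12 * δ) * n t ^ 4) := setLIntegral_mono' measurableSet_Ioc hpt
    _ = (∫⁻ t in Ioc 0 T, ENNReal.ofReal (12 * ‖a‖ ^ α * t ^ (-(α / 2)) + 12 * (1 + 1 / δ))) +
        ENNReal.ofReal (12 * δ) * ∫⁻ t in Ioc 0 T, n t ^ 4 := by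
        rw [lintegral_add_right' _ ((hn.pow_const 4).const_mul _),
          lintegral_const_mul' _ _ ENNReal.ofReal_ne_top]
    _ ≤ ENNReal.ofReal (weightBound a α δ T) + ENNReal.ofReal (12 * δ) * M := by
        rw [← hval, intervalIntegral.integral_of_le hT, ofReal_integral_eq_lintegral_ofReal hint.1]
        · gcongr
        · filter_upwards [ae_restrict_mem measurableSet_Ioc] with t ht
          have := ht.1
          positivity

/-- A time and a parameter for which the nonlinearity is a contraction of constant `1/2`. -/
theorem exists_time (a : ℂ) {α : ℝ} (hα₂ : α < 2) (M : ℝ) (hM : 0 ≤ M) :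
    ∃ T δ : ℝ, 0 < T ∧ 0 < δ ∧
      ENNReal.ofReal (weightBound a α δ T) + ENNReal.ofReal (12 * δ) * ENNReal.ofReal M ≤ 1 / 2 := by
  -- This gives 12 δ M ≤ 1/4. With δ fixed, `weightBound` tends to 0 with T because 1 - α/2 > 0, so
  -- some T makes it less than 1/4.
  set δ : ℝ := 1 / (48 * (M + 1)) with hδ
  have hδ0 : 0 < δ := by positivity
  have hc : Tendsto (weightBound a α δ) (𝓝[>] 0) (𝓝 0) := by
    have h1 : ContinuousAt (weightBound a α δ) 0 := by
      unfold weightBound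
      have : ContinuousAt (fun T : ℝ => T ^ (1 - α / 2)) 0 :=
        Real.continuousAt_rpow_const _ _ (Or.inr (by linarith))
      fun_prop
    have h2 : weightBound a α δ 0 = 0 := by
      simp [weightBound, Real.zero_rpow (show (1 - α / 2) ≠ 0 by linarith)]
    have h3 := h1.tendsto
    rw [h2] at h3
    exact h3.mono_left nhdsWithin_le_nhds
  obtain ⟨T, hT, hT0⟩ := ((hc.eventually (gt_mem_nhds (show (0 : ℝ) < 1 / 4 by norm_num))).and
    self_mem_nhdsWithin).exists
  refine ⟨T, δ, hT0, hδ0, ?_⟩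
  have h1 : 12 * δ * M ≤ 1 / 4 := by
    rw [hδ]
    have : 12 * (1 / (48 * (M + 1))) * M = (1 / 4) * (M / (M + 1)) := by field_simp; ring
    rw [this]
    have : M / (M + 1) ≤ 1 := (div_le_one (by positivity)).2 (by linarith)
    linarith
  rw [← ENNReal.ofReal_mul (by positivity)]
  calc ENNReal.ofReal (weightBound a α δ T) + ENNReal.ofReal (12 * δ * M)
      ≤ ENNReal.ofReal (1 / 4) + ENNReal.ofReal (1 / 4) := by
        gcongr
    _ = ENNReal.ofReal (1 / 2) := by
        rw [← ENNReal.ofReal_add (by norm_num) (by norm_num)]; norm_num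
    _ = 1 / 2 := by
        rw [ENNReal.ofReal_div_of_pos (by norm_num)]; simp

end Nonlinearity

/-! ### The Duhamel equation and its solution by contraction -/

section MildSolutions

open scoped ENNReal BoundedContinuousFunction

/-- The Duhamel integrand of the perturbation, in the interaction picture, on `(0,T]`. -/
noncomputable def source (a : ℂ) (α σ T : ℝ) (W : ℝ → L2R) : ℝ → L2R :=
  (Ioc 0 T).indicator fun r => (Complex.I * σ) • freeProp (-r) (nlDiff a α σ r (W r))

/-- `W` solves the Duhamel equation for the perturbation of `u_{a,σα}` with data `u₀`. -/
structure IsMild (a : ℂ) (α σ T : ℝ) (u₀ : L2R) (W : ℝ → L2R) : Prop where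
  cont : Continuous W
  supNorm_lt : ∫⁻ t, supNorm (W t) ^ 4 < ⊤
  integrable : Integrable (source a α σ T W) volume
  eq : ∀ t, W t = freeProp t (u₀ + ∫ r in Iic t, source a α σ T W r)

theorem measurable_source (a : ℂ) (α σ T : ℝ) {W : ℝ → L2R} (hW : Measurable W) :
    Measurable (source a α σ T W) := by
  refine Measurable.indicator ?_ measurableSet_Ioc
  have h1 : Measurable fun r => freeProp (-r) (nlDiff a α σ r (W r)) :=
    Measurable.comp (g := fun p : ℝ × L2R => freeProp p.1 p.2)
      (f := fun r => (-r, nlDiff a α σ r (W r))) continuous_freeProp.measurable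
      (measurable_neg.prodMk (measurable_nlDiff a α σ hW))
  exact (continuous_const_smul (Complex.I * (σ : ℂ))).measurable.comp h1

theorem ae_supNorm_ne_top {μ : Measure ℝ} {W : ℝ → L2R} (hW : AEMeasurable W μ)
    (h : ∫⁻ t, supNorm (W t) ^ 4 ∂μ ≠ ⊤) : ∀ᵐ t ∂μ, supNorm (W t) ≠ ⊤ := by
  filter_upwards [ae_lt_top' ((measurable_supNorm.comp_aemeasurable hW).pow_const 4) h] with t ht
  exact fun h' => by simp [h'] at ht

theorem enorm_sign {σ : ℝ} (hσ : σ = 1 ∨ σ = -1) : ‖Complex.I * (σ : ℂ)‖ₑ = 1 := by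
  rcases hσ with rfl | rfl <;> simp [← ofReal_norm]

/-- The difference of two sources in `L¹_t L²_x`. -/
theorem lintegral_source_sub_le {a : ℂ} {α σ T δ : ℝ} (hα₀ : 0 ≤ α) (hα₂ : α < 2)
    (hσ : σ = 1 ∨ σ = -1) (hT : 0 ≤ T) (hδ : 0 < δ) {V W : ℝ → L2R} (hV : Measurable V)
    (hW : Measurable W) {M : ℝ≥0∞} (hM : M ≠ ⊤) (hVM : ∫⁻ t, supNorm (V t) ^ 4 ≤ M ^ 4)
    (hWM : ∫⁻ t, supNorm (W t) ^ 4 ≤ M ^ 4) {D : ℝ≥0∞} (hD : ∀ t, ‖V t - W t‖ₑ ≤ D) :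
    ∫⁻ r, ‖source a α σ T V r - source a α σ T W r‖ₑ ≤
      (ENNReal.ofReal (weightBound a α δ T) + ENNReal.ofReal (12 * δ) * (M + M) ^ 4) * D := by
  have hn : Measurable fun t => supNorm (V t) + supNorm (W t) :=
    (measurable_supNorm.comp hV).add (measurable_supNorm.comp hW)
  have hnM : ∫⁻ t in Ioc 0 T, (supNorm (V t) + supNorm (W t)) ^ 4 ≤ (M + M) ^ 4 := by
    refine (setLIntegral_le_lintegral _ _).trans ?_
    have hroot : ∀ {z w : ℝ≥0∞}, z ≤ w ^ 4 → z ^ (1 / 4 : ℝ) ≤ w := fun {z w} h => by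
      calc z ^ (1 / 4 : ℝ) ≤ (w ^ 4) ^ (1 / 4 : ℝ) := by gcongr
        _ = w := by rw [← ENNReal.rpow_natCast, ← ENNReal.rpow_mul]; norm_num
    have hL := ENNReal.lintegral_Lp_add_le (μ := volume) (p := 4)
      (measurable_supNorm.comp hV).aemeasurable (measurable_supNorm.comp hW).aemeasurable
      (by norm_num)
    simp only [Pi.add_apply, Function.comp_apply, ENNReal.rpow_ofNat] at hL
    have h1 := hL.trans (add_le_add (hroot hVM) (hroot hWM))
    calc ∫⁻ t, (supNorm (V t) + supNorm (W t)) ^ 4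
        = ((∫⁻ t, (supNorm (V t) + supNorm (W t)) ^ 4) ^ (1 / 4 : ℝ)) ^ 4 := by
          rw [← ENNReal.rpow_natCast, ← ENNReal.rpow_mul]; norm_num
      _ ≤ (M + M) ^ 4 := by gcongr
  have hVf := ae_supNorm_ne_top hV.aemeasurable (hVM.trans_lt (ENNReal.pow_lt_top hM.lt_top)).ne
  have hWf := ae_supNorm_ne_top hW.aemeasurable (hWM.trans_lt (ENNReal.pow_lt_top hM.lt_top)).ne
  have hpt : ∀ᵐ r, ‖source a α σ T V r - source a α σ T W r‖ₑ ≤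
      (Ioc 0 T).indicator (fun r => ENNReal.ofReal
        (lipWeight a α r (supNorm (V r) + supNorm (W r)).toReal) * D) r := by
    filter_upwards [hVf, hWf] with r h1 h2
    by_cases hr : r ∈ Ioc 0 T
    · rw [source, source, indicator_of_mem hr, indicator_of_mem hr, indicator_of_mem hr,
        ← smul_sub, ← map_sub, enorm_smul, enorm_sign hσ, one_mul, ← ofReal_norm,
        LinearIsometry.norm_map]
      refine (ENNReal.ofReal_le_ofReal (norm_nlDiff_sub_le hα₀ hα₂.le h1 h2)).trans ?_
      rw [ENNReal.ofReal_mul (by unfold lipWeight; positivity), ofReal_norm]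
      gcongr
      exact hD r
    · rw [source, source, indicator_of_notMem hr, indicator_of_notMem hr, indicator_of_notMem hr]
      simp
  calc ∫⁻ r, ‖source a α σ T V r - source a α σ T W r‖ₑ
      ≤ ∫⁻ r, (Ioc 0 T).indicator (fun r => ENNReal.ofReal
        (lipWeight a α r (supNorm (V r) + supNorm (W r)).toReal) * D) r := lintegral_mono_ae hpt
    _ = (∫⁻ r in Ioc 0 T, ENNReal.ofReal
        (lipWeight a α r (supNorm (V r) + supNorm (W r)).toReal)) * D := by
        rw [lintegral_indicator measurableSet_Ioc, lintegral_mul_const]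
        have := hn.ennreal_toReal
        unfold lipWeight
        fun_prop
    _ ≤ _ := by
        gcongr
        exact lintegral_lipWeight_le hα₀ hα₂ hδ hT hn.aemeasurable hnM

theorem source_zero (a : ℂ) (α σ T : ℝ) : source a α σ T (fun _ => 0) = fun _ => 0 := by
  ext1 r
  unfold source
  by_cases hr : r ∈ Ioc 0 T
  · rw [indicator_of_mem hr, nlDiff_zero, map_zero, smul_zero]
  · rw [indicator_of_notMem hr]

theorem continuous_duhamel {K : ℝ → L2R} (hK : Integrable K volume) (f : L2R) :
    Continuous fun t => freeProp t (f + ∫ r in Iic t, K r) :=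
  Continuous.comp (g := fun p : ℝ × L2R => freeProp p.1 p.2)
    (f := fun t => (t, f + ∫ r in Iic t, K r)) continuous_freeProp
    (continuous_id.prodMk (continuous_const.add (continuous_setIntegral_Iic hK)))

/-- Existence of solutions to the Duhamel equation, by contraction. -/
theorem exists_isMild {a : ℂ} {α σ T δ R : ℝ} (hα₀ : 0 ≤ α) (hα₂ : α < 2)
    (hσ : σ = 1 ∨ σ = -1) (hT : 0 ≤ T) (hδ : 0 < δ) (u₀ : L2R) (hR : 2 * ‖u₀‖ ≤ R)
    (hsmall : ENNReal.ofReal (weightBound a α δ T) +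
      ENNReal.ofReal (12 * δ) * ENNReal.ofReal ((8 * R) ^ 4) ≤ 1 / 2) :
    ∃ W, IsMild a α σ T u₀ W := by
  have hR0 : 0 ≤ R := le_trans (by positivity) hR
  -- The Strichartz constant times the radius R. The Lipschitz weight contains the sup norms of two
  -- curves, whence (M + M)⁴ = (8R)⁴ in the smallness hypothesis.
  let M : ℝ≥0∞ := 4 * ENNReal.ofReal R
  have hM : M ≠ ⊤ := ENNReal.mul_ne_top (by simp) ENNReal.ofReal_ne_top
  have hMM : (M + M) ^ 4 = ENNReal.ofReal ((8 * R) ^ 4) := by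
    rw [ENNReal.ofReal_pow (by positivity), ENNReal.ofReal_mul (by norm_num), ← two_mul,
      ← mul_assoc]
    norm_num
  rw [← hMM] at hsmall
  -- Both norms are bounded on S, but distances are measured only uniformly in L². That suffices for
  -- the contraction, since the L⁴_t L^∞_x norms enter only through the weight, and S is closed for
  -- this weaker distance by Fatou.
  let S : Set (ℝ →ᵇ L2R) := {W | ‖W‖ ≤ R ∧ ∫⁻ t, supNorm (W t) ^ 4 ≤ M ^ 4}
  have hsub : ∀ {V W : ℝ →ᵇ L2R}, V ∈ S → W ∈ S →
      ∫⁻ r, ‖source a α σ T V r - source a α σ T W r‖ₑ ≤ 1 / 2 * ‖V - W‖ₑ := by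
    intro V W hV hW
    refine (lintegral_source_sub_le hα₀ hα₂ hσ hT hδ V.continuous.measurable
      W.continuous.measurable hM hV.2 hW.2 (D := ‖V - W‖ₑ) fun t => ?_).trans (by gcongr)
    rw [enorm_le_iff_norm_le]
    exact (V - W).norm_coe_le_norm t
  have h0S : (0 : ℝ →ᵇ L2R) ∈ S := by
    refine ⟨by simpa using hR0, by simp⟩
  have hsrc : ∀ {W : ℝ →ᵇ L2R}, W ∈ S →
      ∫⁻ r, ‖source a α σ T W r‖ₑ ≤ 1 / 2 * ‖W‖ₑ := by
    intro W hW
    have h := hsub hW h0S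
    have h0 : ∀ r, source a α σ T (0 : ℝ →ᵇ L2R) r = 0 := congrFun (source_zero a α σ T)
    simpa only [h0, sub_zero] using h
  have hint : ∀ {W : ℝ →ᵇ L2R}, W ∈ S → Integrable (source a α σ T W) volume := fun {W} hW =>
    ⟨(measurable_source a α σ T W.continuous.measurable).aestronglyMeasurable,
      (hsrc hW).trans_lt (ENNReal.mul_lt_top (by simp) enorm_lt_top)⟩
  have hnorm : ∀ (W : ℝ →ᵇ L2R) (t : ℝ), ‖∫ r in Iic t, source a α σ T W r‖ₑ ≤
      ∫⁻ r, ‖source a α σ T W r‖ₑ := fun W t =>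
    (enorm_integral_le_lintegral_enorm _).trans (setLIntegral_le_lintegral _ _)
  -- The data take up at most half of the radius; the contraction factor 1/2 leaves the other half
  -- to the Duhamel term.
  have hR' : ‖u₀‖ₑ + 1 / 2 * ENNReal.ofReal R ≤ ENNReal.ofReal R := by
    have h12 : (1 / 2 : ℝ≥0∞) = ENNReal.ofReal (1 / 2) := by
      rw [ENNReal.ofReal_div_of_pos (by norm_num)]; simp
    rw [h12, ← ofReal_norm, ← ENNReal.ofReal_mul (by norm_num),
      ← ENNReal.ofReal_add (norm_nonneg _) (by positivity)]
    exact ENNReal.ofReal_le_ofReal (by linarith)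
  have hWR : ∀ {W : ℝ →ᵇ L2R}, W ∈ S → ‖W‖ₑ ≤ ENNReal.ofReal R := fun {W} hW => by
    rw [← ofReal_norm]; exact ENNReal.ofReal_le_ofReal hW.1
  have hbd : ∀ {W : ℝ →ᵇ L2R}, W ∈ S → ∀ t,
      ‖freeProp t (u₀ + ∫ r in Iic t, source a α σ T W r)‖ ≤ R := by
    intro W hW t
    have h1 : ‖u₀ + ∫ r in Iic t, source a α σ T W r‖ₑ ≤ ENNReal.ofReal R := by
      refine (enorm_add_le _ _).trans (le_trans ?_ hR')
      gcongr
      exact (hnorm W t).trans ((hsrc hW).trans (mul_le_mul_right (hWR hW) _))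
    rw [LinearIsometry.norm_map]
    rw [← ofReal_norm] at h1
    exact (ENNReal.ofReal_le_ofReal_iff hR0).1 h1
  have hcont : ∀ {W : ℝ →ᵇ L2R}, W ∈ S →
      Continuous fun t => freeProp t (u₀ + ∫ r in Iic t, source a α σ T W r) := fun {W} hW =>
    continuous_duhamel (hint hW) u₀
  obtain ⟨Φ, hΦ'⟩ : ∃ Φ : (ℝ →ᵇ L2R) → (ℝ →ᵇ L2R), ∀ W ∈ S, ∀ t,
      Φ W t = freeProp t (u₀ + ∫ r in Iic t, source a α σ T W r) := by
    classical
    -- Integrability of the source is known only on S; elsewhere the map has the default value 0.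
    refine ⟨fun W => if hW : W ∈ S then BoundedContinuousFunction.ofNormedAddCommGroup
      (fun t => freeProp t (u₀ + ∫ r in Iic t, source a α σ T W r)) (hcont hW) R (hbd hW) else 0,
      fun W hW t => ?_⟩
    beta_reduce
    rw [dif_pos hW]; rfl
  have hΦ : ∀ {W : ℝ →ᵇ L2R}, W ∈ S → ∀ t,
      Φ W t = freeProp t (u₀ + ∫ r in Iic t, source a α σ T W r) := fun {W} hW => hΦ' W hW
  have hmaps : MapsTo Φ S S := by
    intro W hW
    refine ⟨(BoundedContinuousFunction.norm_le hR0).2 fun t => by rw [hΦ hW]; exact hbd hW t, ?_⟩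
    simp only [hΦ hW, map_add]
    have h1 := strichartz u₀
    have h2 := strichartz_primitive (hint hW)
    refine (lintegral_supNorm_add_le (continuous_freeProp_left u₀).measurable.aemeasurable
      (by simpa using (continuous_duhamel (hint hW) 0).measurable.aemeasurable) h1 h2).trans ?_
    refine pow_le_pow_left' ?_ 4
    rw [← mul_add]
    refine mul_le_mul_right (le_trans ?_ hR') 4
    gcongr
    exact (hsrc hW).trans (mul_le_mul_right (hWR hW) _)
  have hclosed : IsClosed S := by
    have h1 : IsClosed {W : ℝ →ᵇ L2R | ‖W‖ ≤ R} := isClosed_le continuous_norm continuous_const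
    refine IsSeqClosed.isClosed fun F W hF hlim => ⟨?_, ?_⟩
    · exact h1.mem_of_tendsto hlim (Eventually.of_forall fun n => (hF n).1)
    · refine lintegral_supNorm_le_of_tendsto (F := fun n t => F n t) (B := fun _ => M ^ 4)
        (fun n => (F n).continuous.measurable.aemeasurable) (Eventually.of_forall fun t => ?_)
        (fun n => (hF n).2) tendsto_const_nhds
      exact (((continuous_apply t).comp BoundedContinuousFunction.continuous_coe).tendsto W).comp hlim
  have hlip : ContractingWith (1 / 2) (hmaps.restrict Φ S S) := by
    refine ⟨by rw [← NNReal.coe_lt_coe]; norm_num, fun ⟨V, hV⟩ ⟨W, hW⟩ => ?_⟩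
    change edist (Φ V) (Φ W) ≤ _ * edist V W
    have hb : (0 : ℝ) ≤ 1 / 2 * ‖V - W‖ := by positivity
    have h12 : (1 / 2 : ℝ≥0∞) * ‖V - W‖ₑ = ENNReal.ofReal (1 / 2 * ‖V - W‖) := by
      rw [ENNReal.ofReal_mul (by norm_num), ofReal_norm, ENNReal.ofReal_div_of_pos (by norm_num)]
      simp
    have h1 : dist (Φ V) (Φ W) ≤ 1 / 2 * ‖V - W‖ := by
      refine (BoundedContinuousFunction.dist_le hb).2 fun t => ?_
      have h2 : ‖∫ r in Iic t, (source a α σ T V r - source a α σ T W r)‖ₑ ≤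
          ENNReal.ofReal (1 / 2 * ‖V - W‖) := by
        rw [← h12]
        exact ((enorm_integral_le_lintegral_enorm _).trans
          (setLIntegral_le_lintegral _ _)).trans (hsub hV hW)
      rw [← ofReal_norm] at h2
      have h3 := (ENNReal.ofReal_le_ofReal_iff hb).1 h2
      rwa [hΦ hV, hΦ hW, LinearIsometry.dist_map, dist_add_left, dist_eq_norm,
        ← integral_sub (hint hV).integrableOn (hint hW).integrableOn]
    rw [edist_dist, edist_dist]
    refine (ENNReal.ofReal_le_ofReal h1).trans (le_of_eq ?_)
    rw [ENNReal.ofReal_mul (by norm_num), dist_eq_norm,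
              ENNReal.ofReal_div_of_pos (by norm_num)]
    simp
  obtain ⟨W, hWS, hfix, -⟩ := hlip.exists_fixedPoint' hclosed.isComplete hmaps h0S (edist_ne_top _ _)
  refine ⟨W, W.continuous, hWS.2.trans_lt (ENNReal.pow_lt_top hM.lt_top), hint hWS, fun t => ?_⟩
  rw [← hΦ hWS, hfix]

end MildSolutions

/-! ### Test functions on the strip and integration by parts -/

section TestFunctions

open scoped ENNReal ComplexConjugate

/-- Smooth functions with compact support in `(0,T) × ℝ`. -/
structure IsTest (T : ℝ) (φ : ℝ × ℝ → ℂ) : Prop where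
  smooth : ContDiff ℝ ∞ φ
  compact : HasCompactSupport φ
  support : tsupport φ ⊆ Ioo 0 T ×ˢ univ

/-- The partial derivative `φ_t`. -/
noncomputable def timeDeriv (φ : ℝ × ℝ → ℂ) (p : ℝ × ℝ) : ℂ := fderiv ℝ φ p (1, 0)

/-- The partial derivative `φ_s`. -/
noncomputable def spaceDeriv (φ : ℝ × ℝ → ℂ) (p : ℝ × ℝ) : ℂ := fderiv ℝ φ p (0, 1)

variable {T : ℝ} {φ θ : ℝ × ℝ → ℂ}

theorem IsTest.of_tsupport_subset (hφ : IsTest T φ) (h : ContDiff ℝ ∞ θ)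
    (hs : tsupport θ ⊆ tsupport φ) : IsTest T θ :=
  ⟨h, hφ.compact.of_isClosed_subset (isClosed_tsupport _) hs, hs.trans hφ.support⟩

theorem IsTest.timeDeriv (hφ : IsTest T φ) : IsTest T (timeDeriv φ) :=
  hφ.of_tsupport_subset ((hφ.smooth.fderiv_right (m := ∞) le_rfl).clm_apply contDiff_const)
    (closure_minimal (fun p hp =>
      tsupport_fderiv_subset ℝ (subset_tsupport _ (fun h => hp (by
        simp only [DiracNLS.timeDeriv, h]; rfl)))) (isClosed_tsupport _))

theorem IsTest.spaceDeriv (hφ : IsTest T φ) : IsTest T (spaceDeriv φ) :=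
  hφ.of_tsupport_subset ((hφ.smooth.fderiv_right (m := ∞) le_rfl).clm_apply contDiff_const)
    (closure_minimal (fun p hp =>
      tsupport_fderiv_subset ℝ (subset_tsupport _ (fun h => hp (by
        simp only [DiracNLS.spaceDeriv, h]; rfl)))) (isClosed_tsupport _))

theorem IsTest.conj (hφ : IsTest T φ) : IsTest T (fun p => conj (φ p)) :=
  hφ.of_tsupport_subset (Complex.conjCLE.contDiff.comp hφ.smooth)
    (closure_mono fun p hp h => hp (by simp [h]))

theorem IsTest.const_mul (hφ : IsTest T φ) (c : ℂ) : IsTest T (fun p => c * φ p) :=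
  hφ.of_tsupport_subset (contDiff_const.mul hφ.smooth)
    (closure_mono fun p hp h => hp (by simp [h]))

theorem IsTest.add (hφ : IsTest T φ) (hθ : IsTest T θ) : IsTest T (fun p => φ p + θ p) :=
  ⟨hφ.smooth.add hθ.smooth, hφ.compact.add hθ.compact,
    (tsupport_add φ θ).trans (union_subset hφ.support hθ.support)⟩

theorem IsTest.hasDerivAt_time (hφ : IsTest T φ) (t s : ℝ) :
    HasDerivAt (fun t => φ (t, s)) (DiracNLS.timeDeriv φ (t, s)) t :=
  ((hφ.smooth.differentiable (by simp)) (t, s)).hasFDerivAt.comp_hasDerivAt t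
    (f := fun t => (t, s)) ((hasDerivAt_id t).prodMk (hasDerivAt_const t s))

theorem IsTest.hasDerivAt_space (hφ : IsTest T φ) (t s : ℝ) :
    HasDerivAt (fun s => φ (t, s)) (DiracNLS.spaceDeriv φ (t, s)) s :=
  ((hφ.smooth.differentiable (by simp)) (t, s)).hasFDerivAt.comp_hasDerivAt s
    (f := fun s => (t, s)) ((hasDerivAt_const s t).prodMk (hasDerivAt_id s))

theorem IsTest.deriv_time (hφ : IsTest T φ) (p : ℝ × ℝ) :
    deriv (fun t => φ (t, p.2)) p.1 = DiracNLS.timeDeriv φ p :=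
  (hφ.hasDerivAt_time p.1 p.2).deriv

theorem IsTest.iteratedDeriv_space (hφ : IsTest T φ) (p : ℝ × ℝ) :
    iteratedDeriv 2 (fun s => φ (p.1, s)) p.2 = DiracNLS.spaceDeriv (DiracNLS.spaceDeriv φ) p := by
  rw [iteratedDeriv_succ, iteratedDeriv_one, funext fun s => (hφ.hasDerivAt_space p.1 s).deriv]
  exact (hφ.spaceDeriv.hasDerivAt_space p.1 p.2).deriv

theorem IsTest.eq_zero (hφ : IsTest T φ) {t : ℝ} (ht : t ∉ Ioo 0 T) (s : ℝ) : φ (t, s) = 0 := by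
  by_contra h
  exact ht (hφ.support (subset_tsupport _ h)).1

theorem IsTest.eventually_eq_zero (hφ : IsTest T φ) {t : ℝ} (ht : t ∉ Ioo 0 T) (s : ℝ) :
    (fun t => φ (t, s)) =ᶠ[𝓝 t] 0 := by
  have h : (t, s) ∉ tsupport φ := fun h => ht (hφ.support h).1
  have h1 : Tendsto (fun t => (t, s)) (𝓝 t) (𝓝 (t, s)) :=
    Continuous.tendsto (f := fun t => (t, s)) (by fun_prop) t
  exact h1.eventually (notMem_tsupport_iff_eventuallyEq.1 h)

/-- The factor g may be singular at t = 0, as the explicit solution is. The support of φ is a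
compact subset of the open strip, so the product is continuous on the whole plane. -/
theorem IsTest.continuous_mul (hφ : IsTest T φ) {g : ℝ × ℝ → ℂ}
    (hg : ContinuousOn g (Ioo 0 T ×ˢ univ)) : Continuous fun p => g p * φ p :=
  (hg.mul hφ.smooth.continuous.continuousOn).continuous_of_tsupport_subset
    (isOpen_Ioo.prod isOpen_univ) (tsupport_mul_subset_right.trans hφ.support)

theorem IsTest.compact_mul (hφ : IsTest T φ) (g : ℝ × ℝ → ℂ) :
    HasCompactSupport fun p => g p * φ p := hφ.compact.mul_left

theorem IsTest.integrable_mul (hφ : IsTest T φ) {g : ℝ × ℝ → ℂ}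
    (hg : ContinuousOn g (Ioo 0 T ×ˢ univ)) : Integrable fun p => g p * φ p :=
  (hφ.continuous_mul hg).integrable_of_hasCompactSupport (hφ.compact_mul g)

theorem hasCompactSupport_time {f : ℝ × ℝ → ℂ} (hf : HasCompactSupport f) (s : ℝ) :
    HasCompactSupport fun t => f (t, s) :=
  hf.comp_isClosedEmbedding (g := fun t : ℝ => (t, s))
    (Topology.IsClosedEmbedding.of_continuous_injective_isClosedMap (by fun_prop)
      (fun _ _ h => (Prod.mk.inj h).1) (isClosedMap_prodMk_right s))

theorem hasCompactSupport_space {f : ℝ × ℝ → ℂ} (hf : HasCompactSupport f) (t : ℝ) :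
    HasCompactSupport fun s => f (t, s) :=
  hf.comp_isClosedEmbedding (g := fun s : ℝ => (t, s))
    (Topology.IsClosedEmbedding.of_continuous_injective_isClosedMap (by fun_prop)
      (fun _ _ h => (Prod.mk.inj h).2) (isClosedMap_prodMk_left t))

/-- Integration by parts in time. -/
theorem IsTest.integral_time (hφ : IsTest T φ) {g g' : ℝ × ℝ → ℂ}
    (hg : ContinuousOn g (Ioo 0 T ×ˢ univ)) (hg' : ContinuousOn g' (Ioo 0 T ×ˢ univ))
    (h : ∀ t ∈ Ioo 0 T, ∀ s, HasDerivAt (fun t => g (t, s)) (g' (t, s)) t) :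
    ∫ p : ℝ × ℝ, g p * DiracNLS.timeDeriv φ p = - ∫ p : ℝ × ℝ, g' p * φ p := by
  have hi := hφ.timeDeriv.integrable_mul hg
  have hi' := hφ.integrable_mul hg'
  rw [eq_neg_iff_add_eq_zero, ← integral_add hi hi', Measure.volume_eq_prod,
    integral_prod_symm (fun p => g p * DiracNLS.timeDeriv φ p + g' p * φ p) (hi.add hi')]
  have key : ∀ s, ∫ t, (g (t, s) * DiracNLS.timeDeriv φ (t, s) + g' (t, s) * φ (t, s)) = 0 := by
    intro s
    refine integral_eq_zero_of_hasDerivAt_of_integrable (f := fun t => g (t, s) * φ (t, s))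
      (fun t => ?_) ?_ ?_
    · by_cases ht : t ∈ Ioo 0 T
      · exact ((h t ht s).mul (hφ.hasDerivAt_time t s)).congr_deriv (add_comm _ _)
      -- Outside (0, T) nothing is known about g, but φ vanishes near each such time, so the product
      -- is locally zero.
      · rw [hφ.timeDeriv.eq_zero ht, hφ.eq_zero ht, mul_zero, mul_zero, add_zero]
        refine (hasDerivAt_const t (0 : ℂ)).congr_of_eventuallyEq ?_
        filter_upwards [hφ.eventually_eq_zero ht s] with r hr
        rw [show φ (r, s) = 0 from hr, mul_zero]
    · refine Continuous.integrable_of_hasCompactSupport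
        (f := fun t => g (t, s) * DiracNLS.timeDeriv φ (t, s) + g' (t, s) * φ (t, s)) ?_
        (hasCompactSupport_time (f := fun p => g p * DiracNLS.timeDeriv φ p + g' p * φ p)
          ((hφ.timeDeriv.compact_mul g).add (hφ.compact_mul g')) s)
      exact ((hφ.timeDeriv.continuous_mul hg).add (hφ.continuous_mul hg')).comp
        (by fun_prop : Continuous fun t : ℝ => (t, s))
    · exact Continuous.integrable_of_hasCompactSupport
        ((hφ.continuous_mul hg).comp (by fun_prop : Continuous fun t : ℝ => (t, s)))
        (hasCompactSupport_time (hφ.compact_mul g) s)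
  simp only [key, integral_zero]

/-- Integration by parts in space. -/
theorem IsTest.integral_space (hφ : IsTest T φ) {g g' : ℝ × ℝ → ℂ}
    (hg : ContinuousOn g (Ioo 0 T ×ˢ univ)) (hg' : ContinuousOn g' (Ioo 0 T ×ˢ univ))
    (h : ∀ t ∈ Ioo 0 T, ∀ s, HasDerivAt (fun s => g (t, s)) (g' (t, s)) s) :
    ∫ p : ℝ × ℝ, g p * DiracNLS.spaceDeriv φ p = - ∫ p : ℝ × ℝ, g' p * φ p := by
  have hi := hφ.spaceDeriv.integrable_mul hg
  have hi' := hφ.integrable_mul hg'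
  rw [eq_neg_iff_add_eq_zero, ← integral_add hi hi', Measure.volume_eq_prod,
    integral_prod (fun p => g p * DiracNLS.spaceDeriv φ p + g' p * φ p) (hi.add hi')]
  have key : ∀ t, ∫ s, (g (t, s) * DiracNLS.spaceDeriv φ (t, s) + g' (t, s) * φ (t, s)) = 0 := by
    intro t
    by_cases ht : t ∈ Ioo 0 T
    swap
    · simp only [hφ.spaceDeriv.eq_zero ht, hφ.eq_zero ht, mul_zero, add_zero, integral_zero]
    refine integral_eq_zero_of_hasDerivAt_of_integrable (f := fun s => g (t, s) * φ (t, s))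
      (fun s => ?_) ?_ ?_
    · exact ((h t ht s).mul (hφ.hasDerivAt_space t s)).congr_deriv (add_comm _ _)
    · refine Continuous.integrable_of_hasCompactSupport
        (f := fun s => g (t, s) * DiracNLS.spaceDeriv φ (t, s) + g' (t, s) * φ (t, s)) ?_
        (hasCompactSupport_space (f := fun p => g p * DiracNLS.spaceDeriv φ p + g' p * φ p)
          ((hφ.spaceDeriv.compact_mul g).add (hφ.compact_mul g')) t)
      exact ((hφ.spaceDeriv.continuous_mul hg).add (hφ.continuous_mul hg')).comp
        (by fun_prop : Continuous fun s : ℝ => (t, s))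
    · exact Continuous.integrable_of_hasCompactSupport
        ((hφ.continuous_mul hg).comp (by fun_prop : Continuous fun s : ℝ => (t, s)))
        (hasCompactSupport_space (hφ.compact_mul g) t)
  simp only [key, integral_zero]

end TestFunctions

/-! ### The explicit solution satisfies the equation -/

section ExplicitSolution

variable {a : ℂ} {α σ T : ℝ}

theorem hasDerivAt_diracSol_space {t : ℝ} (ht : 0 < t) (s : ℝ) :
    HasDerivAt (fun s => diracSol a α σ t s)
      (Complex.I * s / (2 * t) * diracSol a α σ t s) s := by
  have h1 : HasDerivAt (fun s : ℝ => Complex.I * ((s ^ 2 / (4 * t) : ℝ) : ℂ))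
      (Complex.I * ((2 * s / (4 * t) : ℝ) : ℂ)) s := by
    have := ((hasDerivAt_pow 2 s).div_const (4 * t)).ofReal_comp.const_mul Complex.I
    simpa using this
  refine (((h1.cexp.const_mul a).div_const ((√t : ℝ) : ℂ)).mul_const
    (Complex.exp (Complex.I * ((σ * phase a α t : ℝ) : ℂ)))).congr_deriv ?_
  have : (t : ℂ) ≠ 0 := by exact_mod_cast ht.ne'
  have : ((√t : ℝ) : ℂ) ≠ 0 := by exact_mod_cast (Real.sqrt_pos.2 ht).ne'
  simp only [diracSol, freeDirac]
  push_cast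
  field_simp
  ring

/-- The phase is defined so that its derivative is |u_{a,σα}|^α = (|a|/√t)^α; the nonlinearity then
acts on the free solution as a rotation depending only on time. -/
theorem hasDerivAt_phase (hα₂ : α < 2) {t : ℝ} (ht : 0 < t) :
    HasDerivAt (phase a α) ((‖a‖ / √t) ^ α) t := by
  have h := ((Real.hasDerivAt_rpow_const (p := 1 - α / 2) (Or.inl ht.ne')).const_mul
    (‖a‖ ^ α / (1 - α / 2)))
  refine h.congr_deriv ?_
  have h2 : 1 - α / 2 ≠ 0 := by linarith
  rw [Real.div_rpow (norm_nonneg _) (Real.sqrt_nonneg _), Real.sqrt_eq_rpow, ← Real.rpow_mul ht.le,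
    show 1 - α / 2 - 1 = -(1 / 2 * α) by ring, Real.rpow_neg ht.le]
  field_simp
  rw [mul_div_assoc, div_self (by linarith), mul_one]

theorem hasDerivAt_diracSol_time (hα₂ : α < 2) {t : ℝ} (ht : 0 < t) (s : ℝ) :
    HasDerivAt (fun t => diracSol a α σ t s)
      ((-Complex.I * s ^ 2 / (4 * t ^ 2) - 1 / (2 * t)
        + Complex.I * σ * (((‖a‖ / √t) ^ α : ℝ) : ℂ)) * diracSol a α σ t s) t := by
  have hs := Real.sqrt_pos.2 ht
  have h1 : HasDerivAt (fun t : ℝ => Complex.I * ((s ^ 2 / (4 * t) : ℝ) : ℂ))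
      (Complex.I * ((-(s ^ 2) / (4 * t ^ 2) : ℝ) : ℂ)) t := by
    have h : HasDerivAt (fun t : ℝ => s ^ 2 / (4 * t)) (-(s ^ 2) / (4 * t ^ 2)) t := by
      refine ((((hasDerivAt_id t).const_mul 4).inv (by simpa using ht.ne')).const_mul
        (s ^ 2)).congr_deriv ?_
      simp only [id, mul_one]
      field_simp
    exact h.ofReal_comp.const_mul Complex.I
  have h2 : HasDerivAt (fun t : ℝ => (((√t : ℝ) : ℂ))⁻¹)
      (((-(1 / (2 * √t)) / √t ^ 2 : ℝ)) : ℂ) t := by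
    have h := ((Real.hasDerivAt_sqrt ht.ne').inv hs.ne').ofReal_comp
    simpa using h
  have h3 : HasDerivAt (fun t : ℝ => Complex.I * ((σ * phase a α t : ℝ) : ℂ))
      (Complex.I * ((σ * (‖a‖ / √t) ^ α : ℝ) : ℂ)) t :=
    ((hasDerivAt_phase hα₂ ht).const_mul σ).ofReal_comp.const_mul Complex.I
  refine (((h1.cexp.const_mul a).mul h2).mul h3.cexp).congr_deriv ?_
  have : (t : ℂ) ≠ 0 := by exact_mod_cast ht.ne'
  have h4 : ((√t : ℝ) : ℂ) ≠ 0 := by exact_mod_cast hs.ne'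
  have h5 : ((√t : ℝ) : ℂ) ^ 2 = t := by exact_mod_cast Real.sq_sqrt ht.le
  simp only [diracSol, freeDirac, div_eq_mul_inv, Pi.mul_apply]
  push_cast
  rw [h5]
  field_simp
  ring

theorem powerNL_diracSol (t s : ℝ) :
    powerNL α (diracSol a α σ t s) = (((‖a‖ / √t) ^ α : ℝ) : ℂ) * diracSol a α σ t s := by
  rw [powerNL, norm_diracSol]

theorem continuousOn_phase (hα₂ : α < 2) : ContinuousOn (phase a α) (Ioi 0) := fun _ ht =>
  (hasDerivAt_phase hα₂ ht).continuousAt.continuousWithinAt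

theorem continuousOn_diracSol (hα₂ : α < 2) :
    ContinuousOn (fun p : ℝ × ℝ => diracSol a α σ p.1 p.2) (Ioi 0 ×ˢ univ) := by
  have hph : ContinuousOn (fun p : ℝ × ℝ => phase a α p.1) (Ioi 0 ×ˢ univ) :=
    (continuousOn_phase hα₂).comp continuous_fst.continuousOn fun p hp => hp.1
  have h1 : ContinuousOn (fun p : ℝ × ℝ => p.2 ^ 2 / (4 * p.1)) (Ioi 0 ×ˢ univ) :=
    ContinuousOn.div (by fun_prop) (by fun_prop) fun p hp => by
      have : 0 < p.1 := hp.1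
      positivity
  have h2 : ContinuousOn (fun p : ℝ × ℝ => ((√p.1 : ℝ) : ℂ)) (Ioi 0 ×ˢ univ) := by fun_prop
  unfold diracSol freeDirac
  refine ContinuousOn.mul (ContinuousOn.div (by fun_prop) h2 fun p hp => ?_) (by fun_prop)
  exact_mod_cast (Real.sqrt_pos.2 hp.1).ne'

theorem continuousOn_amplitude :
    ContinuousOn (fun p : ℝ × ℝ => (((‖a‖ / √p.1) ^ α : ℝ) : ℂ)) (Ioi 0 ×ˢ univ) := by
  by_cases ha : a = 0
  · simp only [ha, norm_zero, zero_div]; fun_prop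
  refine Complex.continuous_ofReal.comp_continuousOn
    (ContinuousOn.rpow_const (ContinuousOn.div (by fun_prop) (by fun_prop) fun p hp => ?_)
      fun p hp => Or.inl ?_)
  · exact (Real.sqrt_pos.2 hp.1).ne'
  · exact div_ne_zero (norm_ne_zero_iff.2 ha) (Real.sqrt_pos.2 hp.1).ne'

theorem continuousOn_powerNL_diracSol (hα₂ : α < 2) :
    ContinuousOn (fun p : ℝ × ℝ => powerNL α (diracSol a α σ p.1 p.2)) (Ioi 0 ×ˢ univ) := by
  simp only [powerNL_diracSol]
  exact continuousOn_amplitude.mul (continuousOn_diracSol hα₂)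

theorem integral_linear_comb {X : Type*} [MeasurableSpace X] {μ : Measure X} {f g h : X → ℂ}
    (hf : Integrable f μ) (hg : Integrable g μ) (hh : Integrable h μ) (c d : ℂ) :
    ∫ x, (c * f x + g x + d * h x) ∂μ = c * (∫ x, f x ∂μ) + (∫ x, g x ∂μ) + d * ∫ x, h x ∂μ := by
  rw [integral_add (f := fun x => c * f x + g x) ((hf.const_mul c).add hg) (hh.const_mul d),
    integral_add (hf.const_mul c) hg, integral_const_mul, integral_const_mul]

/-- The explicit solution satisfies the equation in the sense of distributions. -/
theorem integral_diracSol (hα₂ : α < 2) {φ : ℝ × ℝ → ℂ} (hφ : IsTest T φ) :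
    ∫ p : ℝ × ℝ, (diracSol a α σ p.1 p.2 * (-Complex.I * timeDeriv φ p
      + spaceDeriv (spaceDeriv φ) p)
        + (σ : ℂ) * powerNL α (diracSol a α σ p.1 p.2) * φ p) = 0 := by
  have hsub : Ioo (0 : ℝ) T ×ˢ (univ : Set ℝ) ⊆ Ioi 0 ×ˢ univ :=
    prod_mono Ioo_subset_Ioi_self subset_rfl
  have hne : ∀ p ∈ Ioo (0 : ℝ) T ×ˢ (univ : Set ℝ), (p.1 : ℂ) ≠ 0 := fun p hp => by
    exact_mod_cast hp.1.1.ne'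
  have hu : ContinuousOn (fun p : ℝ × ℝ => diracSol a α σ p.1 p.2) (Ioo 0 T ×ˢ univ) :=
    (continuousOn_diracSol hα₂).mono hsub
  have hamp : ContinuousOn (fun p : ℝ × ℝ => (((‖a‖ / √p.1) ^ α : ℝ) : ℂ)) (Ioo 0 T ×ˢ univ) :=
    continuousOn_amplitude.mono hsub
  have hF : ContinuousOn (fun p : ℝ × ℝ => powerNL α (diracSol a α σ p.1 p.2))
      (Ioo 0 T ×ˢ univ) := (continuousOn_powerNL_diracSol hα₂).mono hsub
  set u : ℝ × ℝ → ℂ := fun p => diracSol a α σ p.1 p.2 with hudef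
  have hc1 : ContinuousOn (fun p : ℝ × ℝ => Complex.I * p.2 / (2 * p.1)) (Ioo 0 T ×ˢ univ) :=
    ContinuousOn.div (by fun_prop) (by fun_prop) fun p hp => mul_ne_zero two_ne_zero (hne p hp)
  have hc2 : ContinuousOn (fun p : ℝ × ℝ => Complex.I / (2 * p.1) +
      (Complex.I * p.2 / (2 * p.1)) ^ 2) (Ioo 0 T ×ˢ univ) :=
    ContinuousOn.add (ContinuousOn.div (by fun_prop) (by fun_prop)
      fun p hp => mul_ne_zero two_ne_zero (hne p hp)) (hc1.pow 2)
  have hc3 : ContinuousOn (fun p : ℝ × ℝ => -Complex.I * p.2 ^ 2 / (4 * p.1 ^ 2) - 1 / (2 * p.1)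
        + Complex.I * σ * (((‖a‖ / √p.1) ^ α : ℝ) : ℂ)) (Ioo 0 T ×ˢ univ) := by
    refine ContinuousOn.add (ContinuousOn.sub ?_ ?_) (continuousOn_const.mul hamp)
    · exact ContinuousOn.div (by fun_prop) (by fun_prop) fun p hp =>
        mul_ne_zero (by norm_num : (4 : ℂ) ≠ 0) (pow_ne_zero 2 (hne p hp))
    · exact ContinuousOn.div (by fun_prop) (by fun_prop) fun p hp =>
        mul_ne_zero two_ne_zero (hne p hp)
  have e1 := hφ.integral_time hu (hc3.mul hu) fun t ht s => hasDerivAt_diracSol_time hα₂ ht.1 s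
  have e2 := hφ.spaceDeriv.integral_space hu (hc1.mul hu)
    fun t ht s => hasDerivAt_diracSol_space ht.1 s
  have e3 := hφ.integral_space (hc1.mul hu) (hc2.mul hu) fun t ht s => by
    have h1 : HasDerivAt (fun s : ℝ => Complex.I * s / (2 * t)) (Complex.I / (2 * t)) s := by
      simpa using ((hasDerivAt_id s).ofReal_comp.const_mul Complex.I).div_const (2 * (t : ℂ))
    refine (h1.mul (hasDerivAt_diracSol_space (a := a) (α := α) (σ := σ) ht.1 s)).congr_deriv ?_
    simp only [hudef, Pi.mul_apply]
    ring
  have i1 := hφ.timeDeriv.integrable_mul hu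
  have i2 := hφ.spaceDeriv.spaceDeriv.integrable_mul hu
  have i3 := hφ.integrable_mul hF
  have i4 := hφ.integrable_mul (hc3.mul hu)
  have i5 := hφ.integrable_mul (hc2.mul hu)
  calc _ = ∫ p : ℝ × ℝ, (-Complex.I * (u p * timeDeriv φ p) + u p * spaceDeriv (spaceDeriv φ) p
        + σ * (powerNL α (u p) * φ p)) := by congr 1; ext p; simp only [hudef]; ring
    _ = -Complex.I * (∫ p, u p * timeDeriv φ p) + (∫ p, u p * spaceDeriv (spaceDeriv φ) p)
        + σ * ∫ p, powerNL α (u p) * φ p := by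
        exact integral_linear_comb i1 i2 i3 _ _
    _ = ∫ p : ℝ × ℝ, (Complex.I * ((-Complex.I * p.2 ^ 2 / (4 * p.1 ^ 2) - 1 / (2 * p.1)
        + Complex.I * σ * (((‖a‖ / √p.1) ^ α : ℝ) : ℂ)) * u p * φ p) +
        (Complex.I / (2 * p.1) + (Complex.I * p.2 / (2 * p.1)) ^ 2) * u p * φ p
        + σ * (powerNL α (u p) * φ p)) := by
        refine Eq.trans ?_ (integral_linear_comb i4 i5 i3 _ _).symm
        rw [e1, e2, e3]
        simp only [hudef]
        ring
    -- Pointwise cancellation: after multiplication by i the time coefficient is s²/(4t²) - i/(2t) -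
    -- σ(|a|/√t)^α, the space coefficient is i/(2t) - s²/(4t²), and the nonlinear one is
    -- σ(|a|/√t)^α.
    _ = 0 := by
        rw [← integral_zero (ℝ × ℝ) ℂ]
        congr 1
        ext p
        by_cases hp : p.1 ∈ Ioo 0 T
        · have h0 : (p.1 : ℂ) ≠ 0 := by exact_mod_cast hp.1.ne'
          simp only [hudef, powerNL_diracSol]
          field_simp
          ring_nf
          rw [Complex.I_sq]
          ring
        · rw [show φ p = 0 from hφ.eq_zero hp p.2]
          simp

end ExplicitSolution

/-! ### Convergence of the explicit solution to a Dirac mass -/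

section InitialData

open scoped ENNReal ComplexConjugate FourierTransform

/-- The Fourier transform of a Gaussian, paired with a Schwartz function. -/
theorem integral_gaussian_mul {b : ℂ} (hb : 0 < b.re) (φ : 𝓢(ℝ, ℂ)) :
    ∫ s : ℝ, Complex.exp (-b * s ^ 2) * φ s =
      ((Real.pi : ℂ) / b) ^ (1 / 2 : ℂ) *
        ∫ ξ : ℝ, Complex.exp (-(Real.pi : ℂ) ^ 2 * ξ ^ 2 / b) * (𝓕⁻ φ : 𝓢(ℝ, ℂ)) ξ := by
  have hg : Integrable (fun s : ℝ => Complex.exp (-b * s ^ 2)) := integrable_cexp_neg_mul_sq hb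
  have h1 : Integrable (Function.uncurry fun s ξ : ℝ => Complex.exp (-b * s ^ 2) *
      (Complex.exp (Complex.I * (-2 * Real.pi * ξ : ℝ) * s) * (𝓕⁻ φ : 𝓢(ℝ, ℂ)) ξ)) (volume.prod volume) := by
    refine (hg.mul_prod (𝓕⁻ φ).integrable).mono ?_ (Eventually.of_forall fun p => ?_)
    · refine Continuous.aestronglyMeasurable ?_
      have := (𝓕⁻ φ).continuous
      unfold Function.uncurry
      fun_prop
    · simp only [Function.uncurry, norm_mul]
      rw [mul_comm Complex.I, mul_right_comm, ← Complex.ofReal_mul,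
        Complex.norm_exp_ofReal_mul_I, one_mul]
  have h2 : ∀ s : ℝ, φ s = ∫ ξ : ℝ,
      Complex.exp (Complex.I * (-2 * Real.pi * ξ : ℝ) * s) * (𝓕⁻ φ : 𝓢(ℝ, ℂ)) ξ := fun s => by
    conv_lhs => rw [← FourierTransform.fourier_fourierInv_eq (F := 𝓢(ℝ, ℂ)) φ]
    rw [SchwartzMap.fourier_coe, Real.fourier_eq']
    refine integral_congr_ae (Eventually.of_forall fun ξ => ?_)
    simp only [smul_eq_mul]
    congr 2
    simp
    ring
  calc ∫ s : ℝ, Complex.exp (-b * s ^ 2) * φ s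
      = ∫ s : ℝ, ∫ ξ : ℝ, Complex.exp (-b * s ^ 2) *
        (Complex.exp (Complex.I * (-2 * Real.pi * ξ : ℝ) * s) * (𝓕⁻ φ : 𝓢(ℝ, ℂ)) ξ) := by
        refine integral_congr_ae (Eventually.of_forall fun s => ?_)
        simp only
        rw [integral_const_mul, ← h2]
    _ = ∫ ξ : ℝ, ∫ s : ℝ, Complex.exp (-b * s ^ 2) *
        (Complex.exp (Complex.I * (-2 * Real.pi * ξ : ℝ) * s) * (𝓕⁻ φ : 𝓢(ℝ, ℂ)) ξ) :=
        integral_integral_swap h1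
    _ = ∫ ξ : ℝ, ((Real.pi : ℂ) / b) ^ (1 / 2 : ℂ) *
        (Complex.exp (-(Real.pi : ℂ) ^ 2 * ξ ^ 2 / b) * (𝓕⁻ φ : 𝓢(ℝ, ℂ)) ξ) := by
        refine integral_congr_ae (Eventually.of_forall fun ξ => ?_)
        have h3 := fourierIntegral_gaussian hb ((-2 * Real.pi * ξ : ℝ) : ℂ)
        have h4 : -(((-2 * Real.pi * ξ : ℝ) : ℂ)) ^ 2 / (4 * b) =
            -(Real.pi : ℂ) ^ 2 * ξ ^ 2 / b := by
          push_cast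
          rw [show -(-2 * (Real.pi : ℂ) * ξ) ^ 2 = 4 * (-(Real.pi : ℂ) ^ 2 * ξ ^ 2) by ring]
          exact mul_div_mul_left _ _ (by norm_num)
        rw [h4] at h3
        simp only
        rw [← mul_assoc, ← h3, ← integral_mul_const]
        refine integral_congr_ae (Eventually.of_forall fun s => ?_)
        simp only
        ring
    _ = ((Real.pi : ℂ) / b) ^ (1 / 2 : ℂ) *
        ∫ ξ : ℝ, Complex.exp (-(Real.pi : ℂ) ^ 2 * ξ ^ 2 / b) * (𝓕⁻ φ : 𝓢(ℝ, ℂ)) ξ :=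
        integral_const_mul _ _

/-- The oscillatory Gaussian, paired with a Schwartz function. -/
theorem integral_freeDirac_mul {t : ℝ} (ht : 0 < t) (φ : 𝓢(ℝ, ℂ)) :
    ∫ s : ℝ, Complex.exp (Complex.I * ((s ^ 2 / (4 * t) : ℝ) : ℂ)) * φ s =
      (((4 * Real.pi * t : ℝ) : ℂ) * Complex.I) ^ (1 / 2 : ℂ) *
        ∫ ξ : ℝ, Complex.exp (((-4 * Real.pi ^ 2 * ξ ^ 2 * t : ℝ) : ℂ) * Complex.I) * (𝓕⁻ φ : 𝓢(ℝ, ℂ)) ξ := by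
  have ht' : (t : ℂ) ≠ 0 := by exact_mod_cast ht.ne'
  -- A real part ε > 0 makes the Gaussian integrable; at ε = 0 it becomes e^{is²/(4t)}. Since φ and
  -- its inverse transform are integrable, dominated convergence applies on both sides of the
  -- Gaussian identity.
  set b : ℝ → ℂ := fun ε => ε - Complex.I / (4 * t) with hb
  have hbre : ∀ ε, (b ε).re = ε := fun ε => by
    have h : Complex.I / (4 * t) = ((1 / (4 * t) : ℝ) : ℂ) * Complex.I := by push_cast; ring
    simp only [hb]
    rw [h, Complex.sub_re, Complex.ofReal_re, Complex.re_ofReal_mul, Complex.I_re]; ring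
  have hb0 : b 0 = -Complex.I / (4 * t) := by simp only [hb, Complex.ofReal_zero]; ring
  have hbne : b 0 ≠ 0 := by
    rw [hb0]
    exact div_ne_zero (neg_ne_zero.2 Complex.I_ne_zero) (mul_ne_zero (by norm_num) ht')
  have hbc : Continuous b := by simp only [hb]; fun_prop
  have hbt : Tendsto b (𝓝[>] 0) (𝓝 (b 0)) := (hbc.tendsto 0).mono_left nhdsWithin_le_nhds
  have hpos : ∀ᶠ ε : ℝ in 𝓝[>] 0, 0 < ε := self_mem_nhdsWithin
  have hb0' : (b 0)⁻¹ = 4 * t * Complex.I := by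
    refine (eq_inv_of_mul_eq_one_left ?_).symm
    rw [hb0]
    field_simp
    simp
  have hinv : (Real.pi : ℂ) / b 0 = ((4 * Real.pi * t : ℝ) : ℂ) * Complex.I := by
    rw [div_eq_mul_inv, hb0']
    push_cast
    ring
  have h1 : Tendsto (fun ε => ∫ s : ℝ, Complex.exp (-b ε * s ^ 2) * φ s) (𝓝[>] 0)
      (𝓝 (∫ s : ℝ, Complex.exp (-b 0 * s ^ 2) * φ s)) := by
    refine tendsto_integral_filter_of_dominated_convergence (fun s => ‖φ s‖) ?_ ?_
      φ.integrable.norm ?_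
    · refine Eventually.of_forall fun ε => Continuous.aestronglyMeasurable ?_
      have := φ.continuous
      fun_prop
    · filter_upwards [hpos] with ε hε
      refine Eventually.of_forall fun s => ?_
      rw [norm_mul, Complex.norm_exp]
      refine mul_le_of_le_one_left (norm_nonneg _) (Real.exp_le_one_iff.2 ?_)
      rw [← Complex.ofReal_pow, Complex.re_mul_ofReal, Complex.neg_re, hbre]
      nlinarith [sq_nonneg s]
    · refine Eventually.of_forall fun s => ?_
      exact (((Complex.continuous_exp.tendsto _).comp
        ((hbt.neg).mul_const _))).mul_const _
  have h2 : Tendsto (fun ε => ∫ ξ : ℝ, Complex.exp (-(Real.pi : ℂ) ^ 2 * ξ ^ 2 / b ε) * (𝓕⁻ φ : 𝓢(ℝ, ℂ)) ξ)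
      (𝓝[>] 0) (𝓝 (∫ ξ : ℝ, Complex.exp (-(Real.pi : ℂ) ^ 2 * ξ ^ 2 / b 0) * (𝓕⁻ φ : 𝓢(ℝ, ℂ)) ξ)) := by
    refine tendsto_integral_filter_of_dominated_convergence (fun s => ‖(𝓕⁻ φ : 𝓢(ℝ, ℂ)) s‖) ?_ ?_
      (𝓕⁻ φ).integrable.norm ?_
    · refine Eventually.of_forall fun ε => Continuous.aestronglyMeasurable ?_
      have := (𝓕⁻ φ).continuous
      fun_prop
    · filter_upwards [hpos] with ε hε
      refine Eventually.of_forall fun s => ?_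
      rw [norm_mul, Complex.norm_exp]
      refine mul_le_of_le_one_left (norm_nonneg _) (Real.exp_le_one_iff.2 ?_)
      have h : -(Real.pi : ℂ) ^ 2 * s ^ 2 / b ε = ((-(Real.pi ^ 2 * s ^ 2) : ℝ) : ℂ) * (b ε)⁻¹ := by
        push_cast; ring
      rw [h, Complex.re_ofReal_mul, Complex.inv_re, hbre]
      have : 0 ≤ ε / Complex.normSq (b ε) := div_nonneg hε.le (Complex.normSq_nonneg _)
      nlinarith [mul_nonneg (sq_nonneg (Real.pi * s)) this]
    · refine Eventually.of_forall fun s => ?_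
      exact (((Complex.continuous_exp.tendsto _).comp
        (tendsto_const_nhds.div hbt hbne))).mul_const _
  have h3 : Tendsto (fun ε => ((Real.pi : ℂ) / b ε) ^ (1 / 2 : ℂ)) (𝓝[>] 0)
      (𝓝 (((Real.pi : ℂ) / b 0) ^ (1 / 2 : ℂ))) := by
    -- The limit π/b = 4πt i is off the branch cut of the square root, so the square roots converge
    -- too.
    refine (continuousAt_cpow_const ?_).tendsto.comp (tendsto_const_nhds.div hbt hbne)
    rw [hinv]
    right
    rw [Complex.im_ofReal_mul, Complex.I_im, mul_one]
    positivity
  have h4 := tendsto_nhds_unique (h1.congr' ?_) (h3.mul h2)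
  · rw [hinv] at h4
    refine Eq.trans ?_ (h4.trans ?_)
    · congr 1; ext s; congr 2
      rw [hb0]; push_cast; field_simp
    · congr 2; ext ξ; congr 2
      rw [div_eq_mul_inv, hb0']
      push_cast
      ring
  · filter_upwards [hpos] with ε hε
    exact integral_gaussian_mul (by rw [hbre]; exact hε) φ

/-- Principal branch: log i = iπ/2, which is the origin of the factor e^{iπ/4} in `diracMass`. -/
theorem sqrt_mul_I_cpow {r : ℝ} (hr : 0 < r) :
    ((r : ℂ) * Complex.I) ^ (1 / 2 : ℂ) =
      ((√r : ℝ) : ℂ) * Complex.exp (Complex.I * ((Real.pi / 4 : ℝ) : ℂ)) := by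
  rw [Complex.cpow_def_of_ne_zero (mul_ne_zero (by exact_mod_cast hr.ne') Complex.I_ne_zero),
    Complex.log_ofReal_mul hr Complex.I_ne_zero, Complex.log_I, add_mul, Complex.exp_add]
  congr 1
  · rw [Real.sqrt_eq_rpow, Complex.ofReal_cpow hr.le,
      Complex.cpow_def_of_ne_zero (by exact_mod_cast hr.ne'), Complex.ofReal_log hr.le]
    norm_num
  · congr 1; push_cast; ring

/-- The explicit solution converges to a multiple of the Dirac mass. -/
theorem tendsto_diracSol (a : ℂ) {α : ℝ} (σ : ℝ) (hα₂ : α < 2) (φ : 𝓢(ℝ, ℂ)) :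
    Tendsto (fun t : ℝ => ∫ s, diracSol a α σ t s * φ s) (𝓝[>] 0) (𝓝 (a * diracMass * φ 0)) := by
  have hpos : ∀ᶠ t : ℝ in 𝓝[>] 0, 0 < t := self_mem_nhdsWithin
  have h1 : Tendsto (fun t : ℝ => ∫ ξ : ℝ,
      Complex.exp (((-4 * Real.pi ^ 2 * ξ ^ 2 * t : ℝ) : ℂ) * Complex.I) * (𝓕⁻ φ : 𝓢(ℝ, ℂ)) ξ) (𝓝[>] 0)
      (𝓝 (∫ ξ : ℝ, (𝓕⁻ φ : 𝓢(ℝ, ℂ)) ξ)) := by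
    refine tendsto_integral_filter_of_dominated_convergence (fun s => ‖(𝓕⁻ φ : 𝓢(ℝ, ℂ)) s‖) ?_ ?_
      (𝓕⁻ φ).integrable.norm ?_
    · refine Eventually.of_forall fun ε => Continuous.aestronglyMeasurable ?_
      have := (𝓕⁻ φ).continuous
      fun_prop
    · refine Eventually.of_forall fun t => Eventually.of_forall fun s => ?_
      rw [norm_mul, Complex.norm_exp_ofReal_mul_I, one_mul]
    · refine Eventually.of_forall fun ξ => ?_
      have hc : Continuous fun t : ℝ =>
        Complex.exp (((-4 * Real.pi ^ 2 * ξ ^ 2 * t : ℝ) : ℂ) * Complex.I) * (𝓕⁻ φ : 𝓢(ℝ, ℂ)) ξ := by fun_prop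
      simpa using (hc.tendsto 0).mono_left nhdsWithin_le_nhds
  have h0 : ∫ ξ : ℝ, (𝓕⁻ φ : 𝓢(ℝ, ℂ)) ξ = φ 0 := by
    conv_rhs => rw [← FourierTransform.fourier_fourierInv_eq (F := 𝓢(ℝ, ℂ)) φ]
    rw [SchwartzMap.fourier_coe, Real.fourier_eq']
    simp
  -- The nonlinear phase disappears at t = 0 because its exponent 1 - α/2 is positive.
  have h2 : Tendsto (fun t => Complex.exp (Complex.I * ((σ * phase a α t : ℝ) : ℂ))) (𝓝[>] 0)
      (𝓝 1) := by
    have h : Tendsto (fun t : ℝ => phase a α t) (𝓝[>] 0) (𝓝 0) := by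
      have hp : 0 < 1 - α / 2 := by linarith
      have := (((Real.continuous_rpow_const hp.le).tendsto 0).const_mul
        (‖a‖ ^ α / (1 - α / 2))).mono_left (nhdsWithin_le_nhds (s := Ioi 0))
      rw [Real.zero_rpow hp.ne', mul_zero] at this
      exact this
    have hc : Continuous fun x : ℝ => Complex.exp (Complex.I * ((σ * x : ℝ) : ℂ)) := by fun_prop
    simpa [Function.comp_def] using (hc.tendsto 0).comp h
  have h3 := (h2.const_mul (a * diracMass)).mul h1
  rw [h0, mul_one] at h3
  refine h3.congr' ?_
  filter_upwards [hpos] with t ht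
  have hst : ((√t : ℝ) : ℂ) ≠ 0 := by exact_mod_cast (Real.sqrt_pos.2 ht).ne'
  have h4 : ∫ s, diracSol a α σ t s * φ s = a / ((√t : ℝ) : ℂ) *
      Complex.exp (Complex.I * ((σ * phase a α t : ℝ) : ℂ)) *
      ∫ s : ℝ, Complex.exp (Complex.I * ((s ^ 2 / (4 * t) : ℝ) : ℂ)) * φ s := by
    rw [← integral_const_mul]
    congr 1; ext s
    simp only [diracSol, freeDirac]
    ring
  rw [h4, integral_freeDirac_mul ht, sqrt_mul_I_cpow (by positivity), diracMass,
    show 4 * Real.pi * t = 2 ^ 2 * (Real.pi * t) by ring, Real.sqrt_mul (by norm_num),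
    Real.sqrt_sq (by norm_num), Real.sqrt_mul Real.pi_pos.le]
  generalize (∫ ξ : ℝ, Complex.exp (((-4 * Real.pi ^ 2 * ξ ^ 2 * t : ℝ) : ℂ) * Complex.I) *
    (𝓕⁻ φ : 𝓢(ℝ, ℂ)) ξ) = J
  push_cast
  field_simp

end InitialData

/-! ### Integration by parts against Bochner primitives -/

section IntegrationByParts

open scoped ENNReal ComplexConjugate

variable {E : Type*} [NormedAddCommGroup E] [InnerProductSpace ℂ E]

theorem integrableOn_inner {ψ K : ℝ → E} {t : ℝ} (hψ : Continuous ψ)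
    (hK : IntegrableOn K (Ioc 0 t)) : IntegrableOn (fun r => inner ℂ (ψ r) (K r)) (Ioc 0 t) := by
  obtain ⟨C, hC⟩ := (isCompact_Icc (a := (0 : ℝ)) (b := t)).exists_bound_of_continuousOn
    hψ.continuousOn
  refine (hK.norm.const_mul C).mono (hψ.aestronglyMeasurable.inner hK.aestronglyMeasurable) ?_
  filter_upwards [ae_restrict_mem measurableSet_Ioc] with x hx
  refine (norm_inner_le_norm _ _).trans ?_
  rw [norm_mul, norm_norm]
  exact mul_le_mul_of_nonneg_right ((hC _ ⟨hx.1.le, hx.2⟩).trans (Real.le_norm_self _))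
    (norm_nonneg _)

/-- Integration by parts against a primitive. -/
theorem integral_inner_deriv [NormedSpace ℝ E] [IsScalarTower ℝ ℂ E] [CompleteSpace E]
    {ψ ψ' K : ℝ → E} {t : ℝ}
    (hψ : ∀ r, HasDerivAt ψ (ψ' r) r) (hψ' : Continuous ψ')
    (hK : IntegrableOn K (Ioc 0 t)) :
    ∫ r in Ioc 0 t, inner ℂ (ψ' r) (∫ x in Ioc 0 r, K x) =
      inner ℂ (ψ t) (∫ x in Ioc 0 t, K x) - ∫ r in Ioc 0 t, inner ℂ (ψ r) (K r) := by
  set μ : Measure ℝ := volume.restrict (Ioc 0 t) with hμ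
  have hψc : Continuous ψ := continuous_iff_continuousAt.2 fun r => (hψ r).continuousAt
  obtain ⟨C, hC⟩ := (isCompact_Icc (a := (0 : ℝ)) (b := t)).exists_bound_of_continuousOn
    hψ'.continuousOn
  have hmem : ∀ᵐ r ∂μ, r ∈ Ioc 0 t := ae_restrict_mem measurableSet_Ioc
  -- Fubini on the triangle x ≤ r. In this way K only has to be integrable, and its primitive need
  -- not be differentiated.
  let F : ℝ × ℝ → ℂ := {p : ℝ × ℝ | p.2 ≤ p.1}.indicator fun p => inner ℂ (ψ' p.1) (K p.2)
  have hF : Integrable F (μ.prod μ) := by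
    refine ((integrable_const C).mul_prod hK.norm).mono ?_ ?_
    · refine AEStronglyMeasurable.indicator ?_ (measurableSet_le measurable_snd measurable_fst)
      exact (hψ'.comp continuous_fst).aestronglyMeasurable.inner hK.aestronglyMeasurable.comp_snd
    · have h1 : ∀ᵐ p ∂(μ.prod μ), p.1 ∈ Ioc 0 t :=
        Measure.quasiMeasurePreserving_fst.ae hmem
      filter_upwards [h1] with p hp
      refine (norm_indicator_le_norm_self _ _).trans ((norm_inner_le_norm _ _).trans ?_)
      rw [norm_mul, norm_norm]
      exact mul_le_mul_of_nonneg_right ((hC _ ⟨hp.1.le, hp.2⟩).trans (Real.le_norm_self _))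
        (norm_nonneg _)
  have hl : ∀ᵐ r ∂μ, inner ℂ (ψ' r) (∫ x in Ioc 0 r, K x) = ∫ x, F (r, x) ∂μ := by
    filter_upwards [hmem] with r hr
    have h1 : ∀ x, F (r, x) = (Iic r).indicator (fun x => inner ℂ (ψ' r) (K x)) x := fun x => rfl
    simp only [h1]
    rw [integral_indicator measurableSet_Iic, hμ, Measure.restrict_restrict measurableSet_Iic,
      inter_comm, Ioc_inter_Iic, min_eq_right hr.2, integral_inner]
    exact hK.mono_set (Ioc_subset_Ioc_right hr.2)
  have hr : ∀ᵐ x ∂μ, ∫ r, F (r, x) ∂μ = inner ℂ (ψ t) (K x) - inner ℂ (ψ x) (K x) := by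
    filter_upwards [hmem] with x hx
    have h1 : ∀ r, F (r, x) = (Ici x).indicator (fun r => inner ℂ (ψ' r) (K x)) r := fun x => rfl
    simp only [h1]
    have h2 : Ioc 0 t ∩ Ici x = Icc x t := by
      ext r; constructor
      · rintro ⟨h, h'⟩; exact ⟨h', h.2⟩
      · rintro ⟨h, h'⟩; exact ⟨⟨hx.1.trans_le h, h'⟩, h⟩
    rw [integral_indicator measurableSet_Ici, hμ, Measure.restrict_restrict measurableSet_Ici,
      inter_comm, h2, integral_Icc_eq_integral_Ioc, ← intervalIntegral.integral_of_le hx.2]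
    refine intervalIntegral.integral_eq_sub_of_hasDerivAt (f := fun r => inner ℂ (ψ r) (K x))
      (fun r _ => ?_) ?_
    · simpa using (hψ r).inner ℂ (hasDerivAt_const r (K x))
    · exact (hψ'.inner continuous_const).intervalIntegrable _ _
  have hi : Integrable (fun x => inner ℂ (ψ x) (K x)) μ := integrableOn_inner hψc hK
  rw [integral_congr_ae hl, integral_integral_swap (f := fun r x => F (r, x)) hF, integral_congr_ae hr, integral_sub _ hi,
    integral_inner hK]
  exact hK.const_inner _

end IntegrationByParts

/-! ### Test functions as differentiable curves in L² -/

section Slices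

open scoped ENNReal ComplexConjugate

/-- The function `φ(t, ·)` as an element of `L²(ℝ)`. -/
noncomputable def slice (φ : ℝ × ℝ → ℂ) (t : ℝ) : L2R := toL2 fun s => φ (t, s)

theorem real_smul_eq (c : ℝ) (f : L2R) : c • f = (c : ℂ) • f := (algebraMap_smul ℂ c f).symm

variable {T : ℝ} {φ : ℝ × ℝ → ℂ}

theorem IsTest.contDiff_slice (hφ : IsTest T φ) (t : ℝ) : ContDiff ℝ ∞ fun s => φ (t, s) :=
  hφ.smooth.comp (contDiff_const.prodMk contDiff_id)

theorem IsTest.memLp_slice (hφ : IsTest T φ) (t : ℝ) : MemLp (fun s => φ (t, s)) 2 volume :=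
  (hφ.contDiff_slice t).continuous.memLp_of_hasCompactSupport (hasCompactSupport_space hφ.compact t)

/-- A test function is bounded by a multiple of the indicator of a strip. -/
theorem IsTest.exists_bound (hφ : IsTest T φ) : ∃ C R : ℝ, 0 ≤ C ∧ 0 ≤ R ∧
    ∀ t s, ‖φ (t, s)‖ ≤ (Icc (-R) R).indicator (fun _ => C) s := by
  obtain ⟨C, hC⟩ := hφ.compact.exists_bound_of_continuous hφ.smooth.continuous
  obtain ⟨R, hR0, hR⟩ := (hφ.compact.isBounded).subset_closedBall_lt 0 0
  have hC0 := (norm_nonneg _).trans (hC 0)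
  refine ⟨C, R, hC0, hR0.le, fun t s => ?_⟩
  by_cases hs : s ∈ Icc (-R) R
  · rw [indicator_of_mem hs]; exact hC _
  · rw [indicator_of_notMem hs, norm_le_zero_iff]
    by_contra h
    have h1 := hR (subset_tsupport _ h)
    rw [mem_closedBall_zero_iff] at h1
    exact hs (abs_le.1 ((norm_snd_le (t, s)).trans h1))

theorem memLp_indicator_Icc (C R : ℝ) : MemLp ((Icc (-R) R).indicator fun _ => C) 2 volume :=
  memLp_indicator_const 2 measurableSet_Icc C (Or.inr (by simp))

theorem IsTest.continuous_slice (hφ : IsTest T φ) : Continuous (slice φ) := by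
  obtain ⟨C, R, -, -, hb⟩ := hφ.exists_bound
  refine continuous_iff_continuousAt.2 fun t => tendsto_toL2 (memLp_indicator_Icc C R)
    (Eventually.of_forall fun r => (hφ.memLp_slice r).1) (hφ.memLp_slice t).1
    (Eventually.of_forall fun r => Eventually.of_forall (hb r)) (Eventually.of_forall (hb t))
    (Eventually.of_forall fun s => ?_)
  exact (hφ.smooth.continuous.comp (by fun_prop : Continuous fun r : ℝ => (r, s))).tendsto t

theorem IsTest.hasDerivAt_slice (hφ : IsTest T φ) (t : ℝ) :
    HasDerivAt (slice φ) (slice (DiracNLS.timeDeriv φ) t) t := by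
  obtain ⟨C, R, hC, -, hb⟩ := hφ.timeDeriv.exists_bound
  rw [hasDerivAt_iff_tendsto_slope]
  have h1 : ∀ r, slope (slice φ) t r = toL2 fun s => slope (fun r => φ (r, s)) t r := fun r => by
    simp only [slope, vsub_eq_sub, slice]
    rw [← toL2_sub (hφ.memLp_slice r) (hφ.memLp_slice t), real_smul_eq]
    refine (toL2_const_mul _ ((hφ.memLp_slice r).sub (hφ.memLp_slice t))).symm.trans
      (toL2_congr (Eventually.of_forall fun s => ?_))
    simp
  rw [funext h1]
  refine tendsto_toL2 (memLp_indicator_Icc C R) (Eventually.of_forall fun r => ?_)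
    (hφ.timeDeriv.memLp_slice t).1
    (Eventually.of_forall fun r => Eventually.of_forall fun s => ?_) (Eventually.of_forall (hb t))
    (Eventually.of_forall fun s => hasDerivAt_iff_tendsto_slope.1 (hφ.hasDerivAt_time t s))
  · exact (((hφ.memLp_slice r).sub (hφ.memLp_slice t)).1.const_smul ((r - t)⁻¹ : ℝ))
  · have hmv := Convex.norm_image_sub_le_of_norm_hasDerivWithin_le (s := univ) (x := t) (y := r)
      (f := fun r => φ (r, s)) (C := (Icc (-R) R).indicator (fun _ => C) s)
      (fun x _ => (hφ.hasDerivAt_time x s).hasDerivWithinAt) (fun x _ => hb x s) convex_univ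
      (mem_univ _) (mem_univ _)
    have h0 : 0 ≤ (Icc (-R) R).indicator (fun _ => C) s := indicator_nonneg (fun _ _ => hC) s
    rw [slope_def_module, norm_smul, norm_inv]
    rcases eq_or_ne r t with rfl | hrt
    · simpa using h0
    · rw [inv_mul_le_iff₀ (norm_pos_iff.2 (sub_ne_zero.2 hrt)), mul_comm]
      exact hmv

/-- The Schwartz function `φ(t, ·)`. -/
noncomputable def IsTest.schwartz (hφ : IsTest T φ) (t : ℝ) : 𝓢(ℝ, ℂ) :=
  (hasCompactSupport_space hφ.compact t).toSchwartzMap (hφ.contDiff_slice t)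

theorem IsTest.secondDeriv_schwartz (hφ : IsTest T φ) (t s : ℝ) :
    secondDeriv (hφ.schwartz t) s = DiracNLS.spaceDeriv (DiracNLS.spaceDeriv φ) (t, s) := by
  have h : ∀ g : 𝓢(ℝ, ℂ), (SchwartzMap.derivCLM ℂ ℂ g : ℝ → ℂ) = deriv g := fun g => by
    ext x; exact SchwartzMap.derivCLM_apply ℂ g x
  rw [← hφ.iteratedDeriv_space (t, s), iteratedDeriv_succ, iteratedDeriv_one, secondDeriv, h, h]
  rfl

/-- The derivative of a test function in the interaction picture. -/
theorem IsTest.hasDerivAt_freeProp_slice (hφ : IsTest T φ) (t : ℝ) :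
    HasDerivAt (fun r => freeProp (-r) (slice φ r))
      (freeProp (-t) (slice (fun p => DiracNLS.timeDeriv φ p +
        -Complex.I * DiracNLS.spaceDeriv (DiracNLS.spaceDeriv φ) p) t)) t := by
  have h1 : slice φ t = toL2 (hφ.schwartz t) := rfl
  have h2 : HasDerivAt (fun r => freeProp (-r) (slice φ t))
      (-freeProp (-t) (Complex.I • slice (DiracNLS.spaceDeriv (DiracNLS.spaceDeriv φ)) t)) t := by
    have h := (hasDerivAt_freeProp (hφ.schwartz t) (-t)).scomp t (hasDerivAt_neg t)
    rw [neg_one_smul] at h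
    have h3 : slice (DiracNLS.spaceDeriv (DiracNLS.spaceDeriv φ)) t =
        toL2 (secondDeriv (hφ.schwartz t)) :=
      toL2_congr (Eventually.of_forall fun s => (hφ.secondDeriv_schwartz t s).symm)
    rw [h1, h3]
    exact h
  -- Product rule: the slope splits into the group applied to the slope of the slices and the slope
  -- of the group on the frozen slice. The first converges by joint continuity of the group.
  have h3 : Tendsto (fun r => freeProp (-r) (slope (slice φ) t r)) (𝓝[≠] t)
      (𝓝 (freeProp (-t) (slice (DiracNLS.timeDeriv φ) t))) := by
    have hc := (continuous_freeProp.tendsto (-t, slice (DiracNLS.timeDeriv φ) t))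
    refine Tendsto.comp (g := fun p : ℝ × L2R => freeProp p.1 p.2)
      (f := fun r => (-r, slope (slice φ) t r)) hc (Tendsto.prodMk_nhds ?_
      (hasDerivAt_iff_tendsto_slope.1 (hφ.hasDerivAt_slice t)))
    exact (continuous_neg.tendsto t).mono_left nhdsWithin_le_nhds
  rw [hasDerivAt_iff_tendsto_slope] at h2 ⊢
  have h4 : slice (fun p => DiracNLS.timeDeriv φ p +
        -Complex.I * DiracNLS.spaceDeriv (DiracNLS.spaceDeriv φ) p) t =
      slice (DiracNLS.timeDeriv φ) t -
        Complex.I • slice (DiracNLS.spaceDeriv (DiracNLS.spaceDeriv φ)) t := by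
    have := hφ.spaceDeriv.spaceDeriv.memLp_slice t
    simp only [slice]
    rw [toL2_add (hφ.timeDeriv.memLp_slice t) (this.const_mul (-Complex.I)),
      toL2_const_mul _ this, neg_smul, sub_eq_add_neg]
  rw [h4, map_sub, sub_eq_add_neg]
  refine (h3.add h2).congr fun r => ?_
  have h5 : ∀ (c : ℝ) (x : L2R), freeProp (-r) (c • x) = c • freeProp (-r) x := fun c x => by
    rw [real_smul_eq, map_smul, ← real_smul_eq]
  simp only [slope, vsub_eq_sub]
  rw [h5, map_sub, ← smul_add]
  congr 1
  abel

theorem IsTest.inner_slice (hφ : IsTest T φ) (t : ℝ) (g : L2R) :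
    inner ℂ (slice φ t) g = ∫ s, g s * conj (φ (t, s)) := inner_toL2 (hφ.memLp_slice t) g

theorem toL2_zero : toL2 (fun _ => 0) = 0 := by
  have : toL2 (fun _ => 0) = toL2 ((0 : L2R) : ℝ → ℂ) :=
    toL2_congr (Lp.coeFn_zero ℂ 2 (volume : Measure ℝ)).symm
  rw [this, toL2_coeFn]

theorem IsTest.slice_eq_zero (hφ : IsTest T φ) {t : ℝ} (ht : t ∉ Ioo 0 T) : slice φ t = 0 := by
  rw [slice, funext fun s => hφ.eq_zero ht s, toL2_zero]

/-- The adjoint free Schrödinger operator, `φ_t - i φ_ss`. -/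
noncomputable def freeOp (φ : ℝ × ℝ → ℂ) (p : ℝ × ℝ) : ℂ :=
  timeDeriv φ p + -Complex.I * spaceDeriv (spaceDeriv φ) p

theorem IsTest.freeOp (hφ : IsTest T φ) : IsTest T (freeOp φ) :=
  hφ.timeDeriv.add (hφ.spaceDeriv.spaceDeriv.const_mul _)

end Slices

/-! ### From the Duhamel equation to the weak equation -/

section WeakForm

variable {a : ℂ} {α σ T : ℝ}

/-- The equation for the perturbation `V` of `u_{a,σα}`, tested in `L²`. -/
def IsWeak (a : ℂ) (α σ T : ℝ) (V : ℝ → L2R) : Prop :=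
  ∀ φ, IsTest T φ → (∫ t in Ioo 0 T, inner ℂ (slice (freeOp φ) t) (V t)) +
    Complex.I * σ * ∫ t in Ioo 0 T, inner ℂ (slice φ t) (nlDiff a α σ t (V t)) = 0

theorem source_primitive (W : ℝ → L2R) (t : ℝ) :
    ∫ r in Iic t, source a α σ T W r = ∫ r in Ioc 0 t, source a α σ T W r :=
  setIntegral_eq_of_subset_of_forall_sdiff_eq_zero measurableSet_Iic Ioc_subset_Iic_self
    fun _ hx => indicator_of_notMem (fun h => hx.2 ⟨h.1, hx.1⟩) _

/-- In the interaction picture the solution is u₀ plus the primitive of its source, and the pulled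
back test function has derivative equal to the pull back of φ_t - iφ_ss. Integrating by parts leaves
no boundary terms, as φ vanishes at times 0 and T. -/
theorem IsMild.isWeak {u₀ : L2R} {W : ℝ → L2R} (hW : IsMild a α σ T u₀ W) (hT : 0 < T) :
    IsWeak a α σ T W := by
  intro φ hφ
  have hψ : ∀ r, HasDerivAt (fun r => freeProp (-r) (slice φ r))
      (freeProp (-r) (slice (freeOp φ) r)) r := hφ.hasDerivAt_freeProp_slice
  have hfp : ∀ {f : ℝ → L2R}, Continuous f → Continuous fun r => freeProp (-r) (f r) := fun {f} hf =>
    Continuous.comp (g := fun p : ℝ × L2R => freeProp p.1 p.2)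
      (f := fun r => (-r, f r)) continuous_freeProp (continuous_neg.prodMk hf)
  have hψ' : Continuous fun r => freeProp (-r) (slice (freeOp φ) r) :=
    hfp hφ.freeOp.continuous_slice
  have hK := hW.integrable.integrableOn (s := Ioc 0 T)
  have hP : Continuous fun r => ∫ x in Ioc 0 r, source a α σ T W x := by
    simp only [← source_primitive]
    exact continuous_setIntegral_Iic hW.integrable
  have h0 : slice φ 0 = 0 := hφ.slice_eq_zero (by simp)
  have h1 : slice φ T = 0 := hφ.slice_eq_zero (by simp)
  have e1 := integral_inner_deriv hψ hψ' hK
  have e2 : ∫ r in Ioc 0 T, inner ℂ (freeProp (-r) (slice (freeOp φ) r)) u₀ = 0 := by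
    rw [← intervalIntegral.integral_of_le hT.le,
      intervalIntegral.integral_eq_sub_of_hasDerivAt
        (f := fun r => inner ℂ (freeProp (-r) (slice φ r)) u₀) (fun r _ => ?_)
        ((hψ'.inner continuous_const).intervalIntegrable _ _)]
    · simp [h0, h1]
    · simpa using (hψ r).inner ℂ (hasDerivAt_const r u₀)
  rw [h1, map_zero, inner_zero_left, zero_sub] at e1
  have e3 : ∫ r in Ioc 0 T, inner ℂ (slice (freeOp φ) r) (W r) =
      ∫ r in Ioc 0 T, (inner ℂ (freeProp (-r) (slice (freeOp φ) r)) u₀ +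
        inner ℂ (freeProp (-r) (slice (freeOp φ) r)) (∫ x in Ioc 0 r, source a α σ T W x)) := by
    congr 1; ext r
    rw [← inner_add_right, inner_freeProp_neg, ← source_primitive, ← hW.eq]
  have e4 : ∫ r in Ioc 0 T, inner ℂ (freeProp (-r) (slice φ r)) (source a α σ T W r) =
      ∫ r in Ioc 0 T, Complex.I * σ * inner ℂ (slice φ r) (nlDiff a α σ r (W r)) := by
    refine setIntegral_congr_fun measurableSet_Ioc fun r hr => ?_
    simp only [source]
    rw [indicator_of_mem hr, inner_smul_right, LinearIsometry.inner_map_map]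
  rw [integral_add (hψ'.inner continuous_const).integrableOn_Ioc (hψ'.inner hP).integrableOn_Ioc,
    e2, e1, zero_add, e4, integral_const_mul] at e3
  rw [← integral_Ioc_eq_integral_Ioo, ← integral_Ioc_eq_integral_Ioo, e3]
  exact neg_add_cancel _

end WeakForm

/-! ### Integrals over the strip as integrals of L² inner products -/

section Pairing

open scoped ENNReal ComplexConjugate

variable {T : ℝ} {φ : ℝ × ℝ → ℂ}

/-- Pairing with a test function is an integral of `L²` inner products. -/
theorem IsTest.integral_mul_eq (hφ : IsTest T φ) {g : ℝ → ℝ → ℂ} {G : ℝ → L2R}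
    (hG : ∀ᵐ t ∂(volume.restrict (Ioo 0 T)), g t =ᵐ[volume] G t)
    (hi : Integrable fun p : ℝ × ℝ => g p.1 p.2 * φ p) :
    ∫ p : ℝ × ℝ, g p.1 p.2 * φ p =
      ∫ t in Ioo 0 T, inner ℂ (slice (fun p => conj (φ p)) t) (G t) := by
  have h1 : ∫ p : ℝ × ℝ, g p.1 p.2 * φ p = ∫ t, ∫ s, g t s * φ (t, s) := by
    rw [Measure.volume_eq_prod] at hi ⊢
    exact integral_prod _ hi
  rw [h1, ← setIntegral_eq_integral_of_forall_compl_eq_zero (s := Ioo 0 T) fun t ht => by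
    simp [hφ.eq_zero ht]]
  refine integral_congr_ae ?_
  filter_upwards [hG] with t ht
  rw [hφ.conj.inner_slice]
  refine integral_congr_ae ?_
  filter_upwards [ht] with s hs
  rw [hs, Complex.conj_conj]

theorem IsTest.integrable_mul_of_locallyIntegrableOn (hφ : IsTest T φ) {g : ℝ × ℝ → ℂ}
    (hg : LocallyIntegrableOn g (Ioo 0 T ×ˢ univ)) : Integrable fun p => g p * φ p := by
  obtain ⟨C, hC⟩ := hφ.compact.exists_bound_of_continuous hφ.smooth.continuous
  have h1 : IntegrableOn g (tsupport φ) :=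
    hg.integrableOn_compact_subset hφ.support hφ.compact
  have h2 : IntegrableOn (fun p => g p * φ p) (tsupport φ) :=
    Integrable.mul_bdd (c := C) h1 hφ.smooth.continuous.aestronglyMeasurable
      (Eventually.of_forall hC)
  rw [← integrableOn_univ]
  refine h2.of_forall_sdiff_eq_zero MeasurableSet.univ fun p hp => ?_
  rw [image_eq_zero_of_notMem_tsupport hp.2, mul_zero]

/-- Functions in `L¹((0,T), L²(ℝ))` are locally integrable. -/
theorem locallyIntegrableOn_of_lintegral {g : ℝ → ℝ → ℂ} {G : ℝ → L2R}
    (hg : AEStronglyMeasurable (fun p : ℝ × ℝ => g p.1 p.2) (volume.restrict (Ioo 0 T ×ˢ univ)))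
    (hG : ∀ᵐ t ∂(volume.restrict (Ioo 0 T)), g t =ᵐ[volume] G t)
    (hfin : ∫⁻ t in Ioo 0 T, ‖G t‖ₑ < ⊤) :
    LocallyIntegrableOn (fun p : ℝ × ℝ => g p.1 p.2) (Ioo 0 T ×ˢ univ) := by
  intro x hx
  set R := |x.2| + 1
  have hmem : Ioo 0 T ×ˢ Icc (-R) R ∈ 𝓝[Ioo 0 T ×ˢ univ] x := by
    have h1 : (univ : Set ℝ) ×ˢ Ioo (-R) R ∈ 𝓝 x := by
      refine (isOpen_univ.prod isOpen_Ioo).mem_nhds ⟨mem_univ _, ?_⟩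
      exact abs_lt.1 (lt_add_one _)
    filter_upwards [mem_nhdsWithin_of_mem_nhds h1, self_mem_nhdsWithin] with p hp hp'
    exact ⟨hp'.1, Ioo_subset_Icc_self hp.2⟩
  refine ⟨_, hmem, ?_⟩
  have hm : AEStronglyMeasurable (fun p : ℝ × ℝ => g p.1 p.2)
      ((volume.restrict (Ioo 0 T)).prod (volume.restrict (Icc (-R) R))) := by
    rw [Measure.prod_restrict, ← Measure.volume_eq_prod]
    exact hg.mono_set (prod_mono_right (subset_univ _))
  rw [IntegrableOn, Measure.volume_eq_prod, ← Measure.prod_restrict]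
  refine ⟨hm, ?_⟩
  rw [HasFiniteIntegral, lintegral_prod _ hm.enorm]
  -- On the bounded interval [-R, R] the L¹ norm is controlled by the L² norm, with a constant that
  -- does not depend on t.
  have hb : ∀ᵐ t ∂(volume.restrict (Ioo 0 T)), ∫⁻ s in Icc (-R) R, ‖g t s‖ₑ ≤
      ‖G t‖ₑ * (volume.restrict (Icc (-R) R)) univ ^ (1 / (1 : ℝ≥0∞).toReal - 1 / (2 : ℝ≥0∞).toReal) := by
    filter_upwards [hG] with t ht
    have h1 : ∫⁻ s in Icc (-R) R, ‖g t s‖ₑ = eLpNorm (G t) 1 (volume.restrict (Icc (-R) R)) := by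
      rw [eLpNorm_one_eq_lintegral_enorm]
      refine lintegral_congr_ae ?_
      filter_upwards [ae_restrict_of_ae ht] with s hs
      rw [hs]
    rw [h1]
    refine (eLpNorm_le_eLpNorm_mul_rpow_measure_univ (p := 1) (q := 2) one_le_two
      (Lp.aestronglyMeasurable (G t)).restrict).trans ?_
    gcongr
    rw [Lp.enorm_def]
    exact eLpNorm_mono_measure _ Measure.restrict_le_self
  refine (lintegral_mono_ae hb).trans_lt ?_
  rw [lintegral_mul_const' _ _ (ENNReal.rpow_ne_top_of_nonneg (by norm_num) (by simp))]
  exact ENNReal.mul_lt_top hfin (ENNReal.rpow_lt_top_of_nonneg (by norm_num) (by simp))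

theorem IsTest.timeDeriv_conj (hφ : IsTest T φ) (p : ℝ × ℝ) :
    DiracNLS.timeDeriv (fun p => conj (φ p)) p = conj (DiracNLS.timeDeriv φ p) :=
  (hφ.conj.hasDerivAt_time p.1 p.2).unique (hφ.hasDerivAt_time p.1 p.2).star

theorem IsTest.spaceDeriv_conj (hφ : IsTest T φ) (p : ℝ × ℝ) :
    DiracNLS.spaceDeriv (fun p => conj (φ p)) p = conj (DiracNLS.spaceDeriv φ p) :=
  (hφ.conj.hasDerivAt_space p.1 p.2).unique (hφ.hasDerivAt_space p.1 p.2).star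

end Pairing

/-! ### Equation and initial data for perturbations of the explicit solution -/

section Equation

open scoped ENNReal ComplexConjugate

variable {a : ℂ} {α σ T : ℝ}

theorem integrable_diracSol_mul (hα₂ : α < 2) :
    LocallyIntegrableOn (fun p : ℝ × ℝ => diracSol a α σ p.1 p.2) (Ioo 0 T ×ˢ univ) ∧
    LocallyIntegrableOn (fun p : ℝ × ℝ => powerNL α (diracSol a α σ p.1 p.2))
      (Ioo 0 T ×ˢ univ) := by
  have hsub : Ioo (0 : ℝ) T ×ˢ (univ : Set ℝ) ⊆ Ioi 0 ×ˢ univ :=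
    prod_mono Ioo_subset_Ioi_self subset_rfl
  have hm : MeasurableSet (Ioo (0 : ℝ) T ×ˢ (univ : Set ℝ)) := measurableSet_Ioo.prod .univ
  exact ⟨((continuousOn_diracSol hα₂).mono hsub).locallyIntegrableOn hm,
    ((continuousOn_powerNL_diracSol hα₂).mono hsub).locallyIntegrableOn hm⟩

/-- The tested equation for `u` is the tested equation for `u - u_{a,σα}` in `L²`. -/
theorem integral_equation_eq (hα₀ : 0 ≤ α) (hα₂ : α < 2) {u : ℝ → ℝ → ℂ} {V : ℝ → L2R}
    (hu : LocallyIntegrableOn (fun p : ℝ × ℝ => u p.1 p.2) (Ioo 0 T ×ˢ univ))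
    (hFu : LocallyIntegrableOn (fun p : ℝ × ℝ => powerNL α (u p.1 p.2)) (Ioo 0 T ×ˢ univ))
    (hV : ∀ᵐ t ∂(volume.restrict (Ioo 0 T)), (fun s => u t s - diracSol a α σ t s) =ᵐ[volume] V t)
    (hVs : ∀ᵐ t ∂(volume.restrict (Ioo 0 T)), supNorm (V t) ≠ ⊤) {φ : ℝ × ℝ → ℂ}
    (hφ : IsTest T φ) :
    ∫ p : ℝ × ℝ, (u p.1 p.2 * (-Complex.I * deriv (fun t => φ (t, p.2)) p.1
          + iteratedDeriv 2 (fun s => φ (p.1, s)) p.2)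
        + (σ : ℂ) * powerNL α (u p.1 p.2) * φ p) =
      -Complex.I * ((∫ t in Ioo 0 T, inner ℂ (slice (freeOp fun p => conj (φ p)) t) (V t)) +
        Complex.I * σ * ∫ t in Ioo 0 T,
          inner ℂ (slice (fun p => conj (φ p)) t) (nlDiff a α σ t (V t))) := by
  obtain ⟨hd, hFd⟩ := integrable_diracSol_mul (a := a) (α := α) (σ := σ) (T := T) hα₂
  set χ : ℝ × ℝ → ℂ := fun p => -Complex.I * timeDeriv φ p + spaceDeriv (spaceDeriv φ) p with hχd
  have hχ : IsTest T χ := (hφ.timeDeriv.const_mul _).add hφ.spaceDeriv.spaceDeriv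
  have hN : ∀ᵐ t ∂(volume.restrict (Ioo 0 T)), (fun s => powerNL α (u t s) -
      powerNL α (diracSol a α σ t s)) =ᵐ[volume] nlDiff a α σ t (V t) := by
    filter_upwards [hV, hVs] with t h1 h2
    filter_upwards [h1, coeFn_toL2 (memLp_nlDiff (a := a) (σ := σ) (t := t) hα₀ hα₂.le h2)]
      with s h3 h4
    rw [nlDiff, h4, ← h3]
    simp
  have i1 : Integrable fun p : ℝ × ℝ => (u p.1 p.2 - diracSol a α σ p.1 p.2) * χ p :=
    hχ.integrable_mul_of_locallyIntegrableOn (hu.sub hd)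
  have i2 : Integrable fun p : ℝ × ℝ =>
      (powerNL α (u p.1 p.2) - powerNL α (diracSol a α σ p.1 p.2)) * φ p :=
    hφ.integrable_mul_of_locallyIntegrableOn (hFu.sub hFd)
  have i3 : Integrable fun p : ℝ × ℝ => diracSol a α σ p.1 p.2 * χ p +
      σ * powerNL α (diracSol a α σ p.1 p.2) * φ p := by
    refine (hχ.integrable_mul_of_locallyIntegrableOn hd).add ?_
    simp only [mul_assoc]
    exact (hφ.integrable_mul_of_locallyIntegrableOn hFd).const_mul _
  have e1 := hχ.integral_mul_eq (g := fun t s => u t s - diracSol a α σ t s) hV i1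
  have e2 := hφ.integral_mul_eq
    (g := fun t s => powerNL α (u t s) - powerNL α (diracSol a α σ t s)) hN i2
  have e3 := integral_diracSol (a := a) (σ := σ) hα₂ hφ
  -- The inner product is conjugate linear on the left, so test functions enter conjugated; the
  -- conjugate of -iφ_t + φ_ss is i times `freeOp` of the conjugate of φ.
  have hsl : ∀ t, slice (fun p => conj (χ p)) t =
      Complex.I • slice (freeOp fun p => conj (φ p)) t := by
    intro t
    rw [slice, slice, ← toL2_const_mul _ (hφ.conj.freeOp.memLp_slice t)]
    congr 1; ext s
    have h1 : spaceDeriv (fun p => conj (φ p)) = fun p => conj (spaceDeriv φ p) :=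
      funext hφ.spaceDeriv_conj
    simp only [hχd, freeOp, hφ.timeDeriv_conj, h1, hφ.spaceDeriv.spaceDeriv_conj, map_add, map_mul,
      map_neg, Complex.conj_I]
    linear_combination (conj (spaceDeriv (spaceDeriv φ) (t, s))) * Complex.I_sq
  simp only [hsl, inner_smul_left, Complex.conj_I] at e1
  rw [integral_const_mul] at e1
  calc _ = ∫ p : ℝ × ℝ, (1 * ((u p.1 p.2 - diracSol a α σ p.1 p.2) * χ p) +
        (diracSol a α σ p.1 p.2 * χ p + σ * powerNL α (diracSol a α σ p.1 p.2) * φ p) +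
        σ * ((powerNL α (u p.1 p.2) - powerNL α (diracSol a α σ p.1 p.2)) * φ p)) := by
        congr 1; ext p
        rw [hφ.deriv_time, hφ.iteratedDeriv_space]
        simp only [hχd]
        ring
    _ = _ := by
        rw [integral_linear_comb i1 i3 i2, e1, e2, e3]
        linear_combination (σ * ∫ t in Ioo 0 T,
          inner ℂ (slice (fun p => conj (φ p)) t) (nlDiff a α σ t (V t))) * Complex.I_sq

theorem memLp_conj (φ : 𝓢(ℝ, ℂ)) : MemLp (fun s => conj (φ s)) 2 volume :=
  (φ.memLp 2).of_le (f := fun s => conj (φ s))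
    (Complex.continuous_conj.comp φ.continuous).aestronglyMeasurable
    (Eventually.of_forall fun s => by rw [RCLike.norm_conj])

theorem integral_mul_schwartz (g : L2R) (φ : 𝓢(ℝ, ℂ)) :
    ∫ s, g s * φ s = inner ℂ (toL2 fun s => conj (φ s)) g := by
  rw [inner_toL2 (memLp_conj φ)]
  simp only [Complex.conj_conj]

/-- The initial data of perturbations of the explicit solution. -/
theorem tendsto_integral_perturbation (hα₂ : α < 2) (hT : 0 < T) {u : ℝ → ℝ → ℂ} {V : ℝ → L2R}
    (hVc : ContinuousOn V (Ico 0 T))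
    (hV : ∀ t ∈ Ioo 0 T, (fun s => u t s - diracSol a α σ t s) =ᵐ[volume] V t) (φ : 𝓢(ℝ, ℂ)) :
    Tendsto (fun t : ℝ => ∫ s, u t s * φ s) (𝓝[>] 0)
      (𝓝 ((∫ s, V 0 s * φ s) + a * diracMass * φ 0)) := by
  have h1 : Tendsto V (𝓝[>] 0) (𝓝 (V 0)) := by
    refine (hVc 0 ⟨le_rfl, hT⟩).tendsto.mono_left ?_
    rw [← nhdsWithin_Ioo_eq_nhdsGT hT]
    exact nhdsWithin_mono _ Ioo_subset_Ico_self
  have h2 : Tendsto (fun t => ∫ s, V t s * φ s) (𝓝[>] 0) (𝓝 (∫ s, V 0 s * φ s)) := by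
    simp only [integral_mul_schwartz]
    exact tendsto_const_nhds.inner h1
  refine (h2.add (tendsto_diracSol a σ hα₂ φ)).congr' ?_
  filter_upwards [Ioo_mem_nhdsGT hT] with t ht
  have i1 : Integrable fun s => V t s * φ s := by
    have := (Lp.memLp (V t)).integrable_mul (φ.memLp 2)
    exact this
  have i2 : Integrable fun s => diracSol a α σ t s * φ s := by
    refine Integrable.bdd_mul (c := ‖a‖ / √t) φ.integrable ?_
      (Eventually.of_forall fun s => (norm_diracSol a α σ t s).le)
    exact ((measurable_diracSol a α σ).comp (measurable_const.prodMk measurable_id)).aestronglyMeasurable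
  rw [← integral_add i1 i2]
  refine integral_congr_ae ?_
  filter_upwards [hV t ht] with s hs
  rw [← hs]
  ring

/-- A solution of the Duhamel equation gives a solution of the equation. -/
theorem IsMild.exists_isPerturbedSolution {u₀ : L2R} {W : ℝ → L2R} (hW : IsMild a α σ T u₀ W)
    (hα₀ : 0 ≤ α) (hα₂ : α < 2) (hσ : σ = 1 ∨ σ = -1) (hT : 0 < T) :
    ∃ u, IsPerturbedSolution α σ a u₀ T u ∧
      ∀ t, (fun s => u t s - diracSol a α σ t s) =ᵐ[volume] W t := by
  -- A curve of classes does not define a measurable function of (t, s), so the solution is built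
  -- from a jointly measurable representative.
  obtain ⟨w, hw, hwW⟩ := exists_measurable_rep hW.cont.measurable
  obtain ⟨hd, hFd⟩ := integrable_diracSol_mul (a := a) (α := α) (σ := σ) (T := T) hα₂
  have hdm := measurable_diracSol a α σ
  have hsub : ∀ t s, diracSol a α σ t s + w t s - diracSol a α σ t s = w t s := fun t s =>
    add_sub_cancel_left _ _
  have hae : ∀ t, (fun s => diracSol a α σ t s + w t s - diracSol a α σ t s) =ᵐ[volume] W t := by
    simpa only [hsub] using hwW
  have hs : ∀ᵐ t ∂(volume.restrict (Ioo 0 T)), supNorm (W t) ≠ ⊤ :=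
    ae_restrict_of_ae (ae_supNorm_ne_top hW.cont.measurable.aemeasurable hW.supNorm_lt.ne)
  have hWfin : ∫⁻ t in Ioo 0 T, ‖W t‖ₑ < ⊤ := by
    have : IntegrableOn W (Ioo 0 T) := hW.cont.integrableOn_Icc.mono_set Ioo_subset_Icc_self
    exact this.2
  have hNfin : ∫⁻ t in Ioo 0 T, ‖nlDiff a α σ t (W t)‖ₑ < ⊤ := by
    refine lt_of_le_of_lt ?_ (hW.integrable.integrableOn (s := Ioo 0 T)).2
    refine le_of_eq (setLIntegral_congr_fun measurableSet_Ioo fun r hr => ?_)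
    simp only [source]
    rw [indicator_of_mem (show r ∈ Ioc 0 T from ⟨hr.1, hr.2.le⟩), enorm_smul, enorm_sign hσ, one_mul, ← ofReal_norm,
      ← ofReal_norm, LinearIsometry.norm_map]
  have hlw := locallyIntegrableOn_of_lintegral (T := T) hw.aestronglyMeasurable
    (Eventually.of_forall hwW) hWfin
  have hN : ∀ᵐ t ∂(volume.restrict (Ioo 0 T)), (fun s => powerNL α (diracSol a α σ t s + w t s) -
      powerNL α (diracSol a α σ t s)) =ᵐ[volume] nlDiff a α σ t (W t) := by
    filter_upwards [hs] with t h2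
    filter_upwards [hwW t, coeFn_toL2 (memLp_nlDiff (a := a) (σ := σ) (t := t) hα₀ hα₂.le h2)]
      with s h3 h4
    rw [nlDiff, h4, h3]
  have hlN := locallyIntegrableOn_of_lintegral (T := T)
    (g := fun t s => powerNL α (diracSol a α σ t s + w t s) - powerNL α (diracSol a α σ t s))
    (((measurable_powerNL α).comp (hdm.add hw)).sub
      ((measurable_powerNL α).comp hdm)).aestronglyMeasurable hN hNfin
  have hlu : LocallyIntegrableOn (fun p : ℝ × ℝ => diracSol a α σ p.1 p.2 + w p.1 p.2)
      (Ioo 0 T ×ˢ univ) := hd.add hlw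
  have hlF : LocallyIntegrableOn (fun p : ℝ × ℝ => powerNL α (diracSol a α σ p.1 p.2 + w p.1 p.2))
      (Ioo 0 T ×ˢ univ) := by
    have h : (fun p : ℝ × ℝ => powerNL α (diracSol a α σ p.1 p.2 + w p.1 p.2)) =
        (fun p : ℝ × ℝ => powerNL α (diracSol a α σ p.1 p.2)) + fun p : ℝ × ℝ =>
          powerNL α (diracSol a α σ p.1 p.2 + w p.1 p.2) - powerNL α (diracSol a α σ p.1 p.2) := by
      funext p; simp
    rw [h]
    exact hFd.add hlN
  have hW0 : W 0 = u₀ := by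
    rw [hW.eq 0, source_primitive, Ioc_self, setIntegral_empty, add_zero, freeProp_zero]
  have heq : IsDistribSolution α σ T fun t s => diracSol a α σ t s + w t s := by
    refine ⟨hlu, hlF, fun φ h1 h2 h3 => ?_⟩
    have hφ : IsTest T φ := ⟨h1, h2, h3⟩
    rw [integral_equation_eq (u := fun t s => diracSol a α σ t s + w t s) hα₀ hα₂ hlu hlF
      (Eventually.of_forall hae) hs hφ, hW.isWeak hT _ hφ.conj, mul_zero]
  have hin : HasInitialData (fun t s => diracSol a α σ t s + w t s) u₀ (a * diracMass) := by
    intro φ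
    rw [← hW0]
    exact tendsto_integral_perturbation hα₂ hT hW.cont.continuousOn (fun t _ => hae t) φ
  have hL4 : MemL4Linfty T fun t s => diracSol a α σ t s + w t s - diracSol a α σ t s := by
    simp only [hsub]
    refine ⟨hw.aestronglyMeasurable, lt_of_le_of_lt ?_ hW.supNorm_lt⟩
    refine (le_of_eq ?_).trans (setLIntegral_le_lintegral (Ioo 0 T) _)
    refine lintegral_congr fun t => ?_
    rw [eLpNorm_congr_ae (hwW t), supNorm]
  have hC : MemCL2 T fun t s => diracSol a α σ t s + w t s - diracSol a α σ t s :=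
    ⟨W, hW.cont.continuousOn, fun t _ => hae t⟩
  exact ⟨_, ⟨heq, hin, hL4, hC⟩, hae⟩

end Equation

/-! ### The du Bois-Reymond lemma in time -/

section DuBoisReymond

open scoped ENNReal ComplexConjugate

variable {T : ℝ}

/-- Smooth functions with integral zero and compact support in an interval are derivatives of
functions of the same kind. -/
theorem exists_primitive {η : ℝ → ℝ} (hη : ContDiff ℝ ∞ η) (hc : HasCompactSupport η)
    (hs : tsupport η ⊆ Ioo 0 T) (h0 : ∫ t, η t = 0) :
    ∃ χ : ℝ → ℝ, ContDiff ℝ ∞ χ ∧ HasCompactSupport χ ∧ tsupport χ ⊆ Ioo 0 T ∧ deriv χ = η := by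
  have hi : Integrable η := hη.continuous.integrable_of_hasCompactSupport hc
  let χ : ℝ → ℝ := fun t => ∫ r in Iic t, η r
  have hd : ∀ t, HasDerivAt χ (η t) t := fun t => by
    have h1 : ∀ t, χ t = (∫ r in Iic 0, η r) + ∫ r in (0 : ℝ)..t, η r := fun t => by
      rw [intervalIntegral.integral_Iic_sub_Iic hi.integrableOn hi.integrableOn |>.symm]
      simp [χ]
    rw [funext h1]
    exact (intervalIntegral.integral_hasDerivAt_right
      (hη.continuous.intervalIntegrable _ _) hη.continuous.stronglyMeasurable.stronglyMeasurableAtFilter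
      hη.continuous.continuousAt).const_add _
  have hderiv : deriv χ = η := funext fun t => (hd t).deriv
  have hsm : ContDiff ℝ ∞ χ :=
    contDiff_infty_iff_deriv.2 ⟨fun t => (hd t).differentiableAt, hderiv ▸ hη⟩
  by_cases hne : (tsupport η).Nonempty
  swap
  · rw [not_nonempty_iff_eq_empty, tsupport_eq_empty_iff] at hne
    have : χ = 0 := funext fun t => by simp [χ, hne]
    exact ⟨χ, hsm, by rw [this]; exact HasCompactSupport.zero, by simp [this], hderiv⟩
  -- [a, b] is the convex hull of the support of η. The primitive vanishes before a trivially, and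
  -- after b because η has integral zero.
  obtain ⟨a, ha, hamin⟩ := hc.exists_isMinOn hne continuousOn_id
  obtain ⟨b, hb, hbmax⟩ := hc.exists_isMaxOn hne continuousOn_id
  have hsupp : Function.support χ ⊆ Icc a b := by
    intro t ht
    by_contra hcon
    refine ht ?_
    rcases lt_or_ge t a with h | h
    · refine setIntegral_eq_zero_of_forall_eq_zero fun r hr => ?_
      by_contra hr'
      exact (lt_irrefl a) (((hamin (subset_tsupport _ hr')).trans hr).trans_lt h)
    · have h' : b < t := by
        by_contra h'
        exact hcon ⟨h, not_lt.1 h'⟩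
      change ∫ r in Iic t, η r = 0
      rw [setIntegral_eq_integral_of_forall_compl_eq_zero fun r hr => ?_, h0]
      by_contra hr'
      exact hr ((hbmax (subset_tsupport _ hr')).trans h'.le)
  have hts : tsupport χ ⊆ Icc a b := closure_minimal hsupp isClosed_Icc
  exact ⟨χ, hsm, isCompact_Icc.of_isClosed_subset (isClosed_tsupport _) hts,
    hts.trans fun t ht => ⟨(hs ha).1.trans_le ht.1, ht.2.trans_lt (hs hb).2⟩, hderiv⟩

/-- A continuous function with vanishing weak derivative is constant. -/
theorem eq_of_weak_deriv_zero {f : ℝ → ℂ} (hf : ContinuousOn f (Icc 0 T)) (hT : 0 < T)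
    (h : ∀ χ : ℝ → ℝ, ContDiff ℝ ∞ χ → HasCompactSupport χ → tsupport χ ⊆ Ioo 0 T →
      ∫ t in Ioc 0 T, ((deriv χ t : ℝ) : ℂ) * f t = 0) {t : ℝ} (ht : t ∈ Icc 0 T) : f t = f 0 := by
  let B : ContDiffBump (T / 2) := ⟨T / 8, T / 4, by positivity, by linarith⟩
  let ρ : ℝ → ℝ := B.normed volume
  have hρ : ContDiff ℝ ∞ ρ := B.contDiff_normed
  have hρc : HasCompactSupport ρ := B.hasCompactSupport_normed
  have hρs : tsupport ρ ⊆ Ioo 0 T := by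
    rw [B.tsupport_normed_eq, Real.closedBall_eq_Icc]
    intro x hx
    simp only [B, mem_Icc] at hx
    constructor <;> linarith [hx.1, hx.2]
  have hρ1 : ∫ t, ρ t = 1 := B.integral_normed
  have hfi : IntegrableOn f (Icc 0 T) := hf.integrableOn_Icc
  have hfo : IntegrableOn f (Ioo 0 T) := hfi.mono_set Ioo_subset_Icc_self
  have hmul : ∀ {η : ℝ → ℝ}, Continuous η → HasCompactSupport η →
      IntegrableOn (fun t => (η t : ℂ) * f t) (Ioo 0 T) := fun {η} h1 h2 => by
    obtain ⟨C, hC⟩ := h2.exists_bound_of_continuous h1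
    exact Integrable.bdd_mul (c := C) hfo (Complex.continuous_ofReal.comp h1).aestronglyMeasurable
      (Eventually.of_forall fun t => by simpa using hC t)
  set c : ℂ := ∫ t in Ioo 0 T, (ρ t : ℂ) * f t with hc
  have key : ∀ η : ℝ → ℝ, ContDiff ℝ ∞ η → HasCompactSupport η → tsupport η ⊆ Ioo 0 T →
      ∫ t in Ioo 0 T, η t • (f t - c) = 0 := by
    intro η h1 h2 h3
    set m := ∫ t, η t
    have hi : Integrable η := h1.continuous.integrable_of_hasCompactSupport h2
    have hiρ : Integrable ρ := hρ.continuous.integrable_of_hasCompactSupport hρc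
    -- Subtracting m times the bump ρ of mass one produces integral zero, hence a derivative. The
    -- hypothesis then says that η sees f only through the constant c.
    obtain ⟨χ, c1, c2, c3, c4⟩ := exists_primitive (T := T) (η := fun t => η t + -m * ρ t)
      (h1.add (contDiff_const.mul hρ)) (h2.add hρc.mul_left)
      ((tsupport_add _ _).trans (union_subset h3 (tsupport_mul_subset_right.trans hρs)))
      (by rw [integral_add hi (hiρ.const_mul _), integral_const_mul, hρ1]; ring)
    have h4 := h χ c1 c2 c3
    rw [c4, integral_Ioc_eq_integral_Ioo] at h4
    have h5 : ∫ t in Ioo 0 T, (η t : ℂ) = m := by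
      rw [setIntegral_eq_integral_of_forall_compl_eq_zero fun t ht => ?_]
      · exact integral_ofReal
      have : η t = 0 := image_eq_zero_of_notMem_tsupport fun h => ht (h3 h)
      simp [this]
    have hi' : Integrable fun t => (η t : ℂ) := hi.ofReal
    calc ∫ t in Ioo 0 T, η t • (f t - c)
        = ∫ t in Ioo 0 T, ((η t : ℂ) * f t - c * (η t : ℂ)) := by
          congr 1; ext t; rw [Complex.real_smul]; ring
      _ = (∫ t in Ioo 0 T, (η t : ℂ) * f t) - c * m := by
          rw [integral_sub (hmul h1.continuous h2) (hi'.const_mul c).integrableOn,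
            integral_const_mul, h5]
      _ = ∫ t in Ioo 0 T, ((η t : ℂ) * f t + -m * ((ρ t : ℂ) * f t)) := by
          rw [integral_add (hmul h1.continuous h2) ((hmul hρ.continuous hρc).const_mul _),
            integral_const_mul, ← hc]
          ring
      _ = 0 := by
          rw [← h4]
          congr 1; ext t; push_cast; ring
  have hae := isOpen_Ioo.ae_eq_zero_of_integral_contDiff_smul_eq_zero
    (μ := volume) (U := Ioo 0 T) (f := fun t => f t - c)
    ((hfo.sub (integrableOn_const (by simp))).locallyIntegrableOn) fun η h1 h2 h3 => by
      rw [← setIntegral_eq_integral_of_forall_compl_eq_zero (s := Ioo 0 T) fun t ht => ?_]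
      · exact key η h1 h2 h3
      · have : η t = 0 := image_eq_zero_of_notMem_tsupport fun h => ht (h3 h)
        simp [this]
  have heq : EqOn f (fun _ => c) (Icc 0 T) := by
    have h1 : f =ᵐ[volume.restrict (Icc 0 T)] fun _ => c := by
      rw [← restrict_Ioo_eq_restrict_Icc]
      filter_upwards [(ae_restrict_iff' measurableSet_Ioo).2 hae] with t ht
      exact sub_eq_zero.1 ht
    exact Measure.eqOn_Icc_of_ae_eq volume hT.ne h1 hf continuousOn_const
  rw [heq ht, heq ⟨le_rfl, hT.le⟩]

/-- A continuous function with an integrable weak derivative is its primitive. -/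
theorem eq_add_integral_of_weak_deriv {d g : ℝ → ℂ} (hd : Continuous d) (hT : 0 < T)
    (hg : IntegrableOn g (Ioc 0 T))
    (h : ∀ χ : ℝ → ℝ, ContDiff ℝ ∞ χ → HasCompactSupport χ → tsupport χ ⊆ Ioo 0 T →
      (∫ t in Ioc 0 T, ((deriv χ t : ℝ) : ℂ) * d t) + ∫ t in Ioc 0 T, (χ t : ℂ) * g t = 0)
    {t : ℝ} (ht : t ∈ Icc 0 T) : d t = d 0 + ∫ r in Ioc 0 t, g r := by
  have hgI : IntegrableOn g (Icc 0 T) := (integrableOn_Icc_iff_integrableOn_Ioc (by simp)).2 hg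
  have hP : ContinuousOn (fun t => ∫ r in Ioc 0 t, g r) (Icc 0 T) :=
    intervalIntegral.continuousOn_primitive hgI
  have h1 := eq_of_weak_deriv_zero (f := fun t => d t - ∫ r in Ioc 0 t, g r)
    (hd.continuousOn.sub hP) hT (fun χ c1 c2 c3 => ?_) ht
  · simp only [Ioc_self, setIntegral_empty, sub_zero] at h1
    rw [← h1]; ring
  · have h0 : ∀ {t}, t ∉ Ioo 0 T → χ t = 0 := fun ht =>
      image_eq_zero_of_notMem_tsupport fun h => ht (c3 h)
    have hχd : ∀ r, HasDerivAt (fun r => (χ r : ℂ)) ((deriv χ r : ℝ) : ℂ) r := fun r =>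
      ((c1.differentiable (by simp)) r).hasDerivAt.ofReal_comp
    have hχ' : Continuous fun r => ((deriv χ r : ℝ) : ℂ) :=
      Complex.continuous_ofReal.comp (c1.continuous_deriv (by simp))
    have e := integral_inner_deriv hχd hχ' hg
    rw [h0 (by simp : T ∉ Ioo 0 T)] at e
    simp only [RCLike.inner_apply, Complex.conj_ofReal, Complex.ofReal_zero, map_zero, mul_zero,
      zero_sub, mul_comm _ (Complex.ofReal _)] at e
    have i1 : IntegrableOn (fun t => ((deriv χ t : ℝ) : ℂ) * d t) (Ioc 0 T) :=
      (hχ'.mul hd).integrableOn_Ioc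
    have i2 : IntegrableOn (fun t => ((deriv χ t : ℝ) : ℂ) * ∫ r in Ioc 0 t, g r) (Ioc 0 T) :=
      ((hχ'.continuousOn.mul hP).integrableOn_Icc).mono_set Ioc_subset_Icc_self
    simp only [mul_sub]
    rw [integral_sub i1 i2, e, sub_neg_eq_add]
    exact h χ c1 c2 c3

end DuBoisReymond

/-! ### The inhomogeneous equation in weak form, on the Fourier side -/

section WeakFree

open scoped ENNReal ComplexConjugate FourierTransform

variable {T : ℝ}

theorem isTest_mul {χ : ℝ → ℝ} {ψ : ℝ → ℂ} (c1 : ContDiff ℝ ∞ χ) (c2 : HasCompactSupport χ)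
    (c3 : tsupport χ ⊆ Ioo 0 T) (h1 : ContDiff ℝ ∞ ψ) (h2 : HasCompactSupport ψ) :
    IsTest T fun p => (χ p.1 : ℂ) * ψ p.2 := by
  have hs : tsupport (fun p : ℝ × ℝ => (χ p.1 : ℂ) * ψ p.2) ⊆ tsupport χ ×ˢ tsupport ψ := by
    refine closure_minimal (fun p hp => ⟨subset_tsupport _ fun h => hp ?_,
      subset_tsupport _ fun h => hp ?_⟩) ((isClosed_tsupport _).prod (isClosed_tsupport _))
    · simp [h]
    · simp [h]
  exact ⟨(Complex.ofRealCLM.contDiff.comp (c1.comp contDiff_fst)).mul (h1.comp contDiff_snd),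
    (c2.prod h2).of_isClosed_subset (isClosed_tsupport _) hs, hs.trans fun p hp => ⟨c3 hp.1, trivial⟩⟩

theorem freeOp_mul {χ : ℝ → ℝ} {ψ : ℝ → ℂ} (c1 : ContDiff ℝ ∞ χ) (c2 : HasCompactSupport χ)
    (c3 : tsupport χ ⊆ Ioo 0 T) (h1 : ContDiff ℝ ∞ ψ) (h2 : HasCompactSupport ψ) (p : ℝ × ℝ) :
    freeOp (fun p => (χ p.1 : ℂ) * ψ p.2) p = ((deriv χ p.1 : ℝ) : ℂ) * ψ p.2 +
      -Complex.I * (χ p.1 * deriv (deriv ψ) p.2) := by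
  have hsp : ∀ {ψ : ℝ → ℂ}, ContDiff ℝ ∞ ψ → HasCompactSupport ψ →
      spaceDeriv (fun p => (χ p.1 : ℂ) * ψ p.2) = fun p => (χ p.1 : ℂ) * deriv ψ p.2 :=
    fun {ψ} h1 h2 => funext fun p =>
      ((isTest_mul c1 c2 c3 h1 h2).hasDerivAt_space p.1 p.2).unique
        (((h1.differentiable (by simp)) p.2).hasDerivAt.const_mul (χ p.1 : ℂ))
  have htm : timeDeriv (fun p => (χ p.1 : ℂ) * ψ p.2) p = ((deriv χ p.1 : ℝ) : ℂ) * ψ p.2 :=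
    ((isTest_mul c1 c2 c3 h1 h2).hasDerivAt_time p.1 p.2).unique
      (((c1.differentiable (by simp)) p.1).hasDerivAt.ofReal_comp.mul_const (ψ p.2))
  rw [freeOp, htm, hsp h1 h2, hsp (contDiff_infty_iff_deriv.1 h1).2 h2.deriv]

/-- The inhomogeneous Schrödinger equation `i D_t + D_ss = i N`, tested in `L²`. -/
def IsWeakFree (T : ℝ) (D N : ℝ → L2R) : Prop :=
  ∀ φ, IsTest T φ → (∫ t in Ioo 0 T, inner ℂ (slice (freeOp φ) t) (D t)) +
    ∫ t in Ioo 0 T, inner ℂ (slice φ t) (N t) = 0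

variable {D N : ℝ → L2R}

/-- Testing with products χ(t)ψ(s) shows that the weak derivative of ⟨ψ, D⟩ is i⟨ψ'', D⟩ + ⟨ψ, N⟩;
du Bois-Reymond integrates this in time. -/
theorem IsWeakFree.inner_eq (h : IsWeakFree T D N) (hT : 0 < T) (hD : Continuous D)
    (hN : IntegrableOn N (Ioc 0 T)) {ψ : ℝ → ℂ} (h1 : ContDiff ℝ ∞ ψ) (h2 : HasCompactSupport ψ)
    {t : ℝ} (ht : t ∈ Icc 0 T) :
    inner ℂ (toL2 ψ) (D t - D 0 - ∫ r in Ioc 0 t, N r) =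
      Complex.I * inner ℂ (toL2 (deriv (deriv ψ))) (∫ r in Ioc 0 t, D r) := by
  have h3 : MemLp ψ 2 volume := h1.continuous.memLp_of_hasCompactSupport h2
  have h4 : MemLp (deriv (deriv ψ)) 2 volume :=
    (contDiff_infty_iff_deriv.1 (contDiff_infty_iff_deriv.1 h1).2).2.continuous
      |>.memLp_of_hasCompactSupport h2.deriv.deriv
  have hDi : ∀ {t}, IntegrableOn D (Ioc 0 t) := hD.integrableOn_Ioc
  have hg : IntegrableOn (fun r => Complex.I * inner ℂ (toL2 (deriv (deriv ψ))) (D r) +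
      inner ℂ (toL2 ψ) (N r)) (Ioc 0 T) :=
    ((hDi.const_inner _).const_mul _).add (hN.const_inner _)
  have key := eq_add_integral_of_weak_deriv (d := fun t => inner ℂ (toL2 ψ) (D t))
    (continuous_const.inner hD) hT hg (fun χ c1 c2 c3 => ?_) ht
  · have hNt := hN.mono_set (Ioc_subset_Ioc_right ht.2)
    rw [integral_add ((hDi.const_inner _).const_mul _) (hNt.const_inner _), integral_const_mul,
      integral_inner hDi, integral_inner hNt] at key
    rw [inner_sub_right, inner_sub_right, key]
    ring
  · have hφ := h _ (isTest_mul c1 c2 c3 h1 h2)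
    have e1 : ∀ t, slice (freeOp fun p => (χ p.1 : ℂ) * ψ p.2) t =
        ((deriv χ t : ℝ) : ℂ) • toL2 ψ + (-Complex.I * χ t) • toL2 (deriv (deriv ψ)) := fun t => by
      rw [slice, ← toL2_const_mul _ h3, ← toL2_const_mul _ h4,
        ← toL2_add (h3.const_mul _) (h4.const_mul _)]
      congr 1; ext s
      rw [freeOp_mul c1 c2 c3 h1 h2, mul_assoc]
    have e2 : ∀ t, slice (fun p => (χ p.1 : ℂ) * ψ p.2) t = (χ t : ℂ) • toL2 ψ := fun t => by
      rw [slice, ← toL2_const_mul _ h3]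
    simp only [e1, e2, inner_add_left, inner_smul_left, Complex.conj_ofReal, map_mul, map_neg,
      Complex.conj_I, neg_neg, ← integral_Ioc_eq_integral_Ioo] at hφ
    have hχ : Continuous fun t => (χ t : ℂ) := Complex.continuous_ofReal.comp c1.continuous
    have hχ' : Continuous fun t => ((deriv χ t : ℝ) : ℂ) :=
      Complex.continuous_ofReal.comp (c1.continuous_deriv (by simp))
    have i1 : IntegrableOn (fun t => ((deriv χ t : ℝ) : ℂ) * inner ℂ (toL2 ψ) (D t)) (Ioc 0 T) :=
      (hχ'.mul (continuous_const.inner hD)).integrableOn_Ioc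
    have i2 : IntegrableOn (fun t => Complex.I * (χ t : ℂ) *
        inner ℂ (toL2 (deriv (deriv ψ))) (D t)) (Ioc 0 T) :=
      ((continuous_const.mul hχ).mul (continuous_const.inner hD)).integrableOn_Ioc
    have i3 : IntegrableOn (fun t => (χ t : ℂ) * inner ℂ (toL2 ψ) (N t)) (Ioc 0 T) := by
      obtain ⟨C, hC⟩ := c2.exists_bound_of_continuous c1.continuous
      exact Integrable.bdd_mul (c := C) (hN.const_inner _) hχ.aestronglyMeasurable
        (Eventually.of_forall fun t => by simpa using hC t)
    rw [integral_add i1 i2, add_assoc, ← integral_add i2 i3] at hφ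
    rw [← hφ]
    congr 2; ext t; ring

/-- Cutoffs of Schwartz functions converge together with their second derivatives. -/
theorem exists_cutoff (f : 𝓢(ℝ, ℂ)) : ∃ ψ : ℕ → ℝ → ℂ,
    (∀ n, ContDiff ℝ ∞ (ψ n)) ∧ (∀ n, HasCompactSupport (ψ n)) ∧
    Tendsto (fun n => toL2 (ψ n)) atTop (𝓝 (toL2 f)) ∧
    Tendsto (fun n => toL2 (deriv (deriv (ψ n)))) atTop (𝓝 (toL2 (secondDeriv f))) := by
  let B : ContDiffBump (0 : ℝ) := ⟨1, 2, one_pos, one_lt_two⟩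
  let e : ℝ → ℂ := fun s => (B s : ℂ)
  have he : ContDiff ℝ ∞ e := Complex.ofRealCLM.contDiff.comp B.contDiff
  have hec : HasCompactSupport e := B.hasCompactSupport.comp_left Complex.ofReal_zero
  have he0 : e 0 = 1 := by
    simp only [e]; rw [B.one_of_mem_closedBall (by simp [B])]; simp
  have he' := (contDiff_infty_iff_deriv.1 he).2
  have he'' := (contDiff_infty_iff_deriv.1 he').2
  obtain ⟨C₀, hC₀⟩ := hec.exists_bound_of_continuous he.continuous
  obtain ⟨C₁, hC₁⟩ := hec.deriv.exists_bound_of_continuous he'.continuous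
  obtain ⟨C₂, hC₂⟩ := hec.deriv.deriv.exists_bound_of_continuous he''.continuous
  have h₁ := (norm_nonneg _).trans (hC₁ 0)
  have h₂ := (norm_nonneg _).trans (hC₂ 0)
  -- The cutoff is e(ε s) with ε = 1/(n+1): each derivative falling on it brings a factor ε, so only
  -- the term with f'' survives in the limit.
  let ε : ℕ → ℝ := fun n => 1 / ((n : ℝ) + 1)
  have hε : ∀ n, 0 < ε n := fun n => by positivity
  have hε1 : ∀ n, ε n ≤ 1 := fun n => by
    rw [div_le_one (by positivity)]; linarith [(Nat.cast_nonneg n : (0 : ℝ) ≤ n)]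
  have hε0 : Tendsto ε atTop (𝓝 0) := tendsto_one_div_add_atTop_nhds_zero_nat
  let f₁ : 𝓢(ℝ, ℂ) := SchwartzMap.derivCLM ℂ ℂ f
  have hf : ∀ s, HasDerivAt f (f₁ s) s := fun s => by
    rw [show f₁ s = deriv f s from SchwartzMap.derivCLM_apply ℂ f s]
    exact f.differentiableAt.hasDerivAt
  have hf₁ : ∀ s, HasDerivAt f₁ (secondDeriv f s) s := fun s => by
    rw [show secondDeriv f s = deriv f₁ s from SchwartzMap.derivCLM_apply ℂ f₁ s]
    exact f₁.differentiableAt.hasDerivAt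
  have hsc : ∀ {g : ℝ → ℂ}, ContDiff ℝ ∞ g → ∀ n s,
      HasDerivAt (fun s => g (ε n * s)) (ε n * deriv g (ε n * s)) s := fun {g} hg n s => by
    have h := HasDerivAt.scomp s ((hg.differentiable (by simp)) (ε n * s)).hasDerivAt
      ((hasDerivAt_id s).const_mul (ε n))
    simpa [Function.comp_def] using h
  have hd1 : ∀ n, deriv (fun s => e (ε n * s) * f s) =
      fun s => ε n * deriv e (ε n * s) * f s + e (ε n * s) * f₁ s := fun n =>
    funext fun s => ((hsc he n s).mul (hf s)).deriv
  have hd2 : ∀ n, deriv (deriv fun s => e (ε n * s) * f s) = fun s =>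
      (ε n * (ε n * deriv (deriv e) (ε n * s)) * f s + ε n * deriv e (ε n * s) * f₁ s) +
        (ε n * deriv e (ε n * s) * f₁ s + e (ε n * s) * secondDeriv f s) := fun n => by
    rw [hd1]
    exact funext fun s => ((((hsc he' n s).const_mul _).mul (hf s)).add
      ((hsc he n s).mul (hf₁ s))).deriv
  have hcs : ∀ n, ContDiff ℝ ∞ fun s => e (ε n * s) * f s := fun n =>
    (he.comp (contDiff_const.mul contDiff_id)).mul (f.smooth ⊤)
  have hel : ∀ {g : ℝ → ℂ}, Continuous g → ∀ s, Tendsto (fun n => g (ε n * s)) atTop (𝓝 (g 0)) :=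
    fun {g} hg s => by
      have := (hg.tendsto 0).comp ((hε0.mul_const s).trans_eq (by rw [zero_mul]))
      exact this
  have hεc : Tendsto (fun n => (ε n : ℂ)) atTop (𝓝 0) := by
    simpa [Function.comp_def] using (Complex.continuous_ofReal.tendsto 0).comp hε0
  have hεn : ∀ n, ‖(ε n : ℂ)‖ ≤ 1 := fun n => by
    rw [Complex.norm_real, Real.norm_of_nonneg (hε n).le]; exact hε1 n
  refine ⟨fun n s => e (ε n * s) * f s, hcs, fun n => ?_, ?_, ?_⟩
  · exact (hec.comp_homeomorph (Homeomorph.mulLeft₀ (ε n) (hε n).ne')).mul_right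
  · refine tendsto_toL2 (B := fun s => C₀ * ‖f s‖ + ‖f s‖) (((f.memLp 2).norm.const_mul _).add
      (f.memLp 2).norm) (Eventually.of_forall fun n => (hcs n).continuous.aestronglyMeasurable)
      f.continuous.aestronglyMeasurable (Eventually.of_forall fun n => Eventually.of_forall fun s => ?_)
      (Eventually.of_forall fun s => ?_) (Eventually.of_forall fun s => ?_)
    · rw [norm_mul]
      exact le_add_of_le_of_nonneg (mul_le_mul_of_nonneg_right (hC₀ _) (norm_nonneg _))
        (norm_nonneg _)
    · exact le_add_of_nonneg_left (mul_nonneg ((norm_nonneg _).trans (hC₀ 0)) (norm_nonneg _))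
    · simpa [he0] using (hel he.continuous s).mul_const (f s)
  · simp only [hd2]
    refine tendsto_toL2 (B := fun s => (C₂ * ‖f s‖ + C₁ * ‖f₁ s‖) +
      (C₁ * ‖f₁ s‖ + (C₀ + 1) * ‖secondDeriv f s‖))
      ((((f.memLp 2).norm.const_mul _).add ((f₁.memLp 2).norm.const_mul _)).add
      (((f₁.memLp 2).norm.const_mul _).add (((secondDeriv f).memLp 2).norm.const_mul _)))
      (Eventually.of_forall fun n => ?_)
      (secondDeriv f).continuous.aestronglyMeasurable
      (Eventually.of_forall fun n => Eventually.of_forall fun s => ?_)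
      (Eventually.of_forall fun s => ?_) (Eventually.of_forall fun s => ?_)
    · refine Continuous.aestronglyMeasurable ?_
      have := f.continuous
      have := f₁.continuous
      have := (secondDeriv f).continuous
      have := he.continuous
      have := he'.continuous
      have := he''.continuous
      fun_prop
    · have b1 : ∀ {g : ℝ → ℂ} {C : ℝ}, (∀ s, ‖g s‖ ≤ C) → ‖(ε n : ℂ) * g (ε n * s)‖ ≤ C :=
        fun {g C} hg => by
          rw [norm_mul]
          exact (mul_le_of_le_one_left (norm_nonneg _) (hεn n)).trans (hg _)
      have b2 : ‖(ε n : ℂ) * (ε n * deriv (deriv e) (ε n * s))‖ ≤ C₂ := by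
        rw [norm_mul]
        exact (mul_le_of_le_one_left (norm_nonneg _) (hεn n)).trans (b1 hC₂)
      refine (norm_add_le _ _).trans (add_le_add ((norm_add_le _ _).trans (add_le_add ?_ ?_))
        ((norm_add_le _ _).trans (add_le_add ?_ ?_))) <;> rw [norm_mul]
      · exact mul_le_mul_of_nonneg_right b2 (norm_nonneg _)
      · exact mul_le_mul_of_nonneg_right (b1 hC₁) (norm_nonneg _)
      · exact mul_le_mul_of_nonneg_right (b1 hC₁) (norm_nonneg _)
      · exact mul_le_mul_of_nonneg_right ((hC₀ _).trans (by linarith)) (norm_nonneg _)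
    · have h₀ := (norm_nonneg _).trans (hC₀ 0)
      nlinarith [norm_nonneg (f s), norm_nonneg (f₁ s), norm_nonneg (secondDeriv f s),
        mul_nonneg h₁ (norm_nonneg (f₁ s)), mul_nonneg h₂ (norm_nonneg (f s)),
        mul_nonneg h₀ (norm_nonneg (secondDeriv f s))]
    · have t1 := (hεc.mul (hel he'.continuous s))
      have t2 := (hεc.mul (hεc.mul (hel he''.continuous s)))
      simpa [he0] using ((t2.mul_const (f s)).add (t1.mul_const (f₁ s))).add
        ((t1.mul_const (f₁ s)).add ((hel he.continuous s).mul_const (secondDeriv f s)))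

/-- The weak equation on the Fourier side. -/
theorem fourierL2_eq_of_inner_eq {A B : L2R}
    (h : ∀ ψ : ℝ → ℂ, ContDiff ℝ ∞ ψ → HasCompactSupport ψ →
      inner ℂ (toL2 ψ) B = Complex.I * inner ℂ (toL2 (deriv (deriv ψ))) A) :
    fourierL2 B =ᵐ[volume] fun ξ => -Complex.I * freq ξ * fourierL2 A ξ := by
  -- The identity has to reach Schwartz functions: localising in frequency means testing with
  -- inverse Fourier transforms of compactly supported functions, which are Schwartz but in general
  -- not compactly supported.
  have hS : ∀ f : 𝓢(ℝ, ℂ), inner ℂ (toL2 f) B = Complex.I * inner ℂ (toL2 (secondDeriv f)) A := by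
    intro f
    obtain ⟨ψ, h1, h2, h3, h4⟩ := exists_cutoff f
    have h5 := h3.inner (tendsto_const_nhds (x := B)) (𝕜 := ℂ)
    have h6 := (h4.inner (tendsto_const_nhds (x := A)) (𝕜 := ℂ)).const_mul Complex.I
    refine tendsto_nhds_unique h5 (h6.congr fun n => (h _ (h1 n) (h2 n)).symm)
  have hlB : LocallyIntegrable (fourierL2 B) volume :=
    (Lp.memLp (fourierL2 B)).locallyIntegrable one_le_two
  have hlA : LocallyIntegrable (fun ξ => Complex.I * freq ξ * fourierL2 A ξ) volume := by
    rw [← locallyIntegrableOn_univ]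
    refine LocallyIntegrableOn.continuousOn_mul ?_ ?_ isOpen_univ.isLocallyClosed
    · rw [locallyIntegrableOn_univ]
      exact (Lp.memLp (fourierL2 A)).locallyIntegrable one_le_two
    · have := continuous_freq
      fun_prop
  have key := ae_eq_zero_of_integral_contDiff_smul_eq_zero (hlB.add hlA) fun g g1 g2 => ?_
  · filter_upwards [key] with ξ hξ
    rw [Pi.add_apply] at hξ
    linear_combination hξ
  · have hgs : ContDiff ℝ ∞ fun ξ => (g ξ : ℂ) := Complex.ofRealCLM.contDiff.comp g1
    have hgc : HasCompactSupport fun ξ => (g ξ : ℂ) := g2.comp_left Complex.ofReal_zero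
    let ζ : 𝓢(ℝ, ℂ) := hgc.toSchwartzMap hgs
    have hζ : ∀ ξ, ζ ξ = g ξ := fun ξ => rfl
    have h1 := hS (𝓕⁻ ζ)
    have h2 : (𝓕 (𝓕⁻ ζ : 𝓢(ℝ, ℂ)) : 𝓢(ℝ, ℂ)) = ζ :=
      FourierTransform.fourier_fourierInv_eq (F := 𝓢(ℝ, ℂ)) ζ
    have h3 : ∀ ξ, (𝓕 (secondDeriv (𝓕⁻ ζ)) : 𝓢(ℝ, ℂ)) ξ = -(freq ξ : ℂ) * g ξ := fun ξ => by
      rw [fourier_secondDeriv, h2, hζ]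
    rw [← fourierL2.inner_map_map, ← fourierL2.inner_map_map (toL2 (secondDeriv _)),
      fourierL2_toL2, fourierL2_toL2, h2, inner_toL2 (ζ.memLp 2),
      inner_toL2 ((𝓕 (secondDeriv (𝓕⁻ ζ)) : 𝓢(ℝ, ℂ)).memLp 2)] at h1
    simp only [h3, hζ, map_mul, map_neg, Complex.conj_ofReal] at h1
    have i1 : Integrable fun ξ => (g ξ : ℂ) * fourierL2 B ξ :=
      (ζ.memLp 2).integrable_mul (Lp.memLp (fourierL2 B))
    have i2 : Integrable fun ξ => fourierL2 A ξ * (-(freq ξ : ℂ) * g ξ) := by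
      have := (Lp.memLp (fourierL2 A)).integrable_mul
        ((𝓕 (secondDeriv (𝓕⁻ ζ)) : 𝓢(ℝ, ℂ)).memLp 2)
      refine this.congr (Eventually.of_forall fun ξ => ?_)
      simp only [Pi.mul_apply, h3]
    calc ∫ ξ, g ξ • (fourierL2 B + fun ξ => Complex.I * freq ξ * fourierL2 A ξ) ξ
        = ∫ ξ, ((g ξ : ℂ) * fourierL2 B ξ -
            Complex.I * (fourierL2 A ξ * (-(freq ξ : ℂ) * g ξ))) := by
          congr 1; ext ξ
          simp only [Pi.add_apply, Complex.real_smul]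
          ring
      _ = 0 := by
          rw [integral_sub i1 (i2.const_mul _), integral_const_mul, ← h1, sub_eq_zero]
          congr 1; ext ξ; ring

end WeakFree

/-! ### Energy estimate for weak solutions and Gronwall's inequality -/

section Energy

open scoped ENNReal ComplexConjugate BoundedContinuousFunction

theorem one_le_one_add_freq (n : ℕ) (ξ : ℝ) : 1 ≤ 1 + freq ξ / (n + 1) :=
  le_add_of_nonneg_right (div_nonneg (freq_nonneg ξ) (by positivity))

/-- The Fourier multiplier `(1 + λ/(n+1))⁻¹`. -/
noncomputable def resSymbol (n : ℕ) : ℝ →ᵇ ℂ :=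
  BoundedContinuousFunction.ofNormedAddCommGroup
    (fun ξ => ((1 + freq ξ / (n + 1) : ℝ) : ℂ)⁻¹)
    (Continuous.inv₀ (by have := continuous_freq; fun_prop) fun ξ => by
      exact_mod_cast (zero_lt_one.trans_le (one_le_one_add_freq n ξ)).ne') 1
    (fun ξ => by
      rw [norm_inv, Complex.norm_real]
      exact inv_le_one_of_one_le₀ ((one_le_one_add_freq n ξ).trans (Real.le_norm_self _)))

theorem resSymbol_apply (n : ℕ) (ξ : ℝ) :
    resSymbol n ξ = ((1 + freq ξ / (n + 1) : ℝ) : ℂ)⁻¹ := rfl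

theorem norm_resSymbol_le (n : ℕ) (ξ : ℝ) : ‖resSymbol n ξ‖ ≤ 1 := by
  rw [resSymbol_apply, norm_inv, Complex.norm_real]
  exact inv_le_one_of_one_le₀ ((one_le_one_add_freq n ξ).trans (Real.le_norm_self _))

/-- The Fourier multiplier `λ (1 + λ/(n+1))⁻¹`. -/
noncomputable def freqResSymbol (n : ℕ) : ℝ →ᵇ ℂ :=
  BoundedContinuousFunction.ofNormedAddCommGroup (fun ξ => (freq ξ : ℂ) * resSymbol n ξ)
    (by have := continuous_freq; have := (resSymbol n).continuous; fun_prop) (n + 1)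
    (fun ξ => by
      have h := zero_lt_one.trans_le (one_le_one_add_freq n ξ)
      rw [resSymbol_apply, norm_mul, norm_inv, Complex.norm_real, Complex.norm_real,
        Real.norm_of_nonneg (freq_nonneg ξ), Real.norm_of_nonneg h.le, ← div_eq_mul_inv,
        div_le_iff₀ h]
      have : ((n : ℝ) + 1) * (freq ξ / (n + 1)) = freq ξ := by field_simp
      nlinarith [freq_nonneg ξ, (Nat.cast_nonneg n : (0 : ℝ) ≤ n)])

theorem freqResSymbol_apply (n : ℕ) (ξ : ℝ) :
    freqResSymbol n ξ = (freq ξ : ℂ) * resSymbol n ξ := rfl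

theorem star_resSymbol (n : ℕ) : star (resSymbol n) = resSymbol n := by
  ext ξ
  rw [BoundedContinuousFunction.star_apply, resSymbol_apply, ← Complex.ofReal_inv]
  exact Complex.conj_ofReal _

theorem star_freqResSymbol (n : ℕ) : star (freqResSymbol n) = freqResSymbol n := by
  ext ξ
  rw [BoundedContinuousFunction.star_apply, freqResSymbol_apply, resSymbol_apply,
    ← Complex.ofReal_inv, ← Complex.ofReal_mul]
  exact Complex.conj_ofReal _

theorem tendsto_mulL2_resSymbol (f : L2R) :
    Tendsto (fun n => mulL2 (resSymbol n) f) atTop (𝓝 f) := by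
  have h := tendsto_mulL2 (m := resSymbol) (m₀ := 1) (C := 1) (l := atTop)
    (Eventually.of_forall norm_resSymbol_le) (fun ξ => by simp) (fun ξ => ?_) f
  · rwa [mulL2_one] at h
  · have h1 : Tendsto (fun n : ℕ => 1 + freq ξ / ((n : ℝ) + 1)) atTop (𝓝 (1 + 0)) :=
      tendsto_const_nhds.add (by
        simpa [div_eq_mul_inv] using
          (tendsto_one_div_add_atTop_nhds_zero_nat (𝕜 := ℝ)).const_mul (freq ξ))
    have h2 := ((Complex.continuous_ofReal.tendsto _).comp h1).inv₀ (by simp)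
    simpa [Function.comp_def, resSymbol_apply] using h2

/-- The energy estimate for weak solutions of the inhomogeneous equation. -/
theorem norm_le_integral_of_fourier_eq {D N : ℝ → L2R} {T : ℝ} (hD : Continuous D)
    (hN : IntegrableOn N (Ioc 0 T))
    (h : ∀ t ∈ Icc 0 T, fourierL2 (D t - ∫ r in Ioc 0 t, N r) =ᵐ[volume]
      fun ξ => -Complex.I * freq ξ * fourierL2 (∫ r in Ioc 0 t, D r) ξ) {t : ℝ}
    (ht : t ∈ Icc 0 T) : ‖D t‖ ≤ ∫ r in Ioc 0 t, ‖N r‖ := by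
  let F : L2R →L[ℂ] L2R := fourierL2.toContinuousLinearEquiv.toContinuousLinearMap
  have hF : ∀ x, F x = fourierL2 x := fun x => rfl
  have hDi : ∀ {t}, IntegrableOn D (Ioc 0 t) := hD.integrableOn_Ioc
  have hNt : ∀ {r}, r ∈ Icc 0 T → IntegrableOn N (Ioc 0 r) := fun hr =>
    hN.mono_set (Ioc_subset_Ioc_right hr.2)
  have main : ∀ n : ℕ, ‖mulL2 (resSymbol n) (F (D t))‖ ≤ ∫ r in Ioc 0 t, ‖N r‖ := by
    intro n
    -- D(t) need not lie in the domain of ∂². The multiplier (1 + λ/(n+1))⁻¹ repairs this: its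
    -- product with λ is bounded by n + 1, so the regularised equation is an integral equation in L²
    -- with integrable source k.
    set b : L2R →L[ℂ] L2R := (mulL2 (resSymbol n)).comp F with hb
    set M : L2R →L[ℂ] L2R := (mulL2 (freqResSymbol n)).comp F with hM
    let k : ℝ → L2R := fun r => b (N r) + (-Complex.I) • M (D r)
    have hk : ∀ {r}, r ∈ Icc 0 T → IntegrableOn k (Ioc 0 r) := fun hr =>
      (b.integrable_comp (hNt hr)).add ((M.integrable_comp hDi).smul (-Complex.I))
    have hY : ∀ r ∈ Icc 0 T, b (D r) = ∫ x in Ioc 0 r, k x := by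
      intro r hr
      have h1 : b (D r - ∫ x in Ioc 0 r, N x) = (-Complex.I) • M (∫ x in Ioc 0 r, D x) := by
        refine Lp.ext ?_
        filter_upwards [h r hr, coeFn_mulL2 (resSymbol n) (F (D r - ∫ x in Ioc 0 r, N x)),
          coeFn_mulL2 (freqResSymbol n) (F (∫ x in Ioc 0 r, D x)),
          Lp.coeFn_smul (-Complex.I) (M (∫ x in Ioc 0 r, D x))] with ξ e1 e2 e3 e4
        rw [e4, Pi.smul_apply, hb, hM, ContinuousLinearMap.comp_apply,
          ContinuousLinearMap.comp_apply, e2, e3, hF, hF, e1, freqResSymbol_apply, smul_eq_mul]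
        ring
      have h2 : ∫ x in Ioc 0 r, k x =
          (∫ x in Ioc 0 r, b (N x)) + ∫ x in Ioc 0 r, (-Complex.I) • M (D x) :=
        integral_add (b.integrable_comp (hNt hr)) ((M.integrable_comp hDi).smul (-Complex.I))
      rw [h2, integral_smul, b.integral_comp_comm (hNt hr), M.integral_comp_comm hDi, ← h1, map_sub]
      abel
    have hfy : (fun ξ => (freq ξ : ℂ) * b (D t) ξ) =ᵐ[volume] M (D t) := by
      filter_upwards [coeFn_mulL2 (resSymbol n) (F (D t)),
        coeFn_mulL2 (freqResSymbol n) (F (D t))] with ξ e1 e2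
      rw [hb, hM, ContinuousLinearMap.comp_apply, ContinuousLinearMap.comp_apply, e1, e2,
        freqResSymbol_apply]
      ring
    have hmem : MemLp (fun ξ => (freq ξ : ℂ) * b (D t) ξ) 2 volume :=
      (memLp_congr_ae hfy).2 (Lp.memLp _)
    have hz : toL2 (fun ξ => -Complex.I * (freq ξ * b (D t) ξ)) = (-Complex.I) • M (D t) := by
      rw [toL2_const_mul _ hmem, toL2_congr hfy, toL2_coeFn]
    -- The regularised equation is paired with the free solution that equals b(D t) at r = t. Real
    -- multipliers commute and are symmetric, so the terms with λ cancel and ‖b(D t)‖² becomes the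
    -- integral of its pairing with b(N r).
    have hψ : ∀ r, HasDerivAt (fun r => mulL2 (propSymbol (r - t)) (b (D t)))
        (mulL2 (propSymbol (r - t)) ((-Complex.I) • M (D t))) r := fun r => by
      rw [← hz]
      exact (hasDerivAt_mulL2_propSymbol (b (D t)) hmem (r - t)).comp_sub_const r t
    have hψ' : Continuous fun r => mulL2 (propSymbol (r - t)) ((-Complex.I) • M (D t)) :=
      (continuous_mulL2_propSymbol ((-Complex.I) • M (D t))).comp (continuous_id.sub continuous_const)
    have hψc : Continuous fun r => mulL2 (propSymbol (r - t)) (b (D t)) :=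
      (continuous_mulL2_propSymbol (b (D t))).comp (continuous_id.sub continuous_const)
    have e := integral_inner_deriv hψ hψ' (hk ht)
    rw [sub_self, propSymbol_zero, mulL2_one, ← hY t ht] at e
    have hcomm : ∀ r, inner ℂ (mulL2 (propSymbol (r - t)) ((-Complex.I) • M (D t))) (b (D r)) +
        inner ℂ (mulL2 (propSymbol (r - t)) (b (D t))) (k r) =
        inner ℂ (mulL2 (propSymbol (r - t)) (b (D t))) (b (N r)) := by
      intro r
      have h1 : inner ℂ (mulL2 (propSymbol (r - t)) (M (D t))) (b (D r)) =
          inner ℂ (mulL2 (propSymbol (r - t)) (b (D t))) (M (D r)) := by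
        rw [hb, hM]
        simp only [ContinuousLinearMap.comp_apply]
        rw [mulL2_mulL2, mulL2_mulL2, inner_mulL2_left, inner_mulL2_left, mulL2_mulL2, mulL2_mulL2,
          star_mul, star_mul, star_resSymbol, star_freqResSymbol]
        congr 3
        ring
      simp only [k]
      rw [map_smul, inner_smul_left, inner_add_right, inner_smul_right, h1]
      simp
    have i1 : IntegrableOn (fun r => inner ℂ (mulL2 (propSymbol (r - t)) ((-Complex.I) • M (D t)))
        (b (D r))) (Ioc 0 t) := (hψ'.inner (b.continuous.comp hD)).integrableOn_Ioc
    have i2 := integrableOn_inner hψc (hk ht)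
    have e2 : ∫ r in Ioc 0 t, inner ℂ (mulL2 (propSymbol (r - t)) ((-Complex.I) • M (D t)))
        (b (D r)) = ∫ r in Ioc 0 t, inner ℂ (mulL2 (propSymbol (r - t)) ((-Complex.I) • M (D t)))
        (∫ x in Ioc 0 r, k x) :=
      setIntegral_congr_fun measurableSet_Ioc fun r hr => by
        rw [hY r ⟨hr.1.le, hr.2.trans ht.2⟩]
    rw [← e2, eq_sub_iff_add_eq, ← integral_add i1 i2] at e
    simp only [hcomm] at e
    have h1 : ‖b (D t)‖ * ‖b (D t)‖ ≤ ‖b (D t)‖ * ∫ r in Ioc 0 t, ‖N r‖ := by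
      have h2 : ‖b (D t)‖ * ‖b (D t)‖ = ‖inner ℂ (b (D t)) (b (D t))‖ := by
        rw [inner_self_eq_norm_sq_to_K, norm_pow, RCLike.norm_ofReal, abs_norm, sq]
      rw [h2, ← e, ← integral_const_mul]
      refine norm_integral_le_of_norm_le ((hNt ht).norm.const_mul _)
        (Eventually.of_forall fun r => (norm_inner_le_norm _ _).trans ?_)
      rw [norm_mulL2_propSymbol]
      refine mul_le_mul_of_nonneg_left ?_ (norm_nonneg _)
      refine (norm_mulL2_le (resSymbol n) zero_le_one (norm_resSymbol_le n) _).trans ?_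
      rw [one_mul]
      exact (fourierL2.norm_map (N r)).le
    rcases (norm_nonneg (b (D t))).eq_or_lt with h0 | h0
    · change ‖b (D t)‖ ≤ _
      rw [← h0]
      exact integral_nonneg fun _ => norm_nonneg _
    · exact le_of_mul_le_mul_left h1 h0
  have hlim := (tendsto_mulL2_resSymbol (F (D t))).norm
  rw [hF, LinearIsometryEquiv.norm_map] at hlim
  exact le_of_tendsto' hlim main

/-- Weak solutions of the inhomogeneous equation with zero data are controlled by the source. -/
theorem IsWeakFree.norm_le {D N : ℝ → L2R} {T : ℝ} (h : IsWeakFree T D N) (hT : 0 < T)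
    (hD : Continuous D) (h0 : D 0 = 0) (hN : IntegrableOn N (Ioc 0 T)) {t : ℝ}
    (ht : t ∈ Icc 0 T) : ‖D t‖ ≤ ∫ r in Ioc 0 t, ‖N r‖ :=
  norm_le_integral_of_fourier_eq hD hN (fun t ht => fourierL2_eq_of_inner_eq fun ψ h1 h2 => by
    simpa [h0] using h.inner_eq hT hD hN h1 h2 ht) ht

/-- Gronwall's inequality with an integrable weight and zero data. -/
theorem eq_zero_of_le_integral {f κ : ℝ → ℝ} {T : ℝ} (hf : Continuous f) (hf0 : ∀ t, 0 ≤ f t)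
    (hκ : IntegrableOn κ (Ioc 0 T)) (hκ0 : ∀ t, 0 ≤ κ t)
    (h : ∀ t ∈ Icc 0 T, f t ≤ ∫ r in Ioc 0 t, κ r * f r) {t : ℝ} (ht : t ∈ Icc 0 T) :
    f t = 0 := by
  by_contra hne
  let Z : Set ℝ := {r | r ∈ Icc 0 T ∧ f r ≠ 0}
  have hZ : Z.Nonempty := ⟨t, ht, hne⟩
  have hZb : BddBelow Z := ⟨0, fun r hr => hr.1.1⟩
  -- The function f vanishes up to a, inclusive. On a short interval [a, y] where κ has integral
  -- below 1/2, the maximum of f is at most half of itself, so f vanishes up to y, contradicting the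
  -- infimum.
  set a := sInf Z with ha
  have ha0 : 0 ≤ a := le_csInf hZ fun r hr => hr.1.1
  have hat : a ≤ t := csInf_le hZb ⟨ht, hne⟩
  have hlt : ∀ r, 0 ≤ r → r < a → f r = 0 := fun r h1 h2 => by
    by_contra h3
    exact notMem_of_lt_csInf h2 hZb ⟨⟨h1, h2.le.trans (hat.trans ht.2)⟩, h3⟩
  have hfa : f a = 0 := by
    refine le_antisymm ((h a ⟨ha0, hat.trans ht.2⟩).trans (le_of_eq ?_)) (hf0 a)
    rw [integral_Ioc_eq_integral_Ioo]
    refine setIntegral_eq_zero_of_forall_eq_zero fun r hr => ?_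
    rw [hlt r hr.1.le hr.2, mul_zero]
  have hat' : a < t := lt_of_le_of_ne hat fun h => hne (h ▸ hfa)
  have hκI : IntegrableOn κ (Icc 0 T) := (integrableOn_Icc_iff_integrableOn_Ioc (by simp)).2 hκ
  have hP : ContinuousOn (fun t => ∫ r in Ioc 0 t, κ r) (Icc 0 T) :=
    intervalIntegral.continuousOn_primitive hκI
  obtain ⟨y, hy, hyκ⟩ : ∃ y ∈ Ioc a t, ∫ r in Ioc a y, κ r < 1 / 2 := by
    have h1 : ContinuousWithinAt (fun t => ∫ r in Ioc 0 t, κ r) (Ioc a t) a :=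
      (hP a ⟨ha0, hat.trans ht.2⟩).mono fun r hr => ⟨ha0.trans hr.1.le, hr.2.trans ht.2⟩
    have h2 : ∀ᶠ y in 𝓝[Ioc a t] a, ∫ r in Ioc 0 y, κ r < (∫ r in Ioc 0 a, κ r) + 1 / 2 :=
      h1.tendsto.eventually (gt_mem_nhds (by linarith))
    have : (𝓝[Ioc a t] a).NeBot := by
      rw [nhdsWithin_Ioc_eq_nhdsGT hat']; infer_instance
    obtain ⟨y, hy1, hy2⟩ := (h2.and self_mem_nhdsWithin).exists
    refine ⟨y, hy2, ?_⟩
    have h3 : ∫ r in Ioc 0 y, κ r = (∫ r in Ioc 0 a, κ r) + ∫ r in Ioc a y, κ r := by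
      rw [← Ioc_union_Ioc_eq_Ioc ha0 hy2.1.le]
      refine setIntegral_union (Ioc_disjoint_Ioc_of_le le_rfl) measurableSet_Ioc
        (hκ.mono_set (Ioc_subset_Ioc_right (hat.trans ht.2)))
        (hκ.mono_set (Ioc_subset_Ioc ha0 (hy2.2.trans ht.2)))
    linarith
  obtain ⟨x, hx, hmax⟩ := isCompact_Icc.exists_isMaxOn (nonempty_Icc.2 hy.1.le) hf.continuousOn
  have hxT : x ∈ Icc 0 T := ⟨ha0.trans hx.1, hx.2.trans (hy.2.trans ht.2)⟩
  have hle : f x ≤ 1 / 2 * f x := by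
    calc f x ≤ ∫ r in Ioc 0 x, κ r * f r := h x hxT
      _ = ∫ r in Ioc a x, κ r * f r := by
          refine setIntegral_eq_of_subset_of_forall_sdiff_eq_zero measurableSet_Ioc
            (Ioc_subset_Ioc_left ha0) fun r hr => ?_
          have hra : r ≤ a := by
            by_contra h'
            exact hr.2 ⟨not_le.1 h', hr.1.2⟩
          have : f r = 0 := by
            rcases hra.eq_or_lt with h' | h'
            · rw [h', hfa]
            · exact hlt r hr.1.1.le h'
          rw [this, mul_zero]
      _ ≤ ∫ r in Ioc a y, κ r * f x := by
          have hi : IntegrableOn (fun r => κ r * f x) (Ioc a y) :=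
            (hκ.mono_set (Ioc_subset_Ioc ha0 (hy.2.trans ht.2))).mul_const _
          have hi' : IntegrableOn (fun r => κ r * f r) (Ioc a x) :=
            (hκI.mul_continuousOn hf.continuousOn isCompact_Icc).mono_set fun r hr =>
              ⟨ha0.trans hr.1.le, hr.2.trans hxT.2⟩
          refine (setIntegral_mono_on hi' (hi.mono_set (Ioc_subset_Ioc_right hx.2))
            measurableSet_Ioc fun r hr => mul_le_mul_of_nonneg_left
              (hmax ⟨hr.1.le, hr.2.trans hx.2⟩) (hκ0 r)).trans (setIntegral_mono_set hi ?_ ?_)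
          · exact Eventually.of_forall fun r => mul_nonneg (hκ0 r) (hf0 x)
          · exact (Ioc_subset_Ioc_right hx.2).eventuallyLE
      _ = (∫ r in Ioc a y, κ r) * f x := integral_mul_const _ _
      _ ≤ 1 / 2 * f x := mul_le_mul_of_nonneg_right hyκ.le (hf0 x)
  have hfx : f x = 0 := le_antisymm (by linarith) (hf0 x)
  have hz : ∀ z ∈ Z, y ≤ z := fun z hz => by
    by_contra h'
    refine hz.2 (le_antisymm ?_ (hf0 z))
    rw [← hfx]
    exact hmax ⟨csInf_le hZb hz, (not_le.1 h').le⟩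
  exact absurd (le_csInf hZ hz) (not_le.2 hy.1)

end Energy

/-! ### Uniqueness in the full class -/

section Uniqueness

open scoped ENNReal ComplexConjugate

variable {a : ℂ} {α σ T : ℝ}

theorem IsTest.mono {φ : ℝ × ℝ → ℂ} {t : ℝ} (hφ : IsTest t φ) (h : t ≤ T) : IsTest T φ :=
  ⟨hφ.smooth, hφ.compact, hφ.support.trans (prod_mono (Ioo_subset_Ioo_right h) subset_rfl)⟩

theorem IsTest.setIntegral_inner_slice {φ : ℝ × ℝ → ℂ} {t : ℝ} (hφ : IsTest t φ) (h : t ≤ T)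
    (G : ℝ → L2R) :
    ∫ r in Ioo 0 T, inner ℂ (slice φ r) (G r) = ∫ r in Ioo 0 t, inner ℂ (slice φ r) (G r) :=
  setIntegral_eq_of_subset_of_forall_sdiff_eq_zero measurableSet_Ioo (Ioo_subset_Ioo_right h)
    fun r hr => by rw [hφ.slice_eq_zero hr.2, inner_zero_left]

theorem IsWeak.mono {V : ℝ → L2R} {t : ℝ} (hV : IsWeak a α σ T V) (h : t ≤ T) :
    IsWeak a α σ t V := fun φ hφ => by
  rw [← hφ.freeOp.setIntegral_inner_slice h, ← hφ.setIntegral_inner_slice h]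
  exact hV φ (hφ.mono h)

theorem IsWeak.congr {V W : ℝ → L2R} (hV : IsWeak a α σ T V) (h : EqOn V W (Ioo 0 T)) :
    IsWeak a α σ T W := fun φ hφ => by
  rw [← hV φ hφ]
  congr 1
  · exact setIntegral_congr_fun measurableSet_Ioo fun t ht => by simp only [h ht]
  · congr 1
    exact setIntegral_congr_fun measurableSet_Ioo fun t ht => by simp only [h ht]

theorem IsDistribSolution.isWeak {v : ℝ → ℝ → ℂ} (hv : IsDistribSolution α σ T v) (hα₀ : 0 ≤ α)
    (hα₂ : α < 2) {V : ℝ → L2R}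
    (hV : ∀ᵐ t ∂(volume.restrict (Ioo 0 T)), (fun s => v t s - diracSol a α σ t s) =ᵐ[volume] V t)
    (hVs : ∀ᵐ t ∂(volume.restrict (Ioo 0 T)), supNorm (V t) ≠ ⊤) : IsWeak a α σ T V := by
  intro φ hφ
  have h1 := integral_equation_eq hα₀ hα₂ hv.locInt hv.locInt_powerNL hV hVs hφ.conj
  rw [hv.weak _ hφ.conj.smooth hφ.conj.compact hφ.conj.support] at h1
  simp only [Complex.conj_conj] at h1
  exact (mul_eq_zero.1 h1.symm).resolve_left (neg_ne_zero.2 Complex.I_ne_zero)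

theorem integrableOn_lipWeight (hα₀ : 0 ≤ α) (hα₂ : α < 2) (hT : 0 ≤ T) {n : ℝ → ℝ≥0∞}
    (hn : Measurable n) (h : ∫⁻ t in Ioc 0 T, n t ^ 4 < ⊤) :
    IntegrableOn (fun t => lipWeight a α t (n t).toReal) (Ioc 0 T) := by
  have hm : Measurable fun t => lipWeight a α t (n t).toReal := by
    have := hn.ennreal_toReal
    unfold lipWeight
    fun_prop
  refine ⟨hm.aestronglyMeasurable, ?_⟩
  rw [hasFiniteIntegral_iff_ofReal (Eventually.of_forall fun t => by
    simp only [Pi.zero_apply]; unfold lipWeight; positivity)]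
  -- Only finiteness is needed here, so any δ serves, for instance δ = 1.
  exact (lintegral_lipWeight_le hα₀ hα₂ one_pos hT hn.aemeasurable le_rfl).trans_lt
    (ENNReal.add_lt_top.2 ⟨ENNReal.ofReal_lt_top, ENNReal.mul_lt_top ENNReal.ofReal_lt_top h⟩)

theorem integrableOn_nlDiff (hα₀ : 0 ≤ α) (hα₂ : α < 2) (hT : 0 ≤ T) {V : ℝ → L2R}
    (hV : Continuous V) (h : ∫⁻ t in Ioc 0 T, supNorm (V t) ^ 4 < ⊤) :
    IntegrableOn (fun t => nlDiff a α σ t (V t)) (Ioc 0 T) := by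
  have hκ := (integrableOn_lipWeight (a := a) hα₀ hα₂ hT
    (measurable_supNorm.comp hV.measurable) h)
  obtain ⟨C, hC⟩ := (isCompact_Icc (a := (0 : ℝ)) (b := T)).exists_bound_of_continuousOn
    hV.continuousOn
  refine (hκ.mul_const C).mono' (measurable_nlDiff a α σ hV.measurable).aestronglyMeasurable ?_
  filter_upwards [ae_supNorm_ne_top hV.measurable.aemeasurable h.ne,
    ae_restrict_mem measurableSet_Ioc] with t h1 ht
  have h2 := norm_nlDiff_sub_le (a := a) (σ := σ) (t := t) (g := 0) hα₀ hα₂.le h1 (by simp [supNorm_zero])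
  rw [nlDiff_zero, sub_zero, sub_zero, supNorm_zero, add_zero] at h2
  exact h2.trans (mul_le_mul_of_nonneg_left (hC t ⟨ht.1.le, ht.2⟩)
    (by unfold lipWeight; positivity))

/-- Uniqueness for the weak equation. -/
theorem IsWeak.eq (hα₀ : 0 ≤ α) (hα₂ : α < 2) (hσ : σ = 1 ∨ σ = -1) (hT : 0 < T) {V W : ℝ → L2R}
    (hV : IsWeak a α σ T V) (hW : IsWeak a α σ T W) (hVc : Continuous V) (hWc : Continuous W)
    (h0 : V 0 = W 0) (hVs : ∫⁻ t in Ioc 0 T, supNorm (V t) ^ 4 < ⊤)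
    (hWs : ∫⁻ t in Ioc 0 T, supNorm (W t) ^ 4 < ⊤) {t : ℝ} (ht : t ∈ Icc 0 T) : V t = W t := by
  have hiV := integrableOn_nlDiff (a := a) (σ := σ) hα₀ hα₂ hT.le hVc hVs
  have hiW := integrableOn_nlDiff (a := a) (σ := σ) hα₀ hα₂ hT.le hWc hWs
  -- The difference has zero data and source N with ‖N‖ at most an integrable weight times ‖D‖, so
  -- the energy estimate and Gronwall apply with no smallness of T.
  let D : ℝ → L2R := fun t => V t - W t
  let N : ℝ → L2R := fun t =>
    (Complex.I * σ) • (nlDiff a α σ t (V t) - nlDiff a α σ t (W t))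
  have hD : Continuous D := hVc.sub hWc
  have hN : IntegrableOn N (Ioc 0 T) := (hiV.sub hiW).smul (Complex.I * (σ : ℂ))
  have hDN : IsWeakFree T D N := by
    intro φ hφ
    have e1 := hV φ hφ
    have e2 := hW φ hφ
    simp only [← integral_Ioc_eq_integral_Ioo] at e1 e2 ⊢
    have hc := hφ.freeOp.continuous_slice
    have hc' := hφ.continuous_slice
    have i1 : ∀ {G : ℝ → L2R}, Continuous G →
        IntegrableOn (fun t => inner ℂ (slice (freeOp φ) t) (G t)) (Ioc 0 T) := fun {G} hG =>
      (hc.inner hG).integrableOn_Ioc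
    simp only [D, N, inner_smul_right, inner_sub_right]
    rw [integral_sub (i1 hVc) (i1 hWc), integral_const_mul,
      integral_sub (integrableOn_inner hc' hiV) (integrableOn_inner hc' hiW)]
    linear_combination e1 - e2
  let n : ℝ → ℝ≥0∞ := fun t => supNorm (V t) + supNorm (W t)
  have hmV := measurable_supNorm.comp hVc.measurable
  have hmW := measurable_supNorm.comp hWc.measurable
  have hn4 : ∫⁻ t in Ioc 0 T, n t ^ 4 < ⊤ := by
    have hb : ∀ x y : ℝ≥0∞, (x + y) ^ 4 ≤ 2 ^ 3 * (x ^ 4 + y ^ 4) := fun x y => by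
      have := ENNReal.rpow_add_le_mul_rpow_add_rpow x y (p := 4) (by norm_num)
      simpa [show (4 - 1 : ℝ) = 3 by norm_num] using this
    refine (lintegral_mono fun t => hb _ _).trans_lt ?_
    rw [lintegral_const_mul' _ _ (by simp), lintegral_add_left (f := fun t => supNorm (V t) ^ 4) (hmV.pow_const 4)]
    exact ENNReal.mul_lt_top (by simp) (ENNReal.add_lt_top.2 ⟨hVs, hWs⟩)
  have hκ := integrableOn_lipWeight (a := a) hα₀ hα₂ hT.le (hmV.add hmW) hn4
  have hDf : ∀ t ∈ Icc 0 T, ‖D t‖ ≤ ∫ r in Ioc 0 t, lipWeight a α r (n r).toReal * ‖D r‖ := by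
    intro t ht
    refine (hDN.norm_le hT hD (sub_eq_zero.2 h0) hN ht).trans ?_
    have hsub : Ioc 0 t ⊆ Ioc 0 T := Ioc_subset_Ioc_right ht.2
    refine integral_mono_ae (hN.mono_set hsub).norm ?_ ?_
    · have h1 : IntegrableOn (fun r => lipWeight a α r (n r).toReal * ‖D r‖) (Icc 0 T) :=
        ((integrableOn_Icc_iff_integrableOn_Ioc (by simp)).2 hκ).mul_continuousOn
          hD.norm.continuousOn isCompact_Icc
      exact h1.mono_set (hsub.trans Ioc_subset_Icc_self)
    · filter_upwards [ae_restrict_of_ae_restrict_of_subset hsub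
        (ae_supNorm_ne_top hVc.measurable.aemeasurable hVs.ne),
        ae_restrict_of_ae_restrict_of_subset hsub
        (ae_supNorm_ne_top hWc.measurable.aemeasurable hWs.ne)] with r h1 h2
      have hI : ‖Complex.I * (σ : ℂ)‖ = 1 := by rcases hσ with rfl | rfl <;> simp
      simp only [N]
      rw [norm_smul, hI, one_mul]
      exact norm_nlDiff_sub_le hα₀ hα₂.le h1 h2
  have hz := eq_zero_of_le_integral hD.norm (fun _ => norm_nonneg _) hκ
    (fun r => by unfold lipWeight; positivity) hDf ht
  exact sub_eq_zero.1 (norm_eq_zero.1 hz)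

theorem eq_of_integral_schwartz {f g : L2R}
    (h : ∀ φ : 𝓢(ℝ, ℂ), ∫ s, f s * φ s = ∫ s, g s * φ s) : f = g := by
  refine Lp.ext (ae_eq_of_integral_contDiff_smul_eq
    ((Lp.memLp f).locallyIntegrable one_le_two) ((Lp.memLp g).locallyIntegrable one_le_two)
    fun e h1 h2 => ?_)
  have hs : ContDiff ℝ ∞ fun ξ => (e ξ : ℂ) := Complex.ofRealCLM.contDiff.comp h1
  have hc : HasCompactSupport fun ξ => (e ξ : ℂ) := h2.comp_left Complex.ofReal_zero
  have := h (hc.toSchwartzMap hs)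
  simpa only [Complex.real_smul, mul_comm, HasCompactSupport.toSchwartzMap_toFun] using this

/-- Perturbed solutions agree with the solution of the Duhamel equation. -/
theorem IsPerturbedSolution.eq_mild {u₀ : L2R} {W : ℝ → L2R} {v : ℝ → ℝ → ℂ}
    (hv : IsPerturbedSolution α σ a u₀ T v) (hW : IsMild a α σ T u₀ W) (hα₀ : 0 ≤ α) (hα₂ : α < 2)
    (hσ : σ = 1 ∨ σ = -1) {t : ℝ} (ht : t ∈ Ioo 0 T) :
    (fun s => v t s - diracSol a α σ t s) =ᵐ[volume] W t := by
  have hT : 0 < T := ht.1.trans ht.2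
  obtain ⟨V, hVc, hV⟩ := hv.mem_CL2
  have hV' : ∀ᵐ t ∂(volume.restrict (Ioo 0 T)),
      (fun s => v t s - diracSol a α σ t s) =ᵐ[volume] V t := by
    filter_upwards [ae_restrict_mem measurableSet_Ioo] with r hr using hV r hr
  have hV4 : ∫⁻ r in Ioo 0 T, supNorm (V r) ^ 4 < ⊤ := by
    refine lt_of_le_of_lt (le_of_eq ?_) hv.mem_L4Linfty.2
    refine lintegral_congr_ae ?_
    filter_upwards [hV'] with r hr
    rw [supNorm, eLpNorm_congr_ae hr]
  have hVm : AEMeasurable V (volume.restrict (Ioo 0 T)) :=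
    (hVc.mono Ioo_subset_Ico_self).aemeasurable measurableSet_Ioo
  have hVw : IsWeak a α σ T V :=
    hv.equation.isWeak hα₀ hα₂ hV' (ae_supNorm_ne_top hVm hV4.ne)
  -- The Dirac parts of the two limits of u(t) coincide, so the distributional initial condition
  -- identifies V 0.
  have hV0 : V 0 = u₀ := eq_of_integral_schwartz fun φ => by
    have h1 := tendsto_nhds_unique (hv.initial φ)
      (tendsto_integral_perturbation hα₂ hT hVc hV φ)
    exact (add_right_cancel h1).symm
  have hW0 : W 0 = u₀ := by
    rw [hW.eq 0, source_primitive, Ioc_self, setIntegral_empty, add_zero, freeProp_zero]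
  -- V is continuous only on [0, T), possibly without a limit at T. Freezing it outside [0, t], for
  -- the fixed t < T, makes it continuous on ℝ.
  let V₁ : ℝ → L2R := fun r => V (projIcc 0 t ht.1.le r)
  have hV₁ : ∀ r ∈ Icc 0 t, V₁ r = V r := fun r hr => by
    simp only [V₁, projIcc_of_mem ht.1.le hr]
  have hV₁c : Continuous V₁ := by
    have h1 : ContinuousOn V (Icc 0 t) := hVc.mono fun r hr => ⟨hr.1, hr.2.trans_lt ht.2⟩
    exact (continuousOn_iff_continuous_domRestrict.1 h1).comp continuous_projIcc
  have hs : ∫⁻ r in Ioc 0 t, supNorm (V₁ r) ^ 4 < ⊤ := by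
    refine lt_of_le_of_lt ?_ hV4
    rw [setLIntegral_congr_fun (g := fun r => supNorm (V r) ^ 4) measurableSet_Ioc fun r hr => by
      simp only [hV₁ r ⟨hr.1.le, hr.2⟩]]
    exact lintegral_mono_set fun r hr => ⟨hr.1, hr.2.trans_lt ht.2⟩
  have heq := IsWeak.eq hα₀ hα₂ hσ ht.1
    ((hVw.mono ht.2.le).congr fun r hr => (hV₁ r (Ioo_subset_Icc_self hr)).symm)
    ((hW.isWeak hT).mono ht.2.le) hV₁c hW.cont
    (by rw [hV₁ 0 ⟨le_rfl, ht.1.le⟩, hV0, hW0]) hs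
    ((setLIntegral_le_lintegral _ _).trans_lt hW.supNorm_lt) ⟨ht.1.le, le_rfl⟩
  rw [← heq, hV₁ t ⟨ht.1.le, le_rfl⟩]
  exact hV t ht

end Uniqueness

end DiracNLS

/-! ### Well-posedness on a time depending on a and the norm of the data -/

theorem mainTheorem6 (α : ℝ) (hα₀ : 0 ≤ α) (hα₂ : α < 2) :
    ∃ T : ℂ → ℝ → ℝ, ∀ (σ : ℝ), σ = 1 ∨ σ = -1 →
      ∀ (a : ℂ) (u₀ : Lp ℂ 2 (volume : Measure ℝ)),
        0 < T a ‖u₀‖ ∧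
        ∃ u : ℝ → ℝ → ℂ,
          DiracNLS.IsPerturbedSolution α σ a u₀ (T a ‖u₀‖) u ∧
          ∀ v : ℝ → ℝ → ℂ, DiracNLS.IsPerturbedSolution α σ a u₀ (T a ‖u₀‖) v →
            ∀ t ∈ Ioo 0 (T a ‖u₀‖), v t =ᵐ[volume] u t := by
  have hM : ∀ m : ℝ, 0 ≤ (8 * (2 * m)) ^ 4 := fun m => by positivity
  -- The contraction runs with radius R = 2m, where m stands for ‖u₀‖. Time and δ are chosen from a
  -- and m alone, before the sign and the data are given.
  choose T δ hT hδ hsmall using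
    fun (a : ℂ) (m : ℝ) => DiracNLS.exists_time a hα₂ ((8 * (2 * m)) ^ 4) (hM m)
  refine ⟨T, fun σ hσ a u₀ => ⟨hT a _, ?_⟩⟩
  obtain ⟨W, hW⟩ := DiracNLS.exists_isMild (σ := σ) hα₀ hα₂ hσ (hT a ‖u₀‖).le (hδ a ‖u₀‖) u₀
    le_rfl (hsmall a ‖u₀‖)
  obtain ⟨u, hu, huW⟩ := hW.exists_isPerturbedSolution hα₀ hα₂ hσ (hT a ‖u₀‖)
  refine ⟨u, hu, fun v hv t ht => ?_⟩
  filter_upwards [hv.eq_mild hW hα₀ hα₂ hσ ht, huW t] with s h1 h2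
  exact sub_left_injective (h1.trans h2.symm)
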